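/- Let $d\ge 1$, $\mathbb{R}^d_+=(0,\infty)^d$ with Lebesgue measure, $L^p=L^p(\mathbb{R}^d_+,dx)$ (real- or complex-valued functions), and $\alpha\in[-1/2,\infty)^d$. For $k\in\mathbb{N}^d$ let $\varphi_k^\alpha(x)=\prod_{i=1}^d\varphi_{k_i}^{\alpha_i}(x_i)$, where, for $a>-1$, $n\in\mathbb{N}$, $u>0$, $$\varphi_n^{a}(u)=\sqrt2\,\Big(\frac{\Gamma(n+1)}{\Gamma(n+a+1)}\Big)^{1/2}L_n^{a}(u^2)\,u^{a+1/2}e^{-u^2/2},$$ and $L_n^a$ is the Laguerre polynomial of degree $n$ and order $a$. These functions form an orthonormal basis of $L^2$. Let $L_\alpha^\varphi$ be the self-adjoint extension of $-\Delta+\|x\|^2+\sum_{i=1}^d x_i^{-2}(\alpha_i^2-\tfrac14)$ whose spectral decomposition is given by $L_\alpha^\varphi\varphi_k^\alpha=(4|k|+2|\alpha|+2d)\varphi_k^\alpha$, where $|k|=\sum_i k_i$ and $|\alpha|=\sum_i\alpha_i$. For $t>0$ put $$G_t^{\alpha,\varphi}(x,y)=\sum_{k\in\mathbb{N}^d}e^{-t(4|k|+2|\alpha|+2d)}\varphi_k^\alpha(x)\varphi_k^\alpha(y),\qquad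 T_t^{\alpha,\varphi}f(x)=\int_{\mathbb{R}^d_+}G_t^{\alpha,\varphi}(x,y)f(y)\,dy,$$ for $f\in L^1+L^\infty$, and $T_0^{\alpha,\varphi}=\mathrm{Id}$. A symmetric diffusion semigroup is a family $\{T_t\}_{t\ge0}$ of linear operators from $L^1+L^\infty$ into the measurable functions, with $T_0=\mathrm{Id}$, such that (i) for all $1\le p\le\infty$ every $T_t$ is a contraction on $L^p$ and $\{T_t\}$ is a semigroup there; (ii) every $T_t$ is self-adjoint on $L^2$; (iii) $T_tf\to f$ in $L^2$ as $t\to0^+$ for every $f\in L^2$. It is Markovian if in addition (iv) $T_tf\ge0$ whenever $f\ge0$, and (v) $T_t\mathbf{1}=\mathbf{1}$ for all $t$; it is submarkovian if (i)-(iv) hold and $T_t\mathbf{1}\le\mathbf{1}$ for all $t$. The family $\{T_t\}$ is called $L^p$-contractive if $\|T_tf\|_p\le\|f\|_p$ for all $1\le p\le\infty$, all $t\ge0$ and all $f\in L^2\cap L^p$. All relations between functions are understood almost everywhere. Theorem. The series defining $G_t^{\alpha,\varphi}(x,y)$ converges absolutely for all $t>0$ and $x,y\in\mathbb{R}^d_+$;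 the integral defining $T_t^{\alpha,\varphi}f(x)$ converges absolutely for all $t>0$, $f\in L^1+L^\infty$ and $x\in\mathbb{R}^d_+$; and on $L^2$ the operators $T_t^{\alpha,\varphi}$ coincide with $\exp(-tL_\alpha^\varphi)$, that is, $T_t^{\alpha,\varphi}f=\sum_k e^{-t(4|k|+2|\alpha|+2d)}\langle f,\varphi_k^\alpha\rangle\varphi_k^\alpha$ in $L^2$ for all $t\ge0$ and $f\in L^2$. Moreover: (a) If $\alpha_i\in\{-1/2\}\cup[1/2,\infty)$ for every $i$, then $\{T_t^{\alpha,\varphi}\}$ is a submarkovian, but not Markovian, symmetric diffusion semigroup, and for all $1\le p\le\infty$ $$\|T_t^{\alpha,\varphi}\|_{p\to p}\le(\cosh 2t)^{-d/2},\qquad t>0.$$ (b) If $\alpha_i\in(-1/2,1/2)$ for some $i$, then $\{T_t^{\alpha,\varphi}\}$ is not $L^p$-contractive, but there is a constant $c=c(\alpha)>1$ such that for all $1\le p\le\infty$ $$\|T_t^{\alpha,\varphi}\|_{p\to p}\le c\,(\cosh 2t)^{-d/2},\qquad t>0.$$ -/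

import Mathlib

open MeasureTheory Filter Topology
open scoped ENNReal NNReal ComplexOrder ComplexConjugate

noncomputable section

/-! ### Symmetric diffusion semigroups

Operators act on functions `X → 𝕜`, regarded modulo `μ`-a.e. equality.
A family `{T_t}_{t ≥ 0}` is indexed by `t : ℝ≥0`. -/

section Semigroups

/-- `f` belongs to `L¹(μ) + L^∞(μ)`, the common domain of the semigroups considered. -/
def MemL1AddLinfty {X 𝕜 : Type*} [MeasurableSpace X] [RCLike 𝕜]
    (μ : Measure X) (f : X → 𝕜) : Prop :=
  ∃ g h : X → 𝕜, MemLp g 1 μ ∧ MemLp h ∞ μ ∧ f = g + h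

/-- `S` maps `L^p(μ)` into itself and its operator norm there satisfies `‖S‖_{p→p} ≤ C`. -/
def LpOpNormLE {X 𝕜 : Type*} [MeasurableSpace X] [RCLike 𝕜]
    (μ : Measure X) (p : ℝ≥0∞) (S : (X → 𝕜) → X → 𝕜) (C : ℝ) : Prop :=
  ∀ f : X → 𝕜, MemLp f p μ →
    MemLp (S f) p μ ∧ eLpNorm (S f) p μ ≤ ENNReal.ofReal C * eLpNorm f p μ

/-- Symmetric diffusion semigroup, with the common domain `L¹ + L^∞`. -/
structure IsSymmetricDiffusionSemigroup {X 𝕜 : Type*} [MeasurableSpace X] [RCLike 𝕜]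
    (μ : Measure X) (T : ℝ≥0 → (X → 𝕜) → X → 𝕜) : Prop where
  /-- Each `T_t` maps `L¹ + L^∞` into the measurable functions. -/
  measurable : ∀ t f, MemL1AddLinfty μ f → AEStronglyMeasurable (T t f) μ
  /-- Each `T_t` is well defined on a.e. classes. -/
  congr : ∀ t f g, MemL1AddLinfty μ f → f =ᵐ[μ] g → T t f =ᵐ[μ] T t g
  map_add : ∀ t f g, MemL1AddLinfty μ f → MemL1AddLinfty μ g →
    T t (f + g) =ᵐ[μ] T t f + T t g
  map_smul : ∀ t (c : 𝕜) f, MemL1AddLinfty μ f → T t (c • f) =ᵐ[μ] c • T t f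
  map_zero_time : ∀ f, MemL1AddLinfty μ f → T 0 f =ᵐ[μ] f
  /-- (i) Each `T_t` is a contraction on every `L^p`, `1 ≤ p ≤ ∞`. -/
  contraction : ∀ p : ℝ≥0∞, 1 ≤ p → ∀ t, LpOpNormLE μ p (T t) 1
  /-- (i) The semigroup property on every `L^p`, `1 ≤ p ≤ ∞`. -/
  semigroup : ∀ p : ℝ≥0∞, 1 ≤ p → ∀ s t f, MemLp f p μ → T (s + t) f =ᵐ[μ] T s (T t f)
  /-- (ii) Each `T_t`, a bounded operator on `L²` by (i), is self-adjoint. -/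
  selfAdjoint : ∀ t f g, MemLp f 2 μ → MemLp g 2 μ →
    ∫ x, conj (T t f x) * g x ∂μ = ∫ x, conj (f x) * T t g x ∂μ
  /-- (iii) `T_t f → f` in `L²` as `t → 0⁺`. -/
  strongContinuity : ∀ f, MemLp f 2 μ →
    Tendsto (fun t : ℝ≥0 => eLpNorm (T t f - f) 2 μ) (𝓝[>] 0) (𝓝 0)

/-- (iv) Each `T_t` is positive. -/
def IsPositiveFamily {X 𝕜 : Type*} [MeasurableSpace X] [RCLike 𝕜]
    (μ : Measure X) (T : ℝ≥0 → (X → 𝕜) → X → 𝕜) : Prop :=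
  ∀ t f, MemL1AddLinfty μ f → (∀ᵐ x ∂μ, 0 ≤ f x) → ∀ᵐ x ∂μ, 0 ≤ T t f x

/-- Markovian: (i)-(iv) and `T_t 1 = 1` for all `t`. -/
def IsMarkovianSemigroup {X 𝕜 : Type*} [MeasurableSpace X] [RCLike 𝕜]
    (μ : Measure X) (T : ℝ≥0 → (X → 𝕜) → X → 𝕜) : Prop :=
  IsSymmetricDiffusionSemigroup μ T ∧ IsPositiveFamily μ T ∧
    ∀ t, ∀ᵐ x ∂μ, T t (fun _ => 1) x = 1

/-- Submarkovian: (i)-(iv) and `T_t 1 ≤ 1` for all `t`. -/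
def IsSubmarkovianSemigroup {X 𝕜 : Type*} [MeasurableSpace X] [RCLike 𝕜]
    (μ : Measure X) (T : ℝ≥0 → (X → 𝕜) → X → 𝕜) : Prop :=
  IsSymmetricDiffusionSemigroup μ T ∧ IsPositiveFamily μ T ∧
    ∀ t, ∀ᵐ x ∂μ, T t (fun _ => 1) x ≤ 1

/-- `L^p`-contractive semigroup: `‖T_t f‖_p ≤ ‖f‖_p` for all `1 ≤ p ≤ ∞`, all `t ≥ 0` and all
`f ∈ L² ∩ L^p`. -/
def IsLpContractiveSemigroup {X 𝕜 : Type*} [MeasurableSpace X] [RCLike 𝕜]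
    (μ : Measure X) (T : ℝ≥0 → (X → 𝕜) → X → 𝕜) : Prop :=
  ∀ p : ℝ≥0∞, 1 ≤ p → ∀ t f, MemLp f 2 μ → MemLp f p μ → eLpNorm (T t f) p μ ≤ eLpNorm f p μ

end Semigroups

/-! ### The Laguerre semigroup of Hermite type -/

section Laguerre

/-- The Laguerre polynomial `L_k^a(x)` of degree `k` and order `a > -1`. -/
def laguerrePoly (k : ℕ) (a x : ℝ) : ℝ :=
  ∑ j ∈ Finset.range (k + 1),
    Real.Gamma (k + a + 1) / (Real.Gamma (j + a + 1) * (j.factorial : ℝ) * ((k - j).factorial : ℝ))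
      * (-x) ^ j

/-- The normalized Laguerre polynomial `(Γ(k+1)/Γ(k+a+1))^{1/2} L_k^a(x)`. -/
def laguerreNormalized (k : ℕ) (a x : ℝ) : ℝ :=
  Real.sqrt (Real.Gamma (k + 1) / Real.Gamma (k + a + 1)) * laguerrePoly k a x

/-- The one-dimensional Laguerre function of Hermite type `φ_k^a(x)`, `x > 0`. -/
def laguerreHermite1 (k : ℕ) (a x : ℝ) : ℝ :=
  Real.sqrt 2 * laguerreNormalized k a (x ^ 2) * x ^ (a + 1 / 2) * Real.exp (-x ^ 2 / 2)

/-- The open orthant `ℝ₊^d = (0,∞)^d`. -/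
def orthant (d : ℕ) : Set (Fin d → ℝ) := {x | ∀ i, 0 < x i}

/-- Lebesgue measure on `ℝ₊^d`. -/
def orthantMeasure (d : ℕ) : Measure (Fin d → ℝ) := volume.restrict (orthant d)

/-- The tensor product `φ_k^α(x) = ∏ φ_{k_i}^{α_i}(x_i)`. -/
def laguerreHermite {d : ℕ} (α : Fin d → ℝ) (k : Fin d → ℕ) (x : Fin d → ℝ) : ℝ :=
  ∏ i, laguerreHermite1 (k i) (α i) (x i)

/-- The eigenvalue `4|k| + 2|α| + 2d` of `-Δ + ‖x‖² + ∑ (α_i² - 1/4)/x_i²` on `φ_k^α`. -/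
def laguerreEigenvalue {d : ℕ} (α : Fin d → ℝ) (k : Fin d → ℕ) : ℝ :=
  4 * (∑ i, (k i : ℝ)) + 2 * (∑ i, α i) + 2 * (d : ℝ)

/-- The terms `e^{-t(4|k|+2|α|+2d)} φ_k^α(x) φ_k^α(y)` of the heat kernel series. -/
def laguerreKernelTerm {d : ℕ} (α : Fin d → ℝ) (t : ℝ) (x y : Fin d → ℝ) (k : Fin d → ℕ) : ℝ :=
  Real.exp (-t * laguerreEigenvalue α k) * laguerreHermite α k x * laguerreHermite α k y

/-- The heat kernel `G_t^{α,φ}(x,y)`. -/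
def laguerreHeatKernel {d : ℕ} (α : Fin d → ℝ) (t : ℝ) (x y : Fin d → ℝ) : ℝ :=
  ∑' k : Fin d → ℕ, laguerreKernelTerm α t x y k

/-- The operators `T_t^{α,φ}` on `L¹ + L^∞`: the identity for `t = 0`, and integration against the
heat kernel for `t > 0`. -/
def laguerreSemigroup {𝕜 : Type*} [RCLike 𝕜] {d : ℕ} (α : Fin d → ℝ) (t : ℝ≥0)
    (f : (Fin d → ℝ) → 𝕜) (x : Fin d → ℝ) : 𝕜 :=
  if t = 0 then f x else ∫ y, laguerreHeatKernel α t x y • f y ∂(orthantMeasure d)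

/-- The Fourier-Laguerre coefficient `⟨f, φ_k^α⟩` (the functions `φ_k^α` are real). -/
def laguerreCoeff {𝕜 : Type*} [RCLike 𝕜] {d : ℕ} (α : Fin d → ℝ)
    (f : (Fin d → ℝ) → 𝕜) (k : Fin d → ℕ) : 𝕜 :=
  ∫ y, laguerreHermite α k y • f y ∂(orthantMeasure d)

/-- `g = exp(-t L_α^φ) f` for `f ∈ L²`, where `L_α^φ` is the self-adjoint operator with spectral
decomposition given by the `φ_k^α`: the series `∑ e^{-t(4|k|+2|α|+2d)} ⟨f, φ_k^α⟩ φ_k^α`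
converges (unconditionally) to `g` in `L²(ℝ₊^d)`. -/
def IsSpectralHeatFlow {𝕜 : Type*} [RCLike 𝕜] {d : ℕ} (α : Fin d → ℝ) (t : ℝ)
    (f g : (Fin d → ℝ) → 𝕜) : Prop :=
  MemLp g 2 (orthantMeasure d) ∧
  Tendsto (fun s : Finset (Fin d → ℕ) =>
      eLpNorm (fun x => g x - ∑ k ∈ s,
        (Real.exp (-t * laguerreEigenvalue α k) * laguerreHermite α k x) • laguerreCoeff α f k)
        2 (orthantMeasure d))
    atTop (𝓝 0)

end Laguerre

end

noncomputable section

/-! ### Generating functions and the Hille-Hardy formula -/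

/-! The proof reduces everything to the mass `∫ G_t(x,y) dy` of an explicit positive kernel. The
Hille-Hardy formula (`hasSum_hille_hardy`) with `r = e^{-4t}` sums the one-dimensional series to
`laguerreKernel1`, a Gaussian times a power times a Bessel series with positive coefficients; the
kernel on the orthant is a product of these. It is symmetric, nonnegative, and, for fixed `x`,
bounded and integrable in `y`. Hence integrals against `L¹ + L^∞` converge, and Schur's test bounds
every `L^p` operator norm by the supremum of the mass.

Termwise integration gives, per coordinate, `(cosh 2t)^{-1/2} exp(-(sinh 2t)² w) M(δ,w)` with `δ =
a/2 + 1/4` and `w = x²/(2 sinh 2t cosh 2t)`. A Beta integral (`laguerreMass_eq`) identifies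
`M(δ,w)`, for `δ > 0`, as the expectation of `(1-σ)^{δ-1/2}` restricted to `σ < 1`, where `σ` is
Gamma distributed with shape `δ` and rate `w`; moreover `M(0,w) = 1`. The dichotomy is now visible.
The condition `a = -1/2` or `a ≥ 1/2` says `δ = 0` or `δ ≥ 1/2`, and then the integrand is at most
one, so `M ≤ 1`. For `0 < δ < 1/2` the integrand exceeds one, its first moment correction is
`(1/2-δ)δ/w`, and the lost tail is of smaller order, so `M > 1` for large `w`; still `M` is bounded
uniformly in `w`. Since `w` can be held fixed while `t → 0`, the prefactor tends to one and the
total mass exceeds one on an open set. The other coordinates are placed where their masses are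
nearly one.

The spectral statements rest on termwise pairing of absolutely convergent Laguerre series with `L²`
functions (`hasSum_smul_laguerreCoeff`). It yields the pointwise expansion of `T_t f`, the
eigenfunction relation, the Chapman-Kolmogorov equation, and completeness: the functions `φ_0 exp(-∑
n_i x_i²)` are such series, by the generating function, so a function with vanishing coefficients
has vanishing moments against a separating algebra. The expansion in the resulting Hilbert basis,
together with the `L²` bound, identifies `T_t` with the spectral heat flow. -/

lemma HasSum.swap_of_summable {β γ : Type*} {F : β → γ → ℝ} {g : β → ℝ} {f : γ → ℝ} {S : ℝ}
    (h : Summable fun p : β × γ => F p.1 p.2) (hg : ∀ j, HasSum (F j) (g j))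
    (hf : ∀ n, HasSum (fun j => F j n) (f n)) (hS : HasSum g S) : HasSum f S := by
  have h1 := h.hasSum
  have h2 := h1.prod_fiberwise hg
  rw [h2.unique hS] at h1
  have h3 : HasSum (fun p : γ × β => F p.2 p.1) S :=
    (Equiv.hasSum_iff (Equiv.prodComm γ β)).2 h1
  exact h3.prod_fiberwise hf

lemma summable_prod_of_hasSum {β γ : Type*} {F : β → γ → ℝ} {g : β → ℝ}
    (h0 : ∀ j n, 0 ≤ F j n) (hg : ∀ j, HasSum (F j) (g j)) (hS : Summable g) :
    Summable fun p : β × γ => F p.1 p.2 := by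
  rw [summable_prod_of_nonneg fun p => h0 p.1 p.2]
  exact ⟨fun j => (hg j).summable, hS.congr fun j => (hg j).tsum_eq.symm⟩

lemma HasSum.congr_both {β : Type*} {f g : β → ℝ} {a b : ℝ} (h : HasSum f a) (hfg : ∀ j, g j = f j)
    (hab : b = a) : HasSum g b := by
  rw [hab]
  exact h.congr_fun hfg

lemma Real.Gamma_nat_add (b : ℝ) (hb : 0 < b) (n : ℕ) :
    Real.Gamma (n + b) = (ascPochhammer ℝ n).eval b * Real.Gamma b := by
  induction n with
  | zero => simp
  | succ n ih =>
    have : (n : ℝ) + b ≠ 0 := by positivity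
    rw [ascPochhammer_succ_eval, show ((n + 1 : ℕ) : ℝ) + b = (n + b) + 1 by push_cast; ring,
      Real.Gamma_add_one this, ih]
    ring

/-- The negative binomial series. -/
lemma hasSum_Gamma_div_factorial_mul_pow {b r : ℝ} (hb : 0 < b) (hr : |r| < 1) :
    HasSum (fun m : ℕ => Real.Gamma (m + b) / (m.factorial : ℝ) * r ^ m)
      (Real.Gamma b * (1 - r) ^ (-b)) := by
  have h := (Real.one_div_one_sub_rpow_hasFPowerSeriesOnBall_zero b).hasSum
    (y := r) (by simpa [enorm_eq_nnnorm, ← NNReal.coe_lt_coe] using hr)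
  simp only [FormalMultilinearSeries.ofScalars_apply_eq, zero_add, one_div] at h
  have h2 := h.mul_left (Real.Gamma b)
  rw [Real.rpow_neg (by linarith [(abs_lt.1 hr).2])]
  refine h2.congr_fun fun m => ?_
  have hm : (m.factorial : ℝ) ≠ 0 := by positivity
  have h3 := Ring.factorial_nsmul_multichoose_eq_ascPochhammer b m
  rw [Ring.multichoose_eq, nsmul_eq_mul, Polynomial.ascPochhammer_smeval_eq_eval] at h3
  rw [Real.Gamma_nat_add b hb m, ← h3, smul_eq_mul]
  field_simp

/-- The Laguerre polynomial divided by `Γ(n+a+1)/n!`. -/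
def laguerreReduced (a : ℝ) (n : ℕ) (X : ℝ) : ℝ :=
  ∑ j ∈ Finset.range (n + 1), (n.choose j : ℝ) * ((-X) ^ j / Real.Gamma (j + a + 1))

/-- The value `Γ(n+a+1)/n!`, which is `Γ(a+1) L_n^a(0)`. -/
def laguerreWeight (a : ℝ) (n : ℕ) : ℝ := Real.Gamma (n + a + 1) / (n.factorial : ℝ)

/-- The entire function `∑ z^m / (m! Γ(m+a+1))`. -/
def besselSeries (a z : ℝ) : ℝ :=
  ∑' m : ℕ, z ^ m / ((m.factorial : ℝ) * Real.Gamma (m + a + 1))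

lemma Gamma_nat_add_pos {a : ℝ} (ha : -1 < a) (n : ℕ) : 0 < Real.Gamma (n + a + 1) :=
  Real.Gamma_pos_of_pos (by have : (0 : ℝ) ≤ n := n.cast_nonneg; linarith)

lemma laguerreWeight_pos {a : ℝ} (ha : -1 < a) (n : ℕ) : 0 < laguerreWeight a n :=
  div_pos (Gamma_nat_add_pos ha n) (by positivity)

lemma hasSum_choose_mul (a : ℝ) (n : ℕ) (X : ℝ) :
    HasSum (fun j : ℕ => (n.choose j : ℝ) * ((-X) ^ j / Real.Gamma (j + a + 1)))
      (laguerreReduced a n X) :=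
  hasSum_sum_of_ne_finset_zero fun j hj => by
    rw [Nat.choose_eq_zero_of_lt (by simpa using hj)]; simp

lemma abs_laguerreReduced_le {a : ℝ} (ha : -1 < a) (n : ℕ) (X : ℝ) :
    |laguerreReduced a n X| ≤ laguerreReduced a n (-|X|) := by
  refine (Finset.abs_sum_le_sum_abs _ _).trans (Finset.sum_le_sum fun j _ => ?_)
  rw [abs_mul, abs_div, abs_pow, abs_neg, neg_neg, abs_of_pos (Gamma_nat_add_pos ha j),
    Nat.abs_cast]

lemma laguerreReduced_nonneg {a : ℝ} (ha : -1 < a) (n : ℕ) {X : ℝ} (hX : X ≤ 0) :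
    0 ≤ laguerreReduced a n X :=
  Finset.sum_nonneg fun j _ => mul_nonneg (by positivity)
    (div_nonneg (pow_nonneg (by linarith) _) (Gamma_nat_add_pos ha j).le)

/-- Only `n ≥ j` contribute; writing `n = m + j` leaves the negative binomial series with parameter
`j + a + 1`. -/
lemma hasSum_laguerreWeight_choose {a r : ℝ} (ha : -1 < a) (hr : |r| < 1) (j : ℕ) :
    HasSum (fun n : ℕ => laguerreWeight a n * r ^ n * (n.choose j : ℝ))
      (r ^ j / (j.factorial : ℝ) * (Real.Gamma (j + a + 1) * (1 - r) ^ (-(j + a + 1)))) := by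
  have hj : (0 : ℝ) ≤ j := j.cast_nonneg
  have h := (hasSum_Gamma_div_factorial_mul_pow (b := j + a + 1) (by linarith) hr).mul_left
    (r ^ j / (j.factorial : ℝ))
  have hinj : Function.Injective fun m : ℕ => m + j := add_left_injective j
  refine (hinj.hasSum_iff ?_).1 (h.congr_fun fun m => ?_)
  · intro n hn
    have : n < j := by
      by_contra hc
      exact hn ⟨n - j, by simp; omega⟩
    simp [Nat.choose_eq_zero_of_lt this]
  · have h1 : (((m + j).choose j : ℕ) : ℝ) * (j.factorial : ℝ) * (m.factorial : ℝ)
        = ((m + j).factorial : ℝ) := by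
      have := Nat.choose_mul_factorial_mul_factorial (Nat.le_add_left j m)
      rw [Nat.add_sub_cancel] at this
      exact_mod_cast this
    have h2 : ((m + j).factorial : ℝ) ≠ 0 := by positivity
    have h3 : (j.factorial : ℝ) ≠ 0 := by positivity
    have h4 : (m.factorial : ℝ) ≠ 0 := by positivity
    simp only [Function.comp, laguerreWeight]
    have h5 : (((m + j).choose j : ℕ) : ℝ) ≠ 0 := by
      have := Nat.choose_pos (Nat.le_add_left j m)
      positivity
    rw [← h1] at h2 ⊢
    rw [show ((m + j : ℕ) : ℝ) + a + 1 = m + (j + a + 1) by push_cast; ring, pow_add]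
    field_simp

/-- The generating function of the Laguerre polynomials. -/
lemma hasSum_laguerre_generating {a r : ℝ} (ha : -1 < a) (hr : |r| < 1) (X : ℝ) :
    HasSum (fun n : ℕ => laguerreWeight a n * laguerreReduced a n X * r ^ n)
      ((1 - r) ^ (-(a + 1)) * Real.exp (-X * r / (1 - r))) := by
  -- After the sum over `n`, the sum over `j` is an exponential series. General `r` and `X` are kept
  -- because the case `|r|`, `-|X|` is the nonnegative majorant that justifies the interchange.
  have key : ∀ r : ℝ, |r| < 1 → ∀ X : ℝ, HasSum (fun j : ℕ => (-X) ^ j / Real.Gamma (j + a + 1) *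
      (r ^ j / (j.factorial : ℝ) * (Real.Gamma (j + a + 1) * (1 - r) ^ (-(j + a + 1)))))
      ((1 - r) ^ (-(a + 1)) * Real.exp (-X * r / (1 - r))) := by
    intro r hr X
    have h1r : 0 < 1 - r := by linarith [(abs_lt.1 hr).2]
    have h := (NormedSpace.expSeries_div_hasSum_exp (-X * r / (1 - r))).mul_left
      ((1 - r) ^ (-(a + 1)))
    rw [← Real.exp_eq_exp_ℝ] at h
    refine h.congr_fun fun j => ?_
    have hG := (Gamma_nat_add_pos ha j).ne'
    rw [show -((j : ℝ) + a + 1) = -(a + 1) - j by ring, Real.rpow_sub h1r, Real.rpow_natCast,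
      div_pow, mul_pow]
    field_simp
  refine HasSum.swap_of_summable
    (F := fun j n : ℕ => (-X) ^ j / Real.Gamma (j + a + 1) *
      (laguerreWeight a n * r ^ n * (n.choose j : ℝ))) ?_
    (fun j => (hasSum_laguerreWeight_choose ha hr j).mul_left _) ?_ (key r hr X)
  · have hr' : |(|r|)| < 1 := by simpa using hr
    refine Summable.of_norm ((summable_prod_of_hasSum (F := fun j n : ℕ =>
      (-(-|X|)) ^ j / Real.Gamma (j + a + 1) *
        (laguerreWeight a n * |r| ^ n * (n.choose j : ℝ))) (fun j n => ?_)
      (fun j => (hasSum_laguerreWeight_choose ha hr' j).mul_left _)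
      (key |r| hr' (-|X|)).summable).congr fun p => ?_)
    · have := (laguerreWeight_pos ha n).le
      have := (Gamma_nat_add_pos ha j).le
      rw [neg_neg]
      exact mul_nonneg (div_nonneg (by positivity) this) (by positivity)
    · rw [Real.norm_eq_abs, abs_mul, abs_mul, abs_mul, abs_div, abs_pow, abs_pow, abs_neg, neg_neg,
        Nat.abs_cast, abs_of_pos (Gamma_nat_add_pos ha p.1), abs_of_pos (laguerreWeight_pos ha p.2)]
  · intro n
    rw [mul_right_comm]
    refine ((hasSum_choose_mul a n X).mul_left (laguerreWeight a n * r ^ n)).congr_fun fun j => ?_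
    ring

lemma summable_abs_laguerre_mul_pow {a r : ℝ} (ha : -1 < a) (hr : |r| < 1) (X : ℝ) :
    Summable fun n : ℕ => laguerreWeight a n * |laguerreReduced a n X| * |r| ^ n := by
  refine Summable.of_nonneg_of_le (fun n => ?_) (fun n => ?_)
    (hasSum_laguerre_generating ha (by simpa using hr : |(|r|)| < 1) (-|X|)).summable
  · have := (laguerreWeight_pos ha n).le
    positivity
  · have := (laguerreWeight_pos ha n).le
    gcongr
    exact abs_laguerreReduced_le ha n X

/-- Equality holds at `a = -1/2`. The induction step needs `2m + 1 ≤ 2(m + a + 1)`, which is exactly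
`a ≥ -1/2`. This compares the Bessel series with `cosh`. -/
lemma Gamma_nat_add_ge {a : ℝ} (ha : -1 / 2 ≤ a) (m : ℕ) :
    Real.Gamma (a + 1) * ((2 * m).factorial : ℝ) ≤
      Real.Gamma (m + a + 1) * (m.factorial : ℝ) * 4 ^ m := by
  induction m with
  | zero => simp
  | succ m ih =>
    have hG := Gamma_nat_add_pos (by linarith : -1 < a) m
    have hm : (0 : ℝ) ≤ m := m.cast_nonneg
    rw [show ((m + 1 : ℕ) : ℝ) + a + 1 = (m + a + 1) + 1 by push_cast; ring,
      Real.Gamma_add_one (s := m + a + 1) (by linarith), show 2 * (m + 1) = 2 * m + 1 + 1 by ring,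
      Nat.factorial_succ, Nat.factorial_succ, Nat.factorial_succ]
    push_cast
    calc Real.Gamma (a + 1) * ((2 * m + 1 + 1) * ((2 * m + 1) * ((2 * m).factorial : ℝ)))
        = (2 * m + 1 + 1) * (2 * m + 1) * (Real.Gamma (a + 1) * ((2 * m).factorial : ℝ)) := by ring
      _ ≤ (2 * m + 1 + 1) * (2 * m + 1) *
          (Real.Gamma (m + a + 1) * (m.factorial : ℝ) * 4 ^ m) := by gcongr
      _ ≤ (2 * m + 1 + 1) * (2 * (m + a + 1)) *
          (Real.Gamma (m + a + 1) * (m.factorial : ℝ) * 4 ^ m) := by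
        gcongr ?_ * ?_ * ?_
        linarith
      _ = _ := by ring

lemma besselTerm_le {a : ℝ} (ha : -1 / 2 ≤ a) (w : ℝ) (m : ℕ) :
    (w ^ 2) ^ m / ((m.factorial : ℝ) * Real.Gamma (m + a + 1)) ≤
      1 / Real.Gamma (a + 1) * ((2 * w) ^ (2 * m) / ((2 * m).factorial : ℝ)) := by
  have hG := Gamma_nat_add_pos (by linarith : -1 < a) m
  have hG0 : 0 < Real.Gamma (a + 1) := Real.Gamma_pos_of_pos (by linarith)
  rw [one_div_mul_eq_div, div_div, div_le_div_iff₀ (by positivity) (by positivity), pow_mul,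
    mul_pow, mul_pow]
  have := mul_le_mul_of_nonneg_left (Gamma_nat_add_ge ha m) (by positivity : 0 ≤ (w ^ 2) ^ m)
  norm_num
  nlinarith [this]

lemma summable_besselTerm {a : ℝ} (ha : -1 / 2 ≤ a) (z : ℝ) :
    Summable fun m : ℕ => ‖z ^ m / ((m.factorial : ℝ) * Real.Gamma (m + a + 1))‖ := by
  have h := (Real.hasSum_cosh (2 * √|z|)).summable.mul_left (1 / Real.Gamma (a + 1))
  refine Summable.of_nonneg_of_le (fun m => norm_nonneg _) (fun m => ?_) h
  have hG := Gamma_nat_add_pos (by linarith : -1 < a) m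
  have := besselTerm_le ha (√|z|) m
  rw [Real.sq_sqrt (abs_nonneg z)] at this
  rwa [Real.norm_eq_abs, abs_div, abs_pow, abs_of_pos (by positivity :
    0 < (m.factorial : ℝ) * Real.Gamma (m + a + 1))]

lemma besselSeries_sq_le {a : ℝ} (ha : -1 / 2 ≤ a) (w : ℝ) :
    besselSeries a (w ^ 2) ≤ 1 / Real.Gamma (a + 1) * Real.cosh (2 * w) := by
  have h := (Real.hasSum_cosh (2 * w)).mul_left (1 / Real.Gamma (a + 1))
  rw [← h.tsum_eq]
  exact (summable_besselTerm ha (w ^ 2)).of_norm.tsum_le_tsum (besselTerm_le ha w) h.summable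

lemma besselSeries_nonneg {a : ℝ} (ha : -1 < a) {z : ℝ} (hz : 0 ≤ z) : 0 ≤ besselSeries a z :=
  tsum_nonneg fun m => div_nonneg (by positivity)
    (mul_nonneg (by positivity) (Gamma_nat_add_pos ha m).le)

/-- The exponential generating function of the reduced Laguerre polynomials. -/
lemma hasSum_laguerreReduced_div_factorial {a : ℝ} (ha : -1 / 2 ≤ a) (X s : ℝ) :
    HasSum (fun n : ℕ => laguerreReduced a n X * s ^ n / (n.factorial : ℝ))
      (Real.exp s * besselSeries a (-X * s)) := by
  have h := hasSum_sum_range_mul_of_summable_norm (summable_besselTerm ha (-X * s))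
    (NormedSpace.expSeries_div_hasSum_exp s).summable.norm
  rw [mul_comm, Real.exp_eq_exp_ℝ, ← (NormedSpace.expSeries_div_hasSum_exp s).tsum_eq]
  refine h.congr_fun fun n => ?_
  rw [laguerreReduced, Finset.sum_mul, Finset.sum_div]
  refine Finset.sum_congr rfl fun j hj => ?_
  have hjn : j ≤ n := Nat.lt_succ_iff.1 (Finset.mem_range.1 hj)
  have hG := (Gamma_nat_add_pos (by linarith : -1 < a) j).ne'
  have h1 : ((n.choose j : ℕ) : ℝ) * (j.factorial : ℝ) * ((n - j).factorial : ℝ)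
        = (n.factorial : ℝ) := by exact_mod_cast Nat.choose_mul_factorial_mul_factorial hjn
  have h5 : ((n.choose j : ℕ) : ℝ) ≠ 0 := by
    have := Nat.choose_pos hjn
    positivity
  have h3 : (j.factorial : ℝ) ≠ 0 := by positivity
  have h4 : ((n - j).factorial : ℝ) ≠ 0 := by positivity
  rw [← h1, mul_pow, ← pow_mul_pow_sub s hjn]
  field_simp

lemma eq_of_hasSum_pow_mul {c c' : ℕ → ℝ} {f : ℝ → ℝ}
    (h : ∀ᶠ z in 𝓝 (0 : ℝ), HasSum (fun n => z ^ n * c n) (f z))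
    (h' : ∀ᶠ z in 𝓝 (0 : ℝ), HasSum (fun n => z ^ n * c' n) (f z)) : c = c' := by
  have key : HasFPowerSeriesAt (0 : ℝ → ℝ)
      (FormalMultilinearSeries.ofScalars ℝ (fun n => c n - c' n)) 0 := by
    rw [hasFPowerSeriesAt_iff]
    filter_upwards [h, h'] with z hz hz'
    simpa [FormalMultilinearSeries.coeff_ofScalars, mul_sub] using hz.sub hz'
  have h0 := key.eq_zero
  funext n
  have := congrArg (fun p => FormalMultilinearSeries.coeff p n) h0
  simp only [FormalMultilinearSeries.coeff_ofScalars] at this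
  have h2 : (0 : FormalMultilinearSeries ℝ ℝ ℝ).coeff n = 0 := by
    simp [FormalMultilinearSeries.coeff]
  linarith

/-- Up to `j!` this is the `j`-th derivative of the generating function at `r`. It is found by
expanding at `r + h` twice, once through the binomial theorem and once through the generating
function at `h/(1-r)` with argument `X/(1-r)`, and comparing coefficients of `h^j`. -/
lemma hasSum_laguerre_choose {a r : ℝ} (ha : -1 < a) (hr : |r| < 1) (X : ℝ) (j : ℕ) :
    HasSum (fun n : ℕ => (n.choose j : ℝ) * r ^ (n - j) *
        (laguerreWeight a n * laguerreReduced a n X))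
      ((1 - r) ^ (-(a + 1)) * Real.exp (-X * r / (1 - r)) *
        (laguerreWeight a j * laguerreReduced a j (X / (1 - r)) / (1 - r) ^ j)) := by
  have h1r : 0 < 1 - r := by linarith [(abs_lt.1 hr).2]
  let F : ℝ → ℕ → ℕ → ℝ := fun h n j =>
    (laguerreWeight a n * laguerreReduced a n X) * (r ^ (n - j) * h ^ j * (n.choose j : ℝ))
  have hbinom : ∀ x h : ℝ, ∀ n : ℕ,
      HasSum (fun j => x ^ (n - j) * h ^ j * (n.choose j : ℝ)) ((x + h) ^ n) := by
    intro x h n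
    rw [add_comm x h, add_pow]
    simp only [mul_comm (h ^ _)]
    exact hasSum_sum_of_ne_finset_zero fun j hj => by
      rw [Nat.choose_eq_zero_of_lt (by simpa using hj)]; simp
  have hFs : ∀ h : ℝ, |r| + |h| < 1 → Summable fun p : ℕ × ℕ => F h p.1 p.2 := by
    intro h hh
    have h0 : 0 ≤ |r| + |h| := by positivity
    have hs := summable_abs_laguerre_mul_pow ha (by rwa [abs_of_nonneg h0] : |(|r| + |h|)| < 1) X
    simp only [abs_of_nonneg h0] at hs
    refine Summable.of_norm ((summable_prod_of_hasSum (F := fun n j : ℕ =>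
      (laguerreWeight a n * |laguerreReduced a n X|) *
        (|r| ^ (n - j) * |h| ^ j * (n.choose j : ℝ))) (fun n j => ?_)
      (fun n => (hbinom |r| |h| n).mul_left _) hs).congr fun p => ?_)
    · have := (laguerreWeight_pos ha n).le
      positivity
    · simp only [F]
      rw [Real.norm_eq_abs, abs_mul, abs_mul, abs_mul, abs_mul, abs_pow, abs_pow, Nat.abs_cast,
        abs_of_pos (laguerreWeight_pos ha p.1)]
  have hsum : ∀ j, Summable fun n : ℕ => (n.choose j : ℝ) * r ^ (n - j) *
        (laguerreWeight a n * laguerreReduced a n X) := by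
    intro j
    -- For any positive `h` with `|r| + h < 1`, the `j`-th column of the double series is `h^j`
    -- times the series sought; half the available room is taken.
    have hh : 0 < (1 - |r|) / 2 := by linarith
    have h1 := (hFs ((1 - |r|) / 2) (by rw [abs_of_pos hh]; linarith)).prod_symm.prod_factor j
    have h2 := h1.mul_left ((((1 - |r|) / 2) ^ j)⁻¹)
    refine h2.congr fun n => ?_
    have : ((1 - |r|) / 2) ^ j ≠ 0 := by positivity
    simp only [F, Prod.swap]
    field_simp
  have hev : ∀ᶠ h in 𝓝 (0 : ℝ), |r| + |h| < 1 :=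
    Tendsto.eventually_lt_const (u := 1) (v := |r| + |(0 : ℝ)|) (by simpa using hr)
      (by fun_prop : Continuous fun h : ℝ => |r| + |h|).continuousAt
  have hA : ∀ᶠ h in 𝓝 (0 : ℝ), HasSum (fun j => h ^ j * ∑' n : ℕ, (n.choose j : ℝ) * r ^ (n - j) *
        (laguerreWeight a n * laguerreReduced a n X))
      ((1 - (r + h)) ^ (-(a + 1)) * Real.exp (-X * (r + h) / (1 - (r + h)))) := by
    filter_upwards [hev] with h hh
    refine HasSum.swap_of_summable (hFs h hh)
      (fun n => (hbinom r h n).mul_left (laguerreWeight a n * laguerreReduced a n X))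
      (fun j => ?_) (hasSum_laguerre_generating ha ((abs_add_le r h).trans_lt hh) X)
    refine ((hsum j).hasSum.mul_left (h ^ j)).congr_fun fun n => ?_
    simp only [F]
    ring
  have hB : ∀ᶠ h in 𝓝 (0 : ℝ), HasSum (fun j => h ^ j *
        ((1 - r) ^ (-(a + 1)) * Real.exp (-X * r / (1 - r)) *
        (laguerreWeight a j * laguerreReduced a j (X / (1 - r)) / (1 - r) ^ j)))
      ((1 - (r + h)) ^ (-(a + 1)) * Real.exp (-X * (r + h) / (1 - (r + h)))) := by
    filter_upwards [hev] with h hh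
    have hh1 : h < 1 - r := by linarith [le_abs_self r, le_abs_self h]
    have hh2 : -(1 - r) < h := by linarith [le_abs_self r, neg_abs_le h, neg_abs_le r]
    have hlt : |h / (1 - r)| < 1 := by
      rw [abs_div, abs_of_pos h1r, div_lt_one h1r]
      exact abs_lt.2 ⟨hh2, hh1⟩
    have h0 : 0 < 1 - h / (1 - r) := by linarith [(abs_lt.1 hlt).2]
    have h2 : 1 - (r + h) = (1 - r) * (1 - h / (1 - r)) := by field_simp; ring
    have h3 := (hasSum_laguerre_generating ha hlt (X / (1 - r))).mul_left
      ((1 - r) ^ (-(a + 1)) * Real.exp (-X * r / (1 - r)))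
    have h4 : -X * (r + h) / (1 - (r + h)) = -X * r / (1 - r) +
        -(X / (1 - r)) * (h / (1 - r)) / (1 - h / (1 - r)) := by
      have e1 : 1 - (r + h) ≠ 0 := by rw [h2]; positivity
      have e2 : 1 - r - h ≠ 0 := by rwa [sub_sub]
      have e3 : 1 - h / (1 - r) = (1 - r - h) / (1 - r) := by field_simp
      rw [e3, ← sub_sub]
      field_simp
      ring
    rw [h4, Real.exp_add, h2, Real.mul_rpow h1r.le h0.le]
    refine h3.congr_both (fun j => ?_) (by ring)
    rw [div_pow]
    ring
  have := congrFun (eq_of_hasSum_pow_mul hA hB) j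
  rw [← this]
  exact (hsum j).hasSum

lemma inv_laguerreWeight_le {a : ℝ} (ha : -1 / 2 ≤ a) (n : ℕ) :
    (laguerreWeight a n)⁻¹ ≤ (n + 1) / Real.Gamma (a + 1) := by
  have hG0 : 0 < Real.Gamma (a + 1) := Real.Gamma_pos_of_pos (by linarith)
  rw [laguerreWeight, inv_div,
    div_le_div_iff₀ (Gamma_nat_add_pos (by linarith : -1 < a) n) hG0]
  induction n with
  | zero => simp
  | succ n ih =>
    have hG := Gamma_nat_add_pos (by linarith : -1 < a) n
    have hm : (0 : ℝ) ≤ n := n.cast_nonneg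
    rw [show ((n + 1 : ℕ) : ℝ) + a + 1 = (n + a + 1) + 1 by push_cast; ring,
      Real.Gamma_add_one (s := n + a + 1) (by linarith), Nat.factorial_succ]
    push_cast
    have h2 : ((n : ℝ) + 1) * (n + 1) ≤ (n + 1 + 1) * (n + a + 1) := by nlinarith
    calc (n + 1 : ℝ) * n.factorial * Real.Gamma (a + 1)
        = (n + 1) * (n.factorial * Real.Gamma (a + 1)) := by ring
      _ ≤ (n + 1) * ((n + 1) * Real.Gamma (n + a + 1)) := by gcongr
      _ = ((n + 1) * (n + 1)) * Real.Gamma (n + a + 1) := by ring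
      _ ≤ ((n + 1 + 1) * (n + a + 1)) * Real.Gamma (n + a + 1) := by gcongr
      _ = _ := by ring

lemma exists_inv_laguerreWeight_mul_pow_le {a r : ℝ} (ha : -1 / 2 ≤ a) (hr0 : 0 ≤ r)
    (hr : r < 1) : ∃ K : ℝ, ∀ n : ℕ, (laguerreWeight a n)⁻¹ * r ^ n ≤ K := by
  have hG0 : 0 < Real.Gamma (a + 1) := Real.Gamma_pos_of_pos (by linarith)
  have hr' : ‖r‖ < 1 := by rwa [Real.norm_eq_abs, abs_of_nonneg hr0]
  have hs : Summable fun n : ℕ => (n + 1) / Real.Gamma (a + 1) * r ^ n := by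
    have h := ((summable_pow_mul_geometric_of_norm_lt_one 1 hr').add
      (summable_geometric_of_lt_one hr0 hr)).mul_left (Real.Gamma (a + 1))⁻¹
    refine h.congr fun n => ?_
    ring
  refine ⟨_, fun n => (mul_le_mul_of_nonneg_right (inv_laguerreWeight_le ha n)
    (pow_nonneg hr0 n)).trans (hs.le_tsum n fun m _ => by positivity)⟩

/-- Write `r = ρ³`: one factor `ρ^n` makes each of the two generating series converge, and the third
absorbs the inverse weight, which grows at most linearly. -/
lemma summable_laguerre_mul_laguerre {a r : ℝ} (ha : -1 / 2 ≤ a) (hr0 : 0 < r) (hr : r < 1)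
    (X Y : ℝ) : Summable fun n : ℕ => laguerreWeight a n * |laguerreReduced a n X| *
      |laguerreReduced a n Y| * r ^ n := by
  have ha' : -1 < a := by linarith
  obtain ⟨ρ, hρ0, hρ1, rfl⟩ : ∃ ρ : ℝ, 0 < ρ ∧ ρ < 1 ∧ ρ ^ 3 = r :=
    ⟨r ^ ((3 : ℕ) : ℝ)⁻¹, Real.rpow_pos_of_pos hr0 _,
      Real.rpow_lt_one hr0.le hr (by positivity), Real.rpow_inv_natCast_pow hr0.le (by norm_num)⟩
  have hρ : |ρ| < 1 := by rwa [abs_of_pos hρ0]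
  obtain ⟨K, hK⟩ := exists_inv_laguerreWeight_mul_pow_le ha hρ0.le hρ1
  have h1 := summable_abs_laguerre_mul_pow ha' hρ X
  have h2 := summable_abs_laguerre_mul_pow ha' hρ Y
  rw [abs_of_pos hρ0] at h1 h2
  have hw := fun n => laguerreWeight_pos ha' n
  have h3 : ∀ n, laguerreWeight a n * |laguerreReduced a n Y| * ρ ^ n ≤
      ∑' n, laguerreWeight a n * |laguerreReduced a n Y| * ρ ^ n := fun n =>
    h2.le_tsum n fun m _ => by have := (hw m).le; positivity
  refine Summable.of_nonneg_of_le (fun n => by have := (hw n).le; positivity) (fun n => ?_)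
    (h1.mul_right ((∑' n, laguerreWeight a n * |laguerreReduced a n Y| * ρ ^ n) * K))
  have hw0 := hw n
  calc laguerreWeight a n * |laguerreReduced a n X| * |laguerreReduced a n Y| * (ρ ^ 3) ^ n
      = (laguerreWeight a n * |laguerreReduced a n X| * ρ ^ n) *
        ((laguerreWeight a n * |laguerreReduced a n Y| * ρ ^ n) *
          ((laguerreWeight a n)⁻¹ * ρ ^ n)) := by
        rw [← pow_mul, mul_comm 3 n, pow_mul]
        field_simp
    _ ≤ _ := by
        have : 0 ≤ (laguerreWeight a n)⁻¹ * ρ ^ n := by positivity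
        have : 0 ≤ laguerreWeight a n * |laguerreReduced a n Y| * ρ ^ n := by positivity
        gcongr
        · exact this.trans (h3 n)
        · exact h3 n
        · exact hK n

lemma summable_sqrt_laguerreWeight_mul {a r : ℝ} (ha : -1 / 2 ≤ a) (hr0 : 0 < r) (hr : r < 1)
    (X : ℝ) : Summable fun n : ℕ => √(laguerreWeight a n) * |laguerreReduced a n X| * r ^ n := by
  have ha' : -1 < a := by linarith
  have hw := fun n => laguerreWeight_pos ha' n
  obtain ⟨ρ, hρ0, hρ1, rfl⟩ : ∃ ρ : ℝ, 0 < ρ ∧ ρ < 1 ∧ ρ ^ 2 = r :=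
    ⟨√r, Real.sqrt_pos.2 hr0, by rwa [Real.sqrt_lt' one_pos, one_pow], Real.sq_sqrt hr0.le⟩
  have hρ : |ρ| < 1 := by rwa [abs_of_pos hρ0]
  obtain ⟨K, hK⟩ := exists_inv_laguerreWeight_mul_pow_le ha hρ0.le hρ1
  have h1 := summable_abs_laguerre_mul_pow ha' hρ X
  rw [abs_of_pos hρ0] at h1
  refine Summable.of_nonneg_of_le (fun n => by have := (hw n).le; positivity) (fun n => ?_)
    (h1.mul_right (1 + K))
  have hw0 := hw n
  -- The right side is `weight + 1`, so this follows from `(√weight - 1)² ≥ 0`.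
  have hsq : √(laguerreWeight a n) ≤ laguerreWeight a n * (1 + (laguerreWeight a n)⁻¹) := by
    rw [mul_add, mul_inv_cancel₀ hw0.ne', mul_one]
    nlinarith [Real.sq_sqrt hw0.le, sq_nonneg (√(laguerreWeight a n) - 1)]
  have hp : ρ ^ n ≤ 1 := pow_le_one₀ hρ0.le hρ1.le
  calc √(laguerreWeight a n) * |laguerreReduced a n X| * (ρ ^ 2) ^ n
      ≤ laguerreWeight a n * (1 + (laguerreWeight a n)⁻¹) * |laguerreReduced a n X| *
        (ρ ^ 2) ^ n := by gcongr
    _ = (laguerreWeight a n * |laguerreReduced a n X| * ρ ^ n) *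
          (ρ ^ n + (laguerreWeight a n)⁻¹ * ρ ^ n) := by
        rw [← pow_mul, mul_comm 2 n, pow_mul]
        ring
    _ ≤ _ := by
        gcongr
        exact hK n

/-- The Hille-Hardy formula. -/
lemma hasSum_hille_hardy {a r : ℝ} (ha : -1 / 2 ≤ a) (hr0 : 0 < r) (hr : r < 1) (X Y : ℝ) :
    HasSum (fun n : ℕ => laguerreWeight a n * laguerreReduced a n X * laguerreReduced a n Y * r ^ n)
      ((1 - r) ^ (-(a + 1)) * Real.exp (-(X + Y) * r / (1 - r)) *
        besselSeries a (X * Y * r / (1 - r) ^ 2)) := by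
  have ha' : -1 < a := by linarith
  have hra : |r| < 1 := by rwa [abs_of_pos hr0]
  have h1r : 0 < 1 - r := by linarith
  -- Expand the polynomial in `Y` and sum over `n` first, by `hasSum_laguerre_choose`. The remaining
  -- sum over `j` is the exponential generating function at `X/(1-r)` and `s = -Yr/(1-r)`.
  refine HasSum.swap_of_summable (F := fun j n : ℕ => (-Y) ^ j / Real.Gamma (j + a + 1) * r ^ j *
    ((n.choose j : ℝ) * r ^ (n - j) * (laguerreWeight a n * laguerreReduced a n X))) ?_
    (fun j => (hasSum_laguerre_choose ha' hra X j).mul_left _) (fun n => ?_) ?_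
  · refine Summable.of_norm ?_
    -- The majorant replaces `Y` by `-|Y|`, where every term of the reduced polynomial is
    -- nonnegative.
    have hsw := summable_prod_of_hasSum (F := fun n j : ℕ =>
        laguerreWeight a n * |laguerreReduced a n X| * r ^ n *
        ((n.choose j : ℝ) * ((-(-|Y|)) ^ j / Real.Gamma (j + a + 1)))) (fun n j => ?_)
        (fun n => (hasSum_choose_mul a n (-|Y|)).mul_left _)
        ((summable_laguerre_mul_laguerre ha hr0 hr X (-|Y|)).congr fun n => ?_)
    rotate_left
    · have := (laguerreWeight_pos ha' n).le
      have := (Gamma_nat_add_pos ha' j).le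
      rw [neg_neg]
      exact mul_nonneg (by positivity) (mul_nonneg (by positivity)
        (div_nonneg (by positivity) this))
    · rw [abs_of_nonneg (laguerreReduced_nonneg ha' n (by simp : -|Y| ≤ 0))]
      ring
    refine hsw.prod_symm.congr fun p => ?_
    rw [Real.norm_eq_abs, abs_mul, abs_mul, abs_mul, abs_mul, abs_mul, abs_div, abs_pow, abs_pow,
      abs_pow, abs_neg, neg_neg, Nat.abs_cast, abs_of_pos (laguerreWeight_pos ha' _),
      abs_of_pos (Gamma_nat_add_pos ha' _), abs_of_pos hr0]
    simp only [Prod.swap]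
    rcases le_or_gt p.1 p.2 with h | h
    · rw [← pow_mul_pow_sub r h]
      ring
    · rw [Nat.choose_eq_zero_of_lt h]
      simp
  · rw [mul_right_comm]
    refine ((hasSum_choose_mul a n Y).mul_left
      (laguerreWeight a n * laguerreReduced a n X * r ^ n)).congr_fun fun j => ?_
    rcases le_or_gt j n with h | h
    · rw [← pow_mul_pow_sub r h]
      ring
    · rw [Nat.choose_eq_zero_of_lt h]
      simp
  · have h := (hasSum_laguerreReduced_div_factorial ha (X / (1 - r)) (-Y * r / (1 - r))).mul_left
      ((1 - r) ^ (-(a + 1)) * Real.exp (-X * r / (1 - r)))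
    refine h.congr_both (fun j => ?_) ?_
    · have := (Gamma_nat_add_pos ha' j).ne'
      simp only [laguerreWeight, div_pow, mul_pow]
      field_simp
    · rw [show -(X + Y) * r / (1 - r) = -X * r / (1 - r) + -Y * r / (1 - r) by ring, Real.exp_add,
        show -(X / (1 - r)) * (-Y * r / (1 - r)) = X * Y * r / (1 - r) ^ 2 by field_simp]
      ring

/-! ### One-dimensional Laguerre functions -/

lemma laguerrePoly_eq (n : ℕ) (a x : ℝ) :
    laguerrePoly n a x = laguerreWeight a n * laguerreReduced a n x := by
  rw [laguerrePoly, laguerreReduced, laguerreWeight, Finset.mul_sum]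
  refine Finset.sum_congr rfl fun j hj => ?_
  have hjn : j ≤ n := Nat.lt_succ_iff.1 (Finset.mem_range.1 hj)
  rw [Nat.cast_choose ℝ hjn]
  have h2 : (n.factorial : ℝ) ≠ 0 := by positivity
  have h3 : (j.factorial : ℝ) ≠ 0 := by positivity
  have h4 : ((n - j).factorial : ℝ) ≠ 0 := by positivity
  field_simp

lemma laguerreHermite1_eq {a : ℝ} (ha : -1 < a) (n : ℕ) (u : ℝ) :
    laguerreHermite1 n a u = √2 * √(laguerreWeight a n) * laguerreReduced a n (u ^ 2) *
      u ^ (a + 1 / 2) * Real.exp (-u ^ 2 / 2) := by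
  have hw := laguerreWeight_pos ha n
  have h : √(Real.Gamma (n + 1) / Real.Gamma (n + a + 1)) * laguerreWeight a n
      = √(laguerreWeight a n) := by
    rw [Real.Gamma_nat_eq_factorial, ← inv_div, Real.sqrt_inv]
    change (√(laguerreWeight a n))⁻¹ * laguerreWeight a n = _
    rw [inv_mul_eq_div, Real.div_sqrt]
  rw [laguerreHermite1, laguerreNormalized, laguerrePoly_eq, ← h]
  ring

lemma measurable_laguerreHermite1 {a : ℝ} (ha : -1 < a) (n : ℕ) :
    Measurable (laguerreHermite1 n a) := by
  have : laguerreHermite1 n a = fun u => √2 * √(laguerreWeight a n) *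
      laguerreReduced a n (u ^ 2) * u ^ (a + 1 / 2) * Real.exp (-u ^ 2 / 2) :=
    funext fun u => laguerreHermite1_eq ha n u
  rw [this]
  unfold laguerreReduced
  fun_prop

lemma summable_abs_laguerreHermite1_mul_pow {a r : ℝ} (ha : -1 / 2 ≤ a) (hr0 : 0 < r) (hr : r < 1)
    (u : ℝ) : Summable fun n : ℕ => |laguerreHermite1 n a u| * r ^ n := by
  refine ((summable_sqrt_laguerreWeight_mul ha hr0 hr (u ^ 2)).mul_left
    (√2 * |u ^ (a + 1 / 2)| * Real.exp (-u ^ 2 / 2))).congr fun n => ?_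
  rw [laguerreHermite1_eq (by linarith), abs_mul, abs_mul, abs_mul, abs_mul,
    abs_of_nonneg (Real.sqrt_nonneg _), abs_of_nonneg (Real.sqrt_nonneg _), Real.abs_exp]
  ring

/-! ### Orthonormality of the one-dimensional Laguerre functions. -/

/-- Up to the sign `(-1)^n` this is an `n`-th forward difference, which kills polynomials of degree
below `n` and sends a monic one of degree `n` to `n!`. -/
lemma sum_choose_mul_ascPochhammer (y : ℝ) (n j : ℕ) (hj : j ≤ n) :
    ∑ i ∈ Finset.range (n + 1), (-1 : ℝ) ^ i * (n.choose i : ℝ) *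
      (ascPochhammer ℝ j).eval (i + y) = if j = n then (-1) ^ n * (n.factorial : ℝ) else 0 := by
  have h1 : (fwdDiff (1 : ℝ))^[n] (ascPochhammer ℝ j).eval y =
      if j = n then (n.factorial : ℝ) else 0 := by
    split_ifs with h
    · subst h
      have := congrFun (Polynomial.fwdDiff_iter_degree_eq_factorial (ascPochhammer ℝ j)) y
      rw [ascPochhammer_natDegree] at this
      rw [this, Polynomial.Monic.leadingCoeff (monic_ascPochhammer ℝ j)]
      simp
    · rw [Polynomial.fwdDiff_iter_eq_zero_of_degree_lt
        (by rw [ascPochhammer_natDegree]; omega)]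
      rfl
  rw [fwdDiff_iter_eq_sum_shift] at h1
  have h2 := congrArg (fun z => (-1 : ℝ) ^ n * z) h1
  simp only [Finset.mul_sum, mul_ite, mul_zero] at h2
  rw [← h2]
  refine Finset.sum_congr rfl fun i hi => ?_
  have hin : i ≤ n := Nat.lt_succ_iff.1 (Finset.mem_range.1 hi)
  have h3 : (-1 : ℝ) ^ n = (-1) ^ i * (-1) ^ (n - i) := by rw [← pow_add]; congr 1; omega
  have h4 : (-1 : ℝ) ^ (n - i) * (-1) ^ (n - i) = 1 := by rw [← mul_pow]; simp
  rw [zsmul_eq_mul, nsmul_eq_mul, mul_one, add_comm y, h3]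
  push_cast
  linear_combination (-(-1 : ℝ) ^ i * (n.choose i : ℝ) *
      (ascPochhammer ℝ j).eval (i + y)) * h4

lemma integrableOn_rpow_mul_exp_neg_sq {s : ℝ} (hs : -1 < s) :
    IntegrableOn (fun u : ℝ => u ^ s * Real.exp (-u ^ 2)) (Set.Ioi 0) := by
  simpa using integrableOn_rpow_mul_exp_neg_mul_sq one_pos hs

lemma integral_rpow_mul_exp_neg_sq {s : ℝ} (hs : -1 < s) :
    ∫ u in Set.Ioi (0 : ℝ), u ^ s * Real.exp (-u ^ 2) = 1 / 2 * Real.Gamma ((s + 1) / 2) := by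
  have := integral_rpow_mul_exp_neg_rpow (p := 2) two_pos hs
  simpa using this

lemma laguerreReduced_mul_eq_sum (a : ℝ) (n j : ℕ) {u : ℝ} (hu : 0 < u) :
    laguerreReduced a n (u ^ 2) * (u ^ (2 * j + 2 * a + 1) * Real.exp (-u ^ 2)) =
      ∑ i ∈ Finset.range (n + 1), (n.choose i : ℝ) * (-1) ^ i / Real.Gamma (i + a + 1) *
        (u ^ (2 * i + 2 * j + 2 * a + 1) * Real.exp (-u ^ 2)) := by
  rw [laguerreReduced, Finset.sum_mul]
  refine Finset.sum_congr rfl fun i _ => ?_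
  rw [show (2 * i + 2 * j + 2 * a + 1 : ℝ) = (2 * i : ℕ) + (2 * j + 2 * a + 1) by push_cast; ring,
    Real.rpow_add hu (2 * i : ℕ), Real.rpow_natCast, neg_pow, pow_mul]
  ring

lemma neg_one_lt_exponent {a : ℝ} (ha : -1 < a) (i j : ℕ) :
    -1 < (2 * i + 2 * j + 2 * a + 1 : ℝ) := by
  have h1 : (0 : ℝ) ≤ i := i.cast_nonneg
  have h2 : (0 : ℝ) ≤ j := j.cast_nonneg
  linarith

lemma integrableOn_laguerreReduced_mul {a : ℝ} (ha : -1 < a) (n j : ℕ) :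
    IntegrableOn (fun u : ℝ => laguerreReduced a n (u ^ 2) *
      (u ^ (2 * j + 2 * a + 1) * Real.exp (-u ^ 2))) (Set.Ioi 0) := by
  refine IntegrableOn.congr_fun (f := fun u : ℝ => ∑ i ∈ Finset.range (n + 1),
    (n.choose i : ℝ) * (-1) ^ i / Real.Gamma (i + a + 1) *
        (u ^ (2 * i + 2 * j + 2 * a + 1) * Real.exp (-u ^ 2))) ?_
    (fun u hu => (laguerreReduced_mul_eq_sum a n j hu).symm) measurableSet_Ioi
  exact integrable_finsetSum _ fun i _ =>
    (integrableOn_rpow_mul_exp_neg_sq (neg_one_lt_exponent ha i j)).const_mul _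

/-- The Gaussian moment of the `i`-th term is `Γ(j+i+a+1)/2`. Divided by the coefficient's
`Γ(i+a+1)` it becomes a rising factorial of degree `j` in `i`, so the sum is an `n`-th difference.
-/
lemma integral_laguerreReduced_mul {a : ℝ} (ha : -1 < a) {n j : ℕ} (hj : j ≤ n) :
    ∫ u in Set.Ioi (0 : ℝ), laguerreReduced a n (u ^ 2) *
      (u ^ (2 * j + 2 * a + 1) * Real.exp (-u ^ 2)) =
      if j = n then (-1) ^ n * (n.factorial : ℝ) / 2 else 0 := by
  rw [setIntegral_congr_fun measurableSet_Ioi fun u hu => laguerreReduced_mul_eq_sum a n j hu,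
    integral_finsetSum _ fun i _ =>
      (integrableOn_rpow_mul_exp_neg_sq (neg_one_lt_exponent ha i j)).const_mul _]
  have h := congrArg (fun z => z / 2) (sum_choose_mul_ascPochhammer (a + 1) n j hj)
  simp only [ite_div, zero_div] at h
  rw [← h, Finset.sum_div]
  refine Finset.sum_congr rfl fun i _ => ?_
  have hG := Gamma_nat_add_pos ha i
  have hi : (0 : ℝ) ≤ i := i.cast_nonneg
  rw [integral_const_mul, integral_rpow_mul_exp_neg_sq (neg_one_lt_exponent ha i j),
    show ((2 * i + 2 * j + 2 * a + 1 + 1) / 2 : ℝ) = j + (i + a + 1) by ring,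
    Real.Gamma_nat_add _ (by linarith), add_assoc (i : ℝ)] at *
  field_simp

lemma laguerreHermite1_mul_eq {a : ℝ} (ha : -1 < a) (n m : ℕ) {u : ℝ} (hu : 0 < u) :
    laguerreHermite1 n a u * laguerreHermite1 m a u =
      2 * √(laguerreWeight a n) * √(laguerreWeight a m) * ∑ j ∈ Finset.range (m + 1),
        (m.choose j : ℝ) * (-1) ^ j / Real.Gamma (j + a + 1) * (laguerreReduced a n (u ^ 2) *
        (u ^ (2 * j + 2 * a + 1) * Real.exp (-u ^ 2))) := by
  have h0 := laguerreReduced_mul_eq_sum a m 0 hu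
  have e1 : ∀ j : ℕ, (m.choose j : ℝ) * (-1) ^ j / Real.Gamma (j + a + 1) *
      (laguerreReduced a n (u ^ 2) * (u ^ (2 * j + 2 * a + 1) * Real.exp (-u ^ 2))) =
      laguerreReduced a n (u ^ 2) * ((m.choose j : ℝ) * (-1) ^ j / Real.Gamma (j + a + 1) *
      (u ^ (2 * j + 2 * (0 : ℕ) + 2 * a + 1 : ℝ) * Real.exp (-u ^ 2))) := by
    intro j
    simp only [Nat.cast_zero, mul_zero, add_zero]
    ring
  have e2 : u ^ (2 * (0 : ℕ) + 2 * a + 1 : ℝ) = u ^ (a + 1 / 2) * u ^ (a + 1 / 2) := by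
    rw [← Real.rpow_add hu]
    congr 1
    push_cast
    ring
  have e3 : Real.exp (-u ^ 2) = Real.exp (-u ^ 2 / 2) * Real.exp (-u ^ 2 / 2) := by
    rw [← Real.exp_add]
    congr 1
    ring
  rw [Finset.sum_congr rfl fun j _ => e1 j, ← Finset.mul_sum, ← h0, laguerreHermite1_eq ha,
    laguerreHermite1_eq ha, e2, e3]
  linear_combination (√(laguerreWeight a n) * √(laguerreWeight a m) * laguerreReduced a n (u ^ 2) *
    laguerreReduced a m (u ^ 2) * u ^ (a + 1 / 2) * u ^ (a + 1 / 2) * Real.exp (-u ^ 2 / 2) *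
    Real.exp (-u ^ 2 / 2)) * (Real.mul_self_sqrt (zero_le_two : (0 : ℝ) ≤ 2))

lemma integrableOn_laguerreHermite1_mul {a : ℝ} (ha : -1 < a) (n m : ℕ) :
    IntegrableOn (fun u => laguerreHermite1 n a u * laguerreHermite1 m a u) (Set.Ioi 0) := by
  refine IntegrableOn.congr_fun ?_ (fun u hu => (laguerreHermite1_mul_eq ha n m hu).symm)
    measurableSet_Ioi
  exact (integrable_finsetSum _ fun i _ =>
    (integrableOn_laguerreReduced_mul ha n i).const_mul _).const_mul _

lemma integral_laguerreHermite1_mul {a : ℝ} (ha : -1 < a) (n m : ℕ) :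
    ∫ u in Set.Ioi (0 : ℝ), laguerreHermite1 n a u * laguerreHermite1 m a u =
      if n = m then 1 else 0 := by
  -- Expanding the factor of lower degree in monomials, only the power `j = n` can survive, and it
  -- occurs only if `m = n`.
  wlog hmn : m ≤ n generalizing n m
  · have := this m n (by omega)
    simp only [mul_comm (laguerreHermite1 m a _), eq_comm (a := m)] at this
    exact this
  rw [setIntegral_congr_fun measurableSet_Ioi fun u hu => laguerreHermite1_mul_eq ha n m hu,
    integral_const_mul, integral_finsetSum _ fun i _ =>
    (integrableOn_laguerreReduced_mul ha n i).const_mul _]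
  have e : ∀ j ∈ Finset.range (m + 1), ∫ u in Set.Ioi (0 : ℝ),
      (m.choose j : ℝ) * (-1) ^ j / Real.Gamma (j + a + 1) * (laguerreReduced a n (u ^ 2) *
        (u ^ (2 * j + 2 * a + 1) * Real.exp (-u ^ 2))) = if j = n then
          (n.factorial : ℝ) / (2 * Real.Gamma (n + a + 1)) else 0 := by
    intro j hj
    have hjm : j ≤ m := Nat.lt_succ_iff.1 (Finset.mem_range.1 hj)
    rw [integral_const_mul, integral_laguerreReduced_mul ha (hjm.trans hmn)]
    split_ifs with h
    · obtain rfl : m = n := by omega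
      subst h
      have h4 : (-1 : ℝ) ^ j * (-1) ^ j = 1 := by rw [← mul_pow]; simp
      have hG := Gamma_nat_add_pos ha j
      rw [Nat.choose_self]
      field_simp
      linear_combination h4
    · simp
  rw [Finset.sum_congr rfl e, Finset.sum_ite_eq']
  split_ifs with h1 h2 h2
  · subst h2
    have hw := laguerreWeight_pos ha n
    have hG := Gamma_nat_add_pos ha n
    rw [mul_assoc 2, Real.mul_self_sqrt hw.le, laguerreWeight]
    have h2 : (n.factorial : ℝ) ≠ 0 := by positivity
    field_simp
  · have := Finset.mem_range.1 h1
    omega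
  · simp [h2] at h1
  · simp

/-! ### The one-dimensional heat kernel -/

/-- The closed form of the one-dimensional heat kernel. -/
def laguerreKernel1 (a t x y : ℝ) : ℝ :=
  2 * (2 * Real.sinh (2 * t)) ^ (-(a + 1)) *
    Real.exp (-(Real.cosh (2 * t) / (2 * Real.sinh (2 * t))) * (x ^ 2 + y ^ 2)) *
    |x * y| ^ (a + 1 / 2) * besselSeries a ((x * y / (2 * Real.sinh (2 * t))) ^ 2)

/-- The absolute value in the closed form gives nonnegativity on the whole plane, so the general
kernel lemmas apply without restricting to positive arguments. -/
lemma laguerreKernel1_nonneg {a t : ℝ} (ha : -1 < a) (ht : 0 < t) (x y : ℝ) :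
    0 ≤ laguerreKernel1 a t x y := by
  have hS : 0 < Real.sinh (2 * t) := Real.sinh_pos_iff.2 (by linarith)
  have := besselSeries_nonneg ha (sq_nonneg (x * y / (2 * Real.sinh (2 * t))))
  unfold laguerreKernel1
  positivity

lemma laguerreKernel1_comm (a t x y : ℝ) : laguerreKernel1 a t x y = laguerreKernel1 a t y x := by
  unfold laguerreKernel1
  rw [mul_comm x y, add_comm (x ^ 2)]

lemma hasSum_laguerreKernel1 {a t x y : ℝ} (ha : -1 / 2 ≤ a) (ht : 0 < t) (hx : 0 < x)
    (hy : 0 < y) : HasSum (fun n : ℕ => Real.exp (-t * (4 * n + 2 * a + 2)) *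
      laguerreHermite1 n a x * laguerreHermite1 n a y) (laguerreKernel1 a t x y) := by
  have ha' : -1 < a := by linarith
  set E := Real.exp (2 * t) with hE
  have hE1 : 1 < E := Real.one_lt_exp_iff.2 (by linarith)
  have hE0 : 0 < E := by linarith
  have hr0 : 0 < (E⁻¹) ^ 2 := by positivity
  have hr1 : (E⁻¹) ^ 2 < 1 := pow_lt_one₀ (by positivity) (inv_lt_one_of_one_lt₀ hE1) two_ne_zero
  -- The Hille-Hardy variable is `r = E⁻² = e^{-4t}`, so hyperbolic functions of `2t` become
  -- rational in `E`.
  have h2S : 2 * Real.sinh (2 * t) = E * (1 - (E⁻¹) ^ 2) := by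
    rw [Real.sinh_eq, Real.exp_neg, ← hE]
    field_simp
  have hC : Real.cosh (2 * t) = (E + E⁻¹) / 2 := by
    rw [Real.cosh_eq, Real.exp_neg]
  have hEr : ∀ n : ℕ, Real.exp (-t * (4 * n + 2 * a + 2)) = E ^ (-(a + 1)) * ((E⁻¹) ^ 2) ^ n := by
    intro n
    rw [hE, ← Real.exp_mul, ← Real.exp_neg, ← Real.exp_nat_mul, ← Real.exp_nat_mul,
      ← Real.exp_add]
    congr 1
    push_cast
    ring
  have h1r : 0 < 1 - (E⁻¹) ^ 2 := by linarith
  have hE2 : E ^ 2 - 1 ≠ 0 := by nlinarith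
  refine ((hasSum_hille_hardy ha hr0 hr1 (x ^ 2) (y ^ 2)).mul_left (2 * E ^ (-(a + 1)) *
    x ^ (a + 1 / 2) * y ^ (a + 1 / 2) * Real.exp (-x ^ 2 / 2) * Real.exp (-y ^ 2 / 2))).congr_both
    (fun n => ?_) ?_
  · rw [hEr, laguerreHermite1_eq ha', laguerreHermite1_eq ha']
    linear_combination (E ^ (-(a + 1)) * ((E⁻¹) ^ 2) ^ n * laguerreReduced a n (x ^ 2) *
      laguerreReduced a n (y ^ 2) * x ^ (a + 1 / 2) * y ^ (a + 1 / 2) * Real.exp (-x ^ 2 / 2) *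
      Real.exp (-y ^ 2 / 2)) * (√(laguerreWeight a n) ^ 2 * Real.sq_sqrt (zero_le_two : (0 : ℝ) ≤ 2)
      + 2 * Real.sq_sqrt (laguerreWeight_pos ha' n).le)
  · rw [laguerreKernel1, h2S, hC, Real.mul_rpow hE0.le h1r.le, abs_of_pos (by positivity),
      Real.mul_rpow hx.le hy.le]
    have e1 : -((E + E⁻¹) / 2 / (E * (1 - (E⁻¹) ^ 2))) * (x ^ 2 + y ^ 2) =
        -(x ^ 2 + y ^ 2) * (E⁻¹) ^ 2 / (1 - (E⁻¹) ^ 2) + -x ^ 2 / 2 + -y ^ 2 / 2 := by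
      field_simp
      ring
    have e2 : (x * y / (E * (1 - E⁻¹ ^ 2))) ^ 2 =
        x ^ 2 * y ^ 2 * E⁻¹ ^ 2 / (1 - E⁻¹ ^ 2) ^ 2 := by
      field_simp
    rw [e1, Real.exp_add, Real.exp_add, e2]
    ring

lemma measurable_laguerreKernel1 (a t : ℝ) :
    Measurable fun p : ℝ × ℝ => laguerreKernel1 a t p.1 p.2 := by
  have h : Measurable (besselSeries a) := by
    unfold besselSeries
    exact Measurable.tsum fun m => by fun_prop
  have h2 : Measurable fun p : ℝ × ℝ =>
      besselSeries a ((p.1 * p.2 / (2 * Real.sinh (2 * t))) ^ 2) := h.comp (by fun_prop)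
  have h3 : Measurable fun p : ℝ × ℝ => |p.1 * p.2| ^ (a + 1 / 2) := by fun_prop
  unfold laguerreKernel1
  exact ((measurable_const.mul (by fun_prop)).mul h3).mul h2

/-- For fixed `x` the power and Bessel factors grow at most exponentially in `y`, and the Gaussian
dominates both. -/
lemma exists_laguerreKernel1_le {a t : ℝ} (ha : -1 / 2 ≤ a) (ht : 0 < t) {x : ℝ} (hx : 0 < x) :
    ∃ K : ℝ, ∀ y, 0 < y → laguerreKernel1 a t x y ≤ K := by
  have hS : 0 < Real.sinh (2 * t) := Real.sinh_pos_iff.2 (by linarith)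
  have hC : 0 < Real.cosh (2 * t) := Real.cosh_pos _
  have hG0 : 0 < Real.Gamma (a + 1) := Real.Gamma_pos_of_pos (by linarith)
  set S := Real.sinh (2 * t)
  set C := Real.cosh (2 * t)
  set b := C / (2 * S) with hb
  have hb0 : 0 < b := by positivity
  -- `D` is the total coefficient of `y` in the exponents of the two growing factors; completing the
  -- square against `-b y²` costs `D²/(4b)`.
  set D := (a + 1 / 2 + 1 / S) * x with hD
  refine ⟨2 * (2 * S) ^ (-(a + 1)) * (1 / Real.Gamma (a + 1)) * Real.exp (D ^ 2 / (4 * b)),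
    fun y hy => ?_⟩
  have hxy : 0 < x * y := mul_pos hx hy
  have h1 : |x * y| ^ (a + 1 / 2) ≤ Real.exp ((a + 1 / 2) * (x * y)) := by
    rw [abs_of_pos hxy, mul_comm (a + 1 / 2), Real.exp_mul]
    have h := Real.add_one_le_exp (x * y)
    exact Real.rpow_le_rpow hxy.le (by linarith) (by linarith)
  have h2 : besselSeries a ((x * y / (2 * S)) ^ 2) ≤
      1 / Real.Gamma (a + 1) * Real.exp (1 / S * (x * y)) := by
    refine (besselSeries_sq_le ha _).trans ?_
    gcongr
    have h : 2 * (x * y / (2 * S)) = 1 / S * (x * y) := by field_simp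
    rw [h, Real.cosh_eq]
    have : Real.exp (-(1 / S * (x * y))) ≤ Real.exp (1 / S * (x * y)) :=
      Real.exp_le_exp.2 (by have : 0 < 1 / S * (x * y) := by positivity
                            linarith)
    linarith
  have h3 := besselSeries_nonneg (by linarith : -1 < a) (sq_nonneg (x * y / (2 * S)))
  have h4 : Real.exp (-b * (x ^ 2 + y ^ 2)) * Real.exp ((a + 1 / 2) * (x * y)) *
      Real.exp (1 / S * (x * y)) ≤ Real.exp (D ^ 2 / (4 * b)) := by
    rw [← Real.exp_add, ← Real.exp_add, Real.exp_le_exp]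
    have : D ^ 2 / (4 * b) - (-b * (x ^ 2 + y ^ 2) + (a + 1 / 2) * (x * y) + 1 / S * (x * y)) =
        b * x ^ 2 + (2 * b * y - D) ^ 2 / (4 * b) := by
      rw [hD]
      field_simp
      ring
    have h5 : 0 ≤ b * x ^ 2 + (2 * b * y - D) ^ 2 / (4 * b) := by positivity
    linarith
  calc laguerreKernel1 a t x y = 2 * (2 * S) ^ (-(a + 1)) * Real.exp (-b * (x ^ 2 + y ^ 2)) *
        |x * y| ^ (a + 1 / 2) * besselSeries a ((x * y / (2 * S)) ^ 2) := rfl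
    _ ≤ 2 * (2 * S) ^ (-(a + 1)) * Real.exp (-b * (x ^ 2 + y ^ 2)) *
        Real.exp ((a + 1 / 2) * (x * y)) *
        (1 / Real.Gamma (a + 1) * Real.exp (1 / S * (x * y))) := by gcongr
    _ = 2 * (2 * S) ^ (-(a + 1)) * (1 / Real.Gamma (a + 1)) *
        (Real.exp (-b * (x ^ 2 + y ^ 2)) * Real.exp ((a + 1 / 2) * (x * y)) *
        Real.exp (1 / S * (x * y))) := by ring
    _ ≤ _ := by gcongr

/-! ### The mass of the one-dimensional heat kernel -/

/-- With `δ = a/2 + 1/4` and `w = x²/(2 sinh 2t cosh 2t)`, the quotient of `∫ G_t(x,y) dy` and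
`(cosh 2t)^{-1/2} exp(-(sinh 2t)² w)`. -/
def laguerreMass (δ w : ℝ) : ℝ≥0∞ :=
  ∑' m : ℕ, ENNReal.ofReal (Real.exp (-w) * w ^ δ *
    (w ^ m * Real.Gamma (m + δ + 1 / 2) / ((m.factorial : ℝ) * Real.Gamma (m + 2 * δ + 1 / 2))))

lemma lintegral_rpow_mul_exp_neg_mul_sq {s b : ℝ} (hs : -1 < s) (hb : 0 < b) :
    ∫⁻ y in Set.Ioi (0 : ℝ), ENNReal.ofReal (y ^ s * Real.exp (-b * y ^ 2)) =
      ENNReal.ofReal (b ^ (-(s + 1) / 2) * (1 / 2) * Real.Gamma ((s + 1) / 2)) := by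
  have h := integral_rpow_mul_exp_neg_mul_rpow (p := 2) two_pos hs hb
  simp only [Real.rpow_ofNat] at h
  rw [← h, ofReal_integral_eq_lintegral_ofReal (integrableOn_rpow_mul_exp_neg_mul_sq hb hs)]
  filter_upwards [ae_restrict_mem measurableSet_Ioi] with y (hy : 0 < y)
  positivity

/-- Expand the Bessel series and integrate the Gaussian moments term by term; positivity makes the
interchange free. -/
lemma lintegral_laguerreKernel1 {a t : ℝ} (ha : -1 / 2 ≤ a) (ht : 0 < t) {x : ℝ} (hx : 0 < x) :
    ∫⁻ y in Set.Ioi (0 : ℝ), ENNReal.ofReal (laguerreKernel1 a t x y) =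
      ENNReal.ofReal (Real.cosh (2 * t) ^ (-1 / 2 : ℝ) * Real.exp (-(Real.sinh (2 * t)) ^ 2 *
        (x ^ 2 / (2 * Real.sinh (2 * t) * Real.cosh (2 * t))))) *
      laguerreMass (a / 2 + 1 / 4) (x ^ 2 / (2 * Real.sinh (2 * t) * Real.cosh (2 * t))) := by
  have hS : 0 < Real.sinh (2 * t) := Real.sinh_pos_iff.2 (by linarith)
  have hC : 0 < Real.cosh (2 * t) := Real.cosh_pos _
  have hCS : Real.cosh (2 * t) ^ 2 = Real.sinh (2 * t) ^ 2 + 1 := Real.cosh_sq _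
  have ha' : -1 < a := by linarith
  have hG := fun m : ℕ => Gamma_nat_add_pos ha' m
  unfold laguerreKernel1
  set S := Real.sinh (2 * t)
  set C := Real.cosh (2 * t)
  set b := C / (2 * S) with hb
  set w := x ^ 2 / (2 * S * C) with hw
  set δ := a / 2 + 1 / 4 with hδ
  have hb0 : 0 < b := by positivity
  have hw0 : 0 < w := by positivity
  have hδ0 : 0 ≤ δ := by rw [hδ]; linarith
  have hterm : ∀ y ∈ Set.Ioi (0 : ℝ), ENNReal.ofReal (2 * (2 * S) ^ (-(a + 1)) *
      Real.exp (-b * (x ^ 2 + y ^ 2)) * |x * y| ^ (a + 1 / 2) *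
      besselSeries a ((x * y / (2 * S)) ^ 2)) =
      ∑' m : ℕ, ENNReal.ofReal (2 * (2 * S) ^ (-(a + 1)) * Real.exp (-b * x ^ 2) *
        x ^ (a + 1 / 2) * ((x / (2 * S)) ^ 2) ^ m / ((m.factorial : ℝ) * Real.Gamma (m + a + 1))) *
        ENNReal.ofReal (y ^ (2 * m + (a + 1 / 2)) * Real.exp (-b * y ^ 2)) := by
    intro y hy
    have hy : 0 < y := hy
    have hG' := hG
    rw [besselSeries, ← tsum_mul_left, ENNReal.ofReal_tsum_of_nonneg]
    · refine tsum_congr fun m => ?_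
      have := hG m
      rw [← ENNReal.ofReal_mul (by positivity)]
      congr 1
      rw [abs_of_pos (mul_pos hx hy), Real.mul_rpow hx.le hy.le, Real.rpow_add hy (2 * m), mul_add,
        Real.exp_add, show (2 * m : ℝ) = (2 * m : ℕ) by push_cast; ring, Real.rpow_natCast,
        pow_mul, show (x * y / (2 * S)) ^ 2 = (x / (2 * S)) ^ 2 * y ^ 2 by ring, mul_pow]
      field_simp
    · intro m
      have := hG m
      positivity
    · exact (summable_besselTerm ha _).of_norm.mul_left _
  rw [setLIntegral_congr_fun measurableSet_Ioi hterm,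
    lintegral_tsum fun m => by fun_prop, laguerreMass, ← ENNReal.tsum_mul_left]
  refine tsum_congr fun m => ?_
  have hm : (0 : ℝ) ≤ m := m.cast_nonneg
  have hGm := hG m
  have hGd : 0 < Real.Gamma (m + δ + 1 / 2) := Real.Gamma_pos_of_pos (by positivity)
  rw [lintegral_const_mul _ (by fun_prop), lintegral_rpow_mul_exp_neg_mul_sq (by linarith) hb0,
    ← ENNReal.ofReal_mul (by positivity), ← ENNReal.ofReal_mul (by positivity)]
  congr 1
  rw [show (2 * m + (a + 1 / 2) + 1) / 2 = m + δ + 1 / 2 by rw [hδ]; ring,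
    show -(2 * m + (a + 1 / 2) + 1) / 2 = -(δ + 1 / 2) - m by rw [hδ]; ring,
    show (m : ℝ) + 2 * δ + 1 / 2 = m + a + 1 by rw [hδ]; ring, Real.rpow_sub hb0,
    Real.rpow_natCast]
  -- Here `b x² = C² w`, and `C² = S² + 1` splits off the factor `e^{-w}` belonging to the mass.
  have e1 : Real.exp (-b * x ^ 2) = Real.exp (-S ^ 2 * w) * Real.exp (-w) := by
    rw [← Real.exp_add]
    congr 1
    rw [hb, hw]
    field_simp
    linear_combination (-1 : ℝ) * hCS
  have e2 : ((x / (2 * S)) ^ 2) ^ m = w ^ m * b ^ m := by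
    rw [← mul_pow, hb, hw]
    congr 1
    field_simp
  -- The powers of `2S` cancel because `a + 1 = 2δ + 1/2`.
  have e3 : (2 * S) ^ (-(a + 1)) * x ^ (a + 1 / 2) * b ^ (-(δ + 1 / 2)) =
      C ^ (-1 / 2 : ℝ) * w ^ δ := by
    have h2S : (0 : ℝ) < 2 * S := by positivity
    have hx2 : x ^ (a + 1 / 2) = w ^ δ * ((2 * S) ^ δ * C ^ δ) := by
      rw [← Real.mul_rpow h2S.le hC.le, ← Real.mul_rpow hw0.le (by positivity), hw,
        div_mul_cancel₀ _ (by positivity), ← Real.rpow_natCast, ← Real.rpow_mul hx.le, hδ]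
      congr 1
      push_cast
      ring
    have hbd : b ^ (-(δ + 1 / 2)) = C ^ (-(δ + 1 / 2)) * (2 * S) ^ (δ + 1 / 2) := by
      rw [hb, Real.div_rpow hC.le h2S.le, Real.rpow_neg h2S.le (δ + 1 / 2), div_inv_eq_mul]
    rw [hx2, hbd]
    have h1 : (2 * S) ^ (-(a + 1)) * (2 * S) ^ δ * (2 * S) ^ (δ + 1 / 2) = 1 := by
      rw [← Real.rpow_add h2S, ← Real.rpow_add h2S,
        show -(a + 1) + δ + (δ + 1 / 2) = 0 by rw [hδ]; ring, Real.rpow_zero]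
    have h2 : C ^ δ * C ^ (-(δ + 1 / 2)) = C ^ (-1 / 2 : ℝ) := by
      rw [← Real.rpow_add hC]
      congr 1
      ring
    calc _ = ((2 * S) ^ (-(a + 1)) * (2 * S) ^ δ * (2 * S) ^ (δ + 1 / 2)) *
        (C ^ δ * C ^ (-(δ + 1 / 2))) * w ^ δ := by ring
      _ = _ := by rw [h1, h2, one_mul]
  rw [e1, e2]
  have hbm : b ^ m ≠ 0 := by positivity
  calc _ = ((2 * S) ^ (-(a + 1)) * x ^ (a + 1 / 2) * b ^ (-(δ + 1 / 2))) * (Real.exp (-S ^ 2 * w) *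
        Real.exp (-w)) * w ^ m * Real.Gamma (m + δ + 1 / 2) /
          ((m.factorial : ℝ) * Real.Gamma (m + a + 1)) := by field_simp
    _ = _ := by rw [e3]; field_simp

/-- For `δ = 0`, that is `a = -1/2`, the two Gamma factors cancel and the exponential series
remains. The Beta representation degenerates here, so this case stands alone. -/
lemma laguerreMass_zero {w : ℝ} (hw : 0 < w) : laguerreMass 0 w = 1 := by
  have e : ∀ m : ℕ, Real.exp (-w) * w ^ (0 : ℝ) * (w ^ m * Real.Gamma (m + 0 + 1 / 2) /
      ((m.factorial : ℝ) * Real.Gamma (m + 2 * 0 + 1 / 2))) =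
      Real.exp (-w) * (w ^ m / (m.factorial : ℝ)) := by
    intro m
    have : 0 < Real.Gamma (m + 1 / 2) := Real.Gamma_pos_of_pos (by positivity)
    rw [mul_zero, add_zero, Real.rpow_zero]
    field_simp
  simp only [laguerreMass, e]
  have h := (NormedSpace.expSeries_div_hasSum_exp w).mul_left (Real.exp (-w))
  rw [← Real.exp_eq_exp_ℝ] at h
  rw [← ENNReal.ofReal_tsum_of_nonneg (fun m => by positivity) h.summable, h.tsum_eq,
    ← Real.exp_add]
  simp

/-! ### Beta integral representation of the mass, with upper and lower bounds. -/

lemma lintegral_rpow_mul_one_sub_rpow {p q : ℝ} (hp : 0 < p) (hq : 0 < q) :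
    ∫⁻ σ in Set.Ioo (0 : ℝ) 1, ENNReal.ofReal (σ ^ (p - 1) * (1 - σ) ^ (q - 1)) =
      ENNReal.ofReal (Real.Gamma p * Real.Gamma q / Real.Gamma (p + q)) := by
  have hb := ProbabilityTheory.beta_pos hp hq
  have h := ProbabilityTheory.lintegral_betaPDF_eq_one hp hq
  rw [ProbabilityTheory.lintegral_betaPDF] at h
  have e : ∀ σ : ℝ, ENNReal.ofReal (1 / ProbabilityTheory.beta p q * σ ^ (p - 1) *
      (1 - σ) ^ (q - 1)) = ENNReal.ofReal (1 / ProbabilityTheory.beta p q) *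
      ENNReal.ofReal (σ ^ (p - 1) * (1 - σ) ^ (q - 1)) := fun σ => by
    rw [mul_assoc, ENNReal.ofReal_mul (by positivity)]
  simp only [e] at h
  rw [lintegral_const_mul _ (by fun_prop)] at h
  have h2 := congrArg (fun z => ENNReal.ofReal (ProbabilityTheory.beta p q) * z) h
  simp only [← mul_assoc, mul_one] at h2
  rw [← ENNReal.ofReal_mul hb.le, mul_one_div_cancel hb.ne', ENNReal.ofReal_one, one_mul] at h2
  exact h2

/-- The quotient `Γ(m+δ+1/2)/Γ(m+2δ+1/2)` is a Beta integral over `Γ(δ)`; under the integral the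
series in `m` sums to `e^{w(1-σ)}`. What results is a truncated Gamma expectation of
`(1-σ)^{δ-1/2}`, in which `δ = 1/2` is visibly the threshold. -/
lemma laguerreMass_eq {δ w : ℝ} (hδ : 0 < δ) (hw : 0 < w) :
    laguerreMass δ w = ENNReal.ofReal (Real.Gamma δ)⁻¹ * ∫⁻ σ in Set.Ioo (0 : ℝ) 1,
      ENNReal.ofReal (w ^ δ * Real.exp (-(w * σ)) * σ ^ (δ - 1) * (1 - σ) ^ (δ - 1 / 2)) := by
  have hG : 0 < Real.Gamma δ := Real.Gamma_pos_of_pos hδ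
  have hterm : ∀ σ ∈ Set.Ioo (0 : ℝ) 1,
      ENNReal.ofReal (w ^ δ * Real.exp (-(w * σ)) * σ ^ (δ - 1) * (1 - σ) ^ (δ - 1 / 2)) =
      ∑' m : ℕ, ENNReal.ofReal (w ^ δ * Real.exp (-w) * (w ^ m / (m.factorial : ℝ))) *
        ENNReal.ofReal (σ ^ (δ - 1) * (1 - σ) ^ (m + δ + 1 / 2 - 1)) := by
    intro σ hσ
    have hσ0 : 0 < σ := hσ.1
    have hσ1 : 0 < 1 - σ := by linarith [hσ.2]
    have h := (NormedSpace.expSeries_div_hasSum_exp (w * (1 - σ))).mul_left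
      (w ^ δ * Real.exp (-w) * σ ^ (δ - 1) * (1 - σ) ^ (δ - 1 / 2))
    rw [← Real.exp_eq_exp_ℝ] at h
    have e : w ^ δ * Real.exp (-(w * σ)) * σ ^ (δ - 1) * (1 - σ) ^ (δ - 1 / 2) =
        w ^ δ * Real.exp (-w) * σ ^ (δ - 1) * (1 - σ) ^ (δ - 1 / 2) *
          Real.exp (w * (1 - σ)) := by
      rw [show -(w * σ) = -w + w * (1 - σ) by ring, Real.exp_add]
      ring
    rw [e, ← h.tsum_eq, ENNReal.ofReal_tsum_of_nonneg (fun m => by positivity) h.summable]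
    refine tsum_congr fun m => ?_
    rw [← ENNReal.ofReal_mul (by positivity), mul_pow,
      show (m + δ + 1 / 2 - 1 : ℝ) = (m : ℝ) + (δ - 1 / 2) by ring, Real.rpow_add hσ1,
      Real.rpow_natCast]
    congr 1
    ring
  rw [setLIntegral_congr_fun measurableSet_Ioo hterm, lintegral_tsum fun m => by fun_prop,
    laguerreMass, ← ENNReal.tsum_mul_left]
  refine tsum_congr fun m => ?_
  have hm : (0 : ℝ) ≤ m := m.cast_nonneg
  rw [lintegral_const_mul _ (by fun_prop), lintegral_rpow_mul_one_sub_rpow hδ (by positivity),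
    ← ENNReal.ofReal_mul (by positivity), ← ENNReal.ofReal_mul (by positivity),
    show δ + (m + δ + 1 / 2) = m + 2 * δ + 1 / 2 by ring]
  congr 1
  field_simp

lemma ofReal_integral_le_lintegral_ofReal {X : Type*} [MeasurableSpace X] {μ : Measure X}
    {f : X → ℝ} (hf : Integrable f μ) :
    ENNReal.ofReal (∫ x, f x ∂μ) ≤ ∫⁻ x, ENNReal.ofReal (f x) ∂μ := by
  rw [integral_eq_lintegral_pos_part_sub_lintegral_neg_part hf]
  refine (ENNReal.ofReal_le_ofReal (sub_le_self _ ENNReal.toReal_nonneg)).trans ?_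
  exact ENNReal.ofReal_toReal_le

lemma integrableOn_rpow_mul_exp_neg_mul {δ w : ℝ} (hδ : 0 < δ) (hw : 0 < w) :
    IntegrableOn (fun σ : ℝ => w ^ δ * Real.exp (-(w * σ)) * σ ^ (δ - 1)) (Set.Ioi 0) := by
  have h := integrableOn_rpow_mul_exp_neg_mul_rpow (p := 1) (s := δ - 1) (b := w) (by linarith)
    one_pos hw
  refine IntegrableOn.congr_fun (h.const_mul (w ^ δ)) (fun σ _ => ?_) measurableSet_Ioi
  simp only [Real.rpow_one, neg_mul]
  ring

lemma integral_rpow_mul_exp_neg_mul {δ w : ℝ} (hδ : 0 < δ) (hw : 0 < w) :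
    ∫ σ in Set.Ioi (0 : ℝ), w ^ δ * Real.exp (-(w * σ)) * σ ^ (δ - 1) = Real.Gamma δ := by
  have h := Real.integral_rpow_mul_exp_neg_mul_Ioi hδ hw
  simp only [mul_assoc, integral_const_mul]
  simp only [mul_comm (Real.exp _)]
  rw [h, ← mul_assoc, one_div, Real.inv_rpow hw.le, mul_inv_cancel₀ (by positivity), one_mul]

lemma lintegral_rpow_mul_exp_neg_mul {δ w : ℝ} (hδ : 0 < δ) (hw : 0 < w) :
    ∫⁻ σ in Set.Ioi (0 : ℝ), ENNReal.ofReal (w ^ δ * Real.exp (-(w * σ)) * σ ^ (δ - 1)) =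
      ENNReal.ofReal (Real.Gamma δ) := by
  rw [← integral_rpow_mul_exp_neg_mul hδ hw,
    ofReal_integral_eq_lintegral_ofReal (integrableOn_rpow_mul_exp_neg_mul hδ hw)]
  filter_upwards [ae_restrict_mem measurableSet_Ioi] with y (hy : 0 < y)
  positivity

/-- For `δ ≥ 1/2` the factor `(1-σ)^{δ-1/2}` is at most one, and dropping it leaves part of a
probability density. -/
lemma laguerreMass_le_one {δ w : ℝ} (hδ : δ = 0 ∨ 1 / 2 ≤ δ) (hw : 0 < w) :
    laguerreMass δ w ≤ 1 := by
  rcases hδ with rfl | hδ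
  · exact (laguerreMass_zero hw).le
  have hδ0 : 0 < δ := by linarith
  have hG : 0 < Real.Gamma δ := Real.Gamma_pos_of_pos hδ0
  rw [laguerreMass_eq hδ0 hw]
  calc _ ≤ ENNReal.ofReal (Real.Gamma δ)⁻¹ * ∫⁻ σ in Set.Ioo (0 : ℝ) 1,
        ENNReal.ofReal (w ^ δ * Real.exp (-(w * σ)) * σ ^ (δ - 1)) := by
        refine mul_le_mul' le_rfl (setLIntegral_mono' measurableSet_Ioo fun σ hσ => ?_)
        refine ENNReal.ofReal_le_ofReal ?_
        have hσ0 : 0 < σ := hσ.1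
        exact mul_le_of_le_one_right (by positivity)
          (Real.rpow_le_one (by linarith [hσ.2]) (by linarith) (by linarith))
    _ ≤ ENNReal.ofReal (Real.Gamma δ)⁻¹ * ∫⁻ σ in Set.Ioi (0 : ℝ),
        ENNReal.ofReal (w ^ δ * Real.exp (-(w * σ)) * σ ^ (δ - 1)) := by
        gcongr
        exact Set.Ioo_subset_Ioi_self
    _ = 1 := by
        rw [lintegral_rpow_mul_exp_neg_mul hδ0 hw, ← ENNReal.ofReal_mul (by positivity),
          inv_mul_cancel₀ hG.ne', ENNReal.ofReal_one]

lemma exists_laguerreMass_le {δ : ℝ} (hδ : 0 ≤ δ) :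
    ∃ c : ℝ, 1 ≤ c ∧ ∀ w, 0 < w → laguerreMass δ w ≤ ENNReal.ofReal c := by
  by_cases h : δ = 0 ∨ 1 / 2 ≤ δ
  · exact ⟨1, le_rfl, fun w hw => by simpa using laguerreMass_le_one h hw⟩
  push Not at h
  have hδ0 : 0 < δ := lt_of_le_of_ne hδ (Ne.symm h.1)
  have hδ1 := h.2
  have hG : 0 < Real.Gamma δ := Real.Gamma_pos_of_pos hδ0
  -- For `0 < δ < 1/2` the factor `(1-σ)^{δ-1/2}` is singular at `1` but integrable, with integral
  -- `B` over `(0,1)`.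
  set B := Real.Gamma 1 * Real.Gamma (δ + 1 / 2) / Real.Gamma (1 + (δ + 1 / 2)) with hB
  have hB0 : 0 < B := div_pos (mul_pos (Real.Gamma_pos_of_pos one_pos)
    (Real.Gamma_pos_of_pos (by linarith))) (Real.Gamma_pos_of_pos (by linarith))
  have hBint := lintegral_rpow_mul_one_sub_rpow (p := 1) (q := δ + 1 / 2) one_pos (by linarith)
  refine ⟨1 + (Real.Gamma δ)⁻¹ * (2 * Real.Gamma δ + 8 * B), by
    have : 0 ≤ (Real.Gamma δ)⁻¹ * (2 * Real.Gamma δ + 8 * B) := by positivity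
    linarith, fun w hw => ?_⟩
  rw [laguerreMass_eq hδ0 hw]
  -- Split at `σ = 1/2`: to the left the singular factor is at most `2`; to the right the remaining
  -- factors are at most `6`, uniformly in `w`, because `e^{-w/2}` beats `w^δ`. The constant `8` has
  -- room to spare.
  have hpt : ∀ σ ∈ Set.Ioo (0 : ℝ) 1,
      w ^ δ * Real.exp (-(w * σ)) * σ ^ (δ - 1) * (1 - σ) ^ (δ - 1 / 2) ≤
      2 * (w ^ δ * Real.exp (-(w * σ)) * σ ^ (δ - 1)) +
      8 * (σ ^ ((1 : ℝ) - 1) * (1 - σ) ^ (δ + 1 / 2 - 1)) := by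
    intro σ hσ
    have hσ0 : 0 < σ := hσ.1
    have hσ1 : 0 < 1 - σ := by linarith [hσ.2]
    rw [sub_self, Real.rpow_zero, one_mul, show δ + 1 / 2 - 1 = δ - 1 / 2 by ring]
    rcases le_or_gt σ (1 / 2) with hs | hs
    · have h1 : (1 - σ) ^ (δ - 1 / 2) ≤ 2 := by
        calc (1 - σ) ^ (δ - 1 / 2) ≤ (1 / 2) ^ (δ - 1 / 2) :=
              Real.rpow_le_rpow_of_nonpos (by norm_num) (by linarith) (by linarith)
          _ ≤ (1 / 2) ^ (-1 : ℝ) :=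
              Real.rpow_le_rpow_of_exponent_ge (by norm_num) (by norm_num) (by linarith)
          _ = 2 := by rw [Real.rpow_neg_one]; norm_num
      have h2 : 0 ≤ w ^ δ * Real.exp (-(w * σ)) * σ ^ (δ - 1) := by positivity
      have h3 : 0 ≤ (1 - σ) ^ (δ - 1 / 2) := by positivity
      nlinarith [mul_le_mul_of_nonneg_left h1 h2]
    · have h1 : σ ^ (δ - 1) ≤ 2 := by
        calc σ ^ (δ - 1) ≤ (1 / 2) ^ (δ - 1) :=
              Real.rpow_le_rpow_of_nonpos (by norm_num) hs.le (by linarith)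
          _ ≤ (1 / 2) ^ (-1 : ℝ) :=
              Real.rpow_le_rpow_of_exponent_ge (by norm_num) (by norm_num) (by linarith)
          _ = 2 := by rw [Real.rpow_neg_one]; norm_num
      have h2 : w ^ δ * Real.exp (-(w * σ)) ≤ 3 := by
        have e1 : w ^ δ ≤ 1 + w := by
          rcases le_total w 1 with hw1 | hw1
          · linarith [Real.rpow_le_one hw.le hw1 hδ]
          · have := Real.rpow_le_rpow_of_exponent_le hw1 (by linarith : δ ≤ 1)
            rw [Real.rpow_one] at this
            linarith
        have e2 : Real.exp (-(w * σ)) ≤ Real.exp (-(w / 2)) :=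
          Real.exp_le_exp.2 (by nlinarith)
        have e3 : 1 + w ≤ 3 * Real.exp (w / 2) := by linarith [Real.add_one_le_exp (w / 2)]
        calc w ^ δ * Real.exp (-(w * σ)) ≤ (3 * Real.exp (w / 2)) * Real.exp (-(w / 2)) := by
              gcongr
              exact e1.trans e3
          _ = 3 := by rw [mul_assoc, ← Real.exp_add]; simp
      have h3 : 0 ≤ (1 - σ) ^ (δ - 1 / 2) := by positivity
      have h4 : 0 ≤ w ^ δ * Real.exp (-(w * σ)) * σ ^ (δ - 1) := by positivity
      have h5 : w ^ δ * Real.exp (-(w * σ)) * σ ^ (δ - 1) ≤ 3 * 2 := by gcongr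
      nlinarith [mul_le_mul_of_nonneg_right h5 h3]
  calc _ ≤ ENNReal.ofReal (Real.Gamma δ)⁻¹ * ∫⁻ σ in Set.Ioo (0 : ℝ) 1,
        (ENNReal.ofReal 2 * ENNReal.ofReal (w ^ δ * Real.exp (-(w * σ)) * σ ^ (δ - 1)) +
        ENNReal.ofReal 8 * ENNReal.ofReal (σ ^ ((1 : ℝ) - 1) * (1 - σ) ^ (δ + 1 / 2 - 1))) := by
        refine mul_le_mul' le_rfl (setLIntegral_mono' measurableSet_Ioo fun σ hσ => ?_)
        have hσ0 : 0 < σ := hσ.1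
        have hσ1 : 0 < 1 - σ := by linarith [hσ.2]
        rw [← ENNReal.ofReal_mul (by norm_num), ← ENNReal.ofReal_mul (by norm_num),
          ← ENNReal.ofReal_add (by positivity) (by positivity)]
        exact ENNReal.ofReal_le_ofReal (hpt σ hσ)
    _ = ENNReal.ofReal (Real.Gamma δ)⁻¹ * (ENNReal.ofReal 2 * (∫⁻ σ in Set.Ioo (0 : ℝ) 1,
        ENNReal.ofReal (w ^ δ * Real.exp (-(w * σ)) * σ ^ (δ - 1))) +
        ENNReal.ofReal 8 * ENNReal.ofReal B) := by
        rw [lintegral_add_left (by fun_prop), lintegral_const_mul _ (by fun_prop),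
          lintegral_const_mul _ (by fun_prop), hBint]
    _ ≤ ENNReal.ofReal (Real.Gamma δ)⁻¹ * (ENNReal.ofReal 2 * ENNReal.ofReal (Real.Gamma δ) +
        ENNReal.ofReal 8 * ENNReal.ofReal B) := by
        rw [← lintegral_rpow_mul_exp_neg_mul hδ0 hw]
        gcongr
        exact Set.Ioo_subset_Ioi_self
    _ ≤ _ := by
        rw [← ENNReal.ofReal_mul (by norm_num), ← ENNReal.ofReal_mul (by norm_num),
          ← ENNReal.ofReal_add (by positivity) (by positivity),
          ← ENNReal.ofReal_mul (by positivity)]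
        exact ENNReal.ofReal_le_ofReal (by linarith)

/-- The Gamma distribution has first moment `δ/w` and second moment `δ(δ+1)/w²`. A quadratic
minorant that is nonpositive beyond `1` may be integrated over the whole half line, since the
extension only lowers the integral. -/
lemma laguerreMass_ge {δ w A B : ℝ} (hδ : 0 < δ) (hw : 0 < w)
    (h1 : ∀ σ ∈ Set.Ioo (0 : ℝ) 1, 1 + A * σ - B * σ ^ 2 ≤ (1 - σ) ^ (δ - 1 / 2))
    (h2 : ∀ σ, 1 ≤ σ → 1 + A * σ - B * σ ^ 2 ≤ 0) :
    ENNReal.ofReal (1 + A * δ / w - B * (δ * (δ + 1)) / w ^ 2) ≤ laguerreMass δ w := by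
  have hG : 0 < Real.Gamma δ := Real.Gamma_pos_of_pos hδ
  let f : ℝ → ℝ := fun σ => w ^ δ * Real.exp (-(w * σ)) * σ ^ (δ - 1) * (1 + A * σ - B * σ ^ 2)
  have hfe : ∀ σ ∈ Set.Ioi (0 : ℝ), w ^ δ * Real.exp (-(w * σ)) * σ ^ (δ - 1) +
      A / w * (w ^ (δ + 1) * Real.exp (-(w * σ)) * σ ^ (δ + 1 - 1)) -
      B / w ^ 2 * (w ^ (δ + 1 + 1) * Real.exp (-(w * σ)) * σ ^ (δ + 1 + 1 - 1)) = f σ := by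
    intro σ hσ
    have hσ : 0 < σ := hσ
    simp only [f]
    rw [Real.rpow_add_one hw.ne' (δ + 1), Real.rpow_add_one hw.ne' δ,
      show δ + 1 + 1 - 1 = δ - 1 + 1 + 1 by ring, show δ + 1 - 1 = δ - 1 + 1 by ring,
      Real.rpow_add_one hσ.ne' (δ - 1 + 1), Real.rpow_add_one hσ.ne' (δ - 1)]
    field_simp
  have i0 := integrableOn_rpow_mul_exp_neg_mul hδ hw
  have i1 := (integrableOn_rpow_mul_exp_neg_mul (by linarith : 0 < δ + 1) hw).const_mul (A / w)
  have i2 := (integrableOn_rpow_mul_exp_neg_mul (by linarith : 0 < δ + 1 + 1) hw).const_mul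
    (B / w ^ 2)
  have i01 : IntegrableOn (fun σ => w ^ δ * Real.exp (-(w * σ)) * σ ^ (δ - 1) +
      A / w * (w ^ (δ + 1) * Real.exp (-(w * σ)) * σ ^ (δ + 1 - 1))) (Set.Ioi 0) := i0.add i1
  have hfi : IntegrableOn f (Set.Ioi 0) :=
    IntegrableOn.congr_fun (i01.sub i2) (fun σ hσ => hfe σ hσ) measurableSet_Ioi
  have hint : ∫ σ in Set.Ioi (0 : ℝ), f σ =
      Real.Gamma δ * (1 + A * δ / w - B * (δ * (δ + 1)) / w ^ 2) := by
    rw [← setIntegral_congr_fun measurableSet_Ioi hfe, integral_sub i01 i2,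
      integral_add i0 i1, integral_const_mul, integral_const_mul,
      integral_rpow_mul_exp_neg_mul hδ hw, integral_rpow_mul_exp_neg_mul (by linarith) hw,
      integral_rpow_mul_exp_neg_mul (by linarith) hw, Real.Gamma_add_one (s := δ + 1) (by linarith),
      Real.Gamma_add_one hδ.ne']
    field_simp
  have hle : ENNReal.ofReal (∫ σ in Set.Ioi (0 : ℝ), f σ) ≤ ∫⁻ σ in Set.Ioo (0 : ℝ) 1,
      ENNReal.ofReal (w ^ δ * Real.exp (-(w * σ)) * σ ^ (δ - 1) * (1 - σ) ^ (δ - 1 / 2)) := by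
    refine (ofReal_integral_le_lintegral_ofReal hfi).trans ?_
    have hun : Set.Ioi (0 : ℝ) = Set.Ioo 0 1 ∪ Set.Ici 1 :=
      (Set.Ioo_union_Ici_eq_Ioi one_pos).symm
    rw [hun, lintegral_union measurableSet_Ici
      (Set.disjoint_left.2 fun z hz hz' => absurd hz.2 (not_lt.2 hz'))]
    have hz : ∫⁻ σ in Set.Ici (1 : ℝ), ENNReal.ofReal (f σ) = 0 := by
      refine setLIntegral_eq_zero measurableSet_Ici fun σ hσ => ?_
      have hσ0 : 0 < σ := lt_of_lt_of_le one_pos hσ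
      exact ENNReal.ofReal_of_nonpos (mul_nonpos_of_nonneg_of_nonpos (by positivity) (h2 σ hσ))
    rw [hz, add_zero]
    refine setLIntegral_mono' measurableSet_Ioo fun σ hσ => ENNReal.ofReal_le_ofReal ?_
    have hσ0 : 0 < σ := hσ.1
    exact mul_le_mul_of_nonneg_left (h1 σ hσ) (by positivity)
  rw [laguerreMass_eq hδ hw]
  calc _ = ENNReal.ofReal (Real.Gamma δ)⁻¹ * ENNReal.ofReal (∫ σ in Set.Ioi (0 : ℝ), f σ) := by
        rw [hint, ← ENNReal.ofReal_mul (by positivity), inv_mul_cancel_left₀ hG.ne']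
    _ ≤ _ := by gcongr

/-- In the non-contractive range the mass exceeds one on some interval of unit length. -/
lemma exists_one_lt_laguerreMass {δ : ℝ} (hδ : 0 < δ) (hδ' : δ < 1 / 2) :
    ∃ W : ℝ, 0 < W ∧ ∃ η : ℝ, 0 < η ∧ ∀ w ∈ Set.Icc W (W + 1),
      ENNReal.ofReal (1 + η) ≤ laguerreMass δ w := by
  set q := 1 / 2 - δ with hq
  have hq0 : 0 < q := by linarith
  -- From this value on, the second-order loss is at most half of the first-order gain `qδ/w`; `η`
  -- is the other half at the right end of the window.
  set W := 2 * (1 + q) * (δ + 1) / q with hW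
  have hW0 : 0 < W := by positivity
  refine ⟨W, hW0, q * δ / (2 * (W + 1)), by positivity, fun w hw => ?_⟩
  have hw0 : 0 < w := hW0.trans_le hw.1
  refine (ENNReal.ofReal_le_ofReal ?_).trans
    -- The slope is that of `(1-σ)^{-q}` at `0`, and `B = 1 + q` makes the minorant vanish at `1`:
    -- it equals `-(σ-1)(1+(1+q)σ)`.
    (laguerreMass_ge (A := q) (B := 1 + q) hδ hw0 (fun σ hσ => ?_) fun σ hσ => ?_)
  · have h1 : (1 + q) * (δ * (δ + 1)) / w ^ 2 ≤ q * δ / (2 * w) := by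
      rw [div_le_div_iff₀ (by positivity) (by positivity)]
      have : 2 * (1 + q) * (δ + 1) ≤ q * w := by
        have := hw.1
        rw [hW, div_le_iff₀ hq0] at this
        linarith
      nlinarith [mul_le_mul_of_nonneg_left this (by positivity : 0 ≤ δ * w)]
    have h2 : q * δ / (2 * (W + 1)) ≤ q * δ / (2 * w) := by
      have := hw.2
      gcongr
    have h3 : q * δ / w = q * δ / (2 * w) + q * δ / (2 * w) := by field_simp; ring
    linarith
  · have hσ0 : 0 < σ := hσ.1
    have hσ1 : 0 < 1 - σ := by linarith [hσ.2]
    have e1 : Real.exp (q * σ) ≤ (1 - σ) ^ (δ - 1 / 2) := by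
      rw [Real.rpow_def_of_pos hσ1, Real.exp_le_exp]
      have := Real.log_le_sub_one_of_pos hσ1
      rw [show δ - 1 / 2 = -q by rw [hq]; ring]
      nlinarith
    nlinarith [Real.add_one_le_exp (q * σ), mul_nonneg (by linarith : 0 ≤ 1 + q) (sq_nonneg σ)]
  · nlinarith [mul_nonneg (by linarith : 0 ≤ σ - 1) (by positivity : 0 ≤ 1 + (1 + q) * σ)]

/-- The mass is close to one on some interval of unit length. -/
lemma exists_laguerreMass_ge {δ ε : ℝ} (hδ : 0 ≤ δ) (hε : 0 < ε) :
    ∃ W : ℝ, 0 < W ∧ ∀ w ∈ Set.Icc W (W + 1), ENNReal.ofReal (1 - ε) ≤ laguerreMass δ w := by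
  by_cases h0 : δ = 0
  · subst h0
    refine ⟨1, one_pos, fun w hw => ?_⟩
    rw [laguerreMass_zero (one_pos.trans_le hw.1)]
    simpa using hε.le
  have hδ0 : 0 < δ := lt_of_le_of_ne hδ (Ne.symm h0)
  rcases lt_or_ge δ (1 / 2) with h1 | h1
  · obtain ⟨W, hW, η, hη, h⟩ := exists_one_lt_laguerreMass hδ0 h1
    exact ⟨W, hW, fun w hw => (ENNReal.ofReal_le_ofReal (by linarith)).trans (h w hw)⟩
  -- `N ≥ 1` permits Bernoulli's inequality `1 - Nσ ≤ (1-σ)^N`, and `N ≥ δ - 1/2` lets the exponent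
  -- be lowered. The linear minorant costs `Nδ/w ≤ ε`.
  · set N := δ + 1 with hN
    refine ⟨N * δ / ε, by positivity, fun w hw => ?_⟩
    have hw0 : 0 < w := lt_of_lt_of_le (by positivity) hw.1
    refine (ENNReal.ofReal_le_ofReal ?_).trans
      (laguerreMass_ge (A := -N) (B := 0) hδ0 hw0 (fun σ hσ => ?_) fun σ hσ => ?_)
    · have : N * δ / w ≤ ε := by
        have := hw.1
        rw [div_le_iff₀ hε] at this
        rw [div_le_iff₀ hw0]
        linarith
      have e : 1 + -N * δ / w - 0 * (δ * (δ + 1)) / w ^ 2 = 1 - N * δ / w := by ring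
      rw [e]
      linarith
    · have hσ0 : 0 < σ := hσ.1
      have hσ1 : 0 < 1 - σ := by linarith [hσ.2]
      have e1 := one_add_mul_self_le_rpow_one_add (s := -σ) (by linarith [hσ.2]) (p := N)
        (by linarith)
      have e2 : (1 - σ) ^ N ≤ (1 - σ) ^ (δ - 1 / 2) :=
        Real.rpow_le_rpow_of_exponent_ge hσ1 (by linarith) (by linarith)
      rw [← sub_eq_add_neg 1 σ] at e1
      linarith
    · nlinarith

/-! ### Integral operators with positive symmetric kernels -/

section PositiveKernel

variable {X 𝕜 : Type*} [MeasurableSpace X] [RCLike 𝕜] {μ : Measure X}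
  {K : X → X → ℝ} {M : ℝ}

/-- The integral operator with kernel `K`. -/
def kernelOp (μ : Measure X) (K : X → X → ℝ) (f : X → 𝕜) (x : X) : 𝕜 := ∫ y, K x y • f y ∂μ

/-- This is monotonicity of `L^p` norms for the finite measure `K(x,·)μ` of mass at most `M`. At `p
= ∞` the convention `∞.toReal = 0` gives the correct exponent `1`. -/
lemma lintegral_kernel_mul_le (hK : ∀ x, Measurable (K x)) {g : X → ℝ≥0∞}
    (hg : AEMeasurable g μ) {p : ℝ≥0∞} (hp : 1 ≤ p) {x : X}
    (hM : ∫⁻ y, ENNReal.ofReal (K x y) ∂μ ≤ ENNReal.ofReal M) :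
    ∫⁻ y, ENNReal.ofReal (K x y) * g y ∂μ ≤
      eLpNorm g p (μ.withDensity fun y => ENNReal.ofReal (K x y)) *
        ENNReal.ofReal M ^ (1 - 1 / p.toReal) := by
  have hk : AEMeasurable (fun y => ENNReal.ofReal (K x y)) μ :=
    (hK x).ennreal_ofReal.aemeasurable
  have h1 := eLpNorm_le_eLpNorm_mul_rpow_measure_univ hp
    (hg.mono_ac (withDensity_absolutelyContinuous μ fun y => ENNReal.ofReal
      (K x y))).aestronglyMeasurable
  rw [eLpNorm_one_eq_lintegral_enorm] at h1
  simp only [enorm_eq_self] at h1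
  rw [lintegral_withDensity_eq_lintegral_mul₀ hk hg, withDensity_apply _ MeasurableSet.univ,
    Measure.restrict_univ, ENNReal.toReal_one, div_one] at h1
  refine h1.trans (mul_le_mul' le_rfl (ENNReal.rpow_le_rpow hM ?_))
  rcases eq_or_ne p ∞ with rfl | hp'
  · simp
  · have : 1 ≤ p.toReal := by
      rw [← ENNReal.toReal_one]
      exact ENNReal.toReal_mono hp' hp
    rw [sub_nonneg, div_le_one (by linarith)]
    exact this

/-- Schur's test for positive symmetric kernels. -/
lemma eLpNorm_lintegral_kernel_mul_le [SFinite μ] (hK : Measurable (Function.uncurry K))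
    (hs : ∀ x y, K x y = K y x)
    (hM : ∀ᵐ x ∂μ, ∫⁻ y, ENNReal.ofReal (K x y) ∂μ ≤ ENNReal.ofReal M)
    {g : X → ℝ≥0∞} (hg : AEMeasurable g μ) {p : ℝ≥0∞} (hp : 1 ≤ p) :
    eLpNorm (fun x => ∫⁻ y, ENNReal.ofReal (K x y) * g y ∂μ) p μ ≤
      ENNReal.ofReal M * eLpNorm g p μ := by
  have hKx : ∀ x, Measurable (K x) := fun x => hK.comp measurable_prodMk_left
  have hk : ∀ x, AEMeasurable (fun y => ENNReal.ofReal (K x y)) μ := fun x =>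
    (hKx x).ennreal_ofReal.aemeasurable
  rcases eq_or_ne p ∞ with rfl | hp'
  · rw [eLpNorm_exponent_top]
    refine eLpNormEssSup_le_of_ae_enorm_bound ?_
    filter_upwards [hM] with x hx
    refine (lintegral_kernel_mul_le hKx hg le_top hx).trans ?_
    rw [ENNReal.toReal_top, div_zero, sub_zero, ENNReal.rpow_one, mul_comm]
    refine mul_le_mul' le_rfl ?_
    rw [eLpNorm_exponent_top]
    exact eLpNormEssSup_mono_measure _ (withDensity_absolutelyContinuous _ _)
  have hp0 : p ≠ 0 := (one_pos.trans_le hp).ne'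
  have hr : 1 ≤ p.toReal := by
    rw [← ENNReal.toReal_one]
    exact ENNReal.toReal_mono hp' hp
  have hr0 : 0 < p.toReal := by linarith
  set r := p.toReal with hrdef
  have hgr : AEMeasurable (fun y => g y ^ r) μ := hg.pow_const r
  have hpt : ∀ᵐ x ∂μ, (∫⁻ y, ENNReal.ofReal (K x y) * g y ∂μ) ^ r ≤
      ENNReal.ofReal M ^ (r - 1) * ∫⁻ y, ENNReal.ofReal (K x y) * g y ^ r ∂μ := by
    filter_upwards [hM] with x hx
    refine (ENNReal.rpow_le_rpow (lintegral_kernel_mul_le hKx hg hp hx) hr0.le).trans ?_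
    rw [ENNReal.mul_rpow_of_nonneg _ _ hr0.le, ← ENNReal.rpow_mul, mul_comm,
      eLpNorm_eq_lintegral_rpow_enorm_toReal hp0 hp', ← ENNReal.rpow_mul, ← hrdef,
      one_div_mul_cancel hr0.ne', ENNReal.rpow_one, sub_mul, one_mul, one_div_mul_cancel hr0.ne']
    simp only [enorm_eq_self]
    rw [lintegral_withDensity_eq_lintegral_mul₀ (hk x) hgr]
    rfl
  have hmeas : AEMeasurable (Function.uncurry fun x y => ENNReal.ofReal (K x y) * g y ^ r)
      (μ.prod μ) :=
    hK.ennreal_ofReal.aemeasurable.mul (hgr.comp_snd)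
  rw [eLpNorm_eq_lintegral_rpow_enorm_toReal hp0 hp',
    eLpNorm_eq_lintegral_rpow_enorm_toReal hp0 hp',
    ← hrdef]
  simp only [enorm_eq_self]
  -- The pointwise bound uses `r - 1` powers of `M`; after Tonelli, symmetry turns the row bound
  -- into a column bound and supplies the last power.
  have hmain : ∫⁻ x, (∫⁻ y, ENNReal.ofReal (K x y) * g y ∂μ) ^ r ∂μ ≤
      ENNReal.ofReal M ^ r * ∫⁻ y, g y ^ r ∂μ := by
    calc _ ≤ ∫⁻ x, ENNReal.ofReal M ^ (r - 1) * ∫⁻ y, ENNReal.ofReal (K x y) * g y ^ r ∂μ ∂μ :=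
          lintegral_mono_ae hpt
      _ = ENNReal.ofReal M ^ (r - 1) * ∫⁻ y, ∫⁻ x, ENNReal.ofReal (K x y) * g y ^ r ∂μ ∂μ := by
          rw [lintegral_const_mul' _ _ (by finiteness), lintegral_lintegral_swap hmeas]
      _ ≤ ENNReal.ofReal M ^ (r - 1) * ∫⁻ y, ENNReal.ofReal M * g y ^ r ∂μ := by
          refine mul_le_mul' le_rfl (lintegral_mono_ae ?_)
          filter_upwards [hM] with y hy
          simp only [fun x => hs x y]
          rw [lintegral_mul_const'' _ (hk y)]
          exact mul_le_mul' hy le_rfl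
      _ = _ := by
          rw [lintegral_const_mul' _ _ ENNReal.ofReal_ne_top, ← mul_assoc]
          congr 1
          nth_rewrite 2 [← ENNReal.rpow_one (ENNReal.ofReal M)]
          rw [← ENNReal.rpow_add_of_nonneg _ _ (by linarith) zero_le_one, sub_add_cancel]
  calc _ ≤ (ENNReal.ofReal M ^ r * ∫⁻ y, g y ^ r ∂μ) ^ (1 / r) :=
        ENNReal.rpow_le_rpow hmain (by positivity)
    _ = _ := by
        rw [ENNReal.mul_rpow_of_nonneg _ _ (by positivity), ← ENNReal.rpow_mul,
          mul_one_div_cancel hr0.ne', ENNReal.rpow_one]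

lemma enorm_kernelOp_le (h0 : ∀ x y, 0 ≤ K x y) (f : X → 𝕜) (x : X) :
    ‖kernelOp μ K f x‖ₑ ≤ ∫⁻ y, ENNReal.ofReal (K x y) * ‖f y‖ₑ ∂μ := by
  refine (enorm_integral_le_lintegral_enorm _).trans (lintegral_mono fun y => ?_)
  rw [enorm_smul, Real.enorm_of_nonneg (h0 x y)]

lemma aestronglyMeasurable_kernelOp [SFinite μ] (hK : Measurable (Function.uncurry K)) {f : X → 𝕜}
    (hf : AEStronglyMeasurable f μ) : AEStronglyMeasurable (kernelOp μ K f) μ :=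
  AEStronglyMeasurable.integral_prod_right' (f := fun z : X × X => K z.1 z.2 • f z.2)
    (hK.aestronglyMeasurable.smul hf.comp_snd)

lemma lpOpNormLE_kernelOp [SFinite μ] (hK : Measurable (Function.uncurry K)) (h0 : ∀ x y, 0 ≤ K x y)
    (hs : ∀ x y, K x y = K y x)
    (hM : ∀ᵐ x ∂μ, ∫⁻ y, ENNReal.ofReal (K x y) ∂μ ≤ ENNReal.ofReal M)
    {p : ℝ≥0∞} (hp : 1 ≤ p) : LpOpNormLE μ p (kernelOp (𝕜 := 𝕜) μ K) M := by
  intro f hf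
  have hle : eLpNorm (kernelOp μ K f) p μ ≤ ENNReal.ofReal M * eLpNorm f p μ := by
    have h1 := eLpNorm_lintegral_kernel_mul_le hK hs hM (g := fun y => ‖f y‖ₑ)
      hf.aestronglyMeasurable.enorm hp
    rw [eLpNorm_enorm] at h1
    exact (eLpNorm_mono_enorm fun x => by
      rw [enorm_eq_self]; exact enorm_kernelOp_le h0 f x).trans h1
  exact ⟨⟨aestronglyMeasurable_kernelOp hK hf.aestronglyMeasurable,
    hle.trans_lt (ENNReal.mul_lt_top ENNReal.ofReal_lt_top hf.eLpNorm_lt_top)⟩, hle⟩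

lemma integral_conj_kernelOp_mul [SFinite μ] (hK : Measurable (Function.uncurry K))
    (h0 : ∀ x y, 0 ≤ K x y)
    (hs : ∀ x y, K x y = K y x)
    (hM : ∀ᵐ x ∂μ, ∫⁻ y, ENNReal.ofReal (K x y) ∂μ ≤ ENNReal.ofReal M)
    {f g : X → 𝕜} (hf : MemLp f 2 μ) (hg : MemLp g 2 μ) :
    ∫ x, conj (kernelOp μ K f x) * g x ∂μ = ∫ x, conj (f x) * kernelOp μ K g x ∂μ := by
  have hfm := hf.aestronglyMeasurable
  have hgm := hg.aestronglyMeasurable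
  let F : X → X → 𝕜 := fun x y => K x y • (conj (f y) * g x)
  have hFm : AEStronglyMeasurable (Function.uncurry F) (μ.prod μ) :=
    hK.aestronglyMeasurable.smul
      ((RCLike.continuous_conj.comp_aestronglyMeasurable hfm.comp_snd).mul hgm.comp_fst)
  -- Fubini is licensed by Cauchy-Schwarz between `g` and the operator applied to `|f|`, which is in
  -- `L²` by Schur's test.
  have hFi : Integrable (Function.uncurry F) (μ.prod μ) := by
    refine ⟨hFm, ?_⟩
    have hSm : AEMeasurable (fun x => ∫⁻ y, ENNReal.ofReal (K x y) * ‖f y‖ₑ ∂μ) μ :=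
      AEMeasurable.lintegral_prod_right' (f := fun z : X × X => ENNReal.ofReal (K z.1 z.2) *
        ‖f z.2‖ₑ) (hK.ennreal_ofReal.aemeasurable.mul hfm.comp_snd.enorm)
    have hS := (eLpNorm_lintegral_kernel_mul_le hK hs hM (g := fun y => ‖f y‖ₑ) hfm.enorm
      one_le_two).trans_lt (ENNReal.mul_lt_top ENNReal.ofReal_lt_top
        (by rw [eLpNorm_enorm]; exact hf.eLpNorm_lt_top))
    have hG := hg.eLpNorm_lt_top
    rw [eLpNorm_eq_lintegral_rpow_enorm_toReal two_ne_zero ENNReal.ofNat_ne_top,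
      ENNReal.toReal_ofNat] at hS hG
    simp only [enorm_eq_self] at hS
    rw [HasFiniteIntegral, lintegral_prod _ hFm.enorm]
    refine lt_of_le_of_lt ?_ ((ENNReal.lintegral_mul_le_Lp_mul_Lq μ Real.HolderConjugate.two_two
      hSm hgm.enorm).trans_lt (ENNReal.mul_lt_top hS hG))
    refine lintegral_mono fun x => ?_
    simp only [Function.uncurry, F, Pi.mul_apply]
    rw [← lintegral_mul_const' _ _ enorm_ne_top]
    refine lintegral_mono fun y => ?_
    rw [enorm_smul, Real.enorm_of_nonneg (h0 x y), enorm_mul, RCLike.enorm_conj, mul_assoc]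
  calc ∫ x, conj (kernelOp μ K f x) * g x ∂μ = ∫ x, ∫ y, F x y ∂μ ∂μ := by
        refine integral_congr_ae (Eventually.of_forall fun x => ?_)
        simp only [kernelOp, F]
        rw [← integral_conj, ← integral_mul_const]
        refine integral_congr_ae (Eventually.of_forall fun y => ?_)
        simp only [RCLike.real_smul_eq_coe_mul, map_mul, RCLike.conj_ofReal]
        ring
    _ = ∫ y, ∫ x, F x y ∂μ ∂μ := integral_integral_swap hFi
    _ = _ := by
        refine integral_congr_ae (Eventually.of_forall fun y => ?_)
        simp only [kernelOp, F]
        rw [← integral_const_mul]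
        refine integral_congr_ae (Eventually.of_forall fun x => ?_)
        simp only [RCLike.real_smul_eq_coe_mul, hs x y]
        ring

lemma kernelOp_nonneg (h0 : ∀ x y, 0 ≤ K x y) {f : X → 𝕜} (hf : ∀ᵐ x ∂μ, 0 ≤ f x) (x : X) :
    0 ≤ kernelOp μ K f x := by
  have e : ∫ y, K x y • f y ∂μ = ((∫ y, K x y * RCLike.re (f y) ∂μ : ℝ) : 𝕜) := by
    rw [← integral_ofReal]
    refine integral_congr_ae ?_
    filter_upwards [hf] with y hy
    rw [RCLike.nonneg_iff] at hy
    rw [RCLike.ofReal_mul, RCLike.real_smul_eq_coe_mul]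
    congr 1
    rw [← RCLike.re_add_im (f y), hy.2]
    simp
  rw [kernelOp, e]
  refine RCLike.ofReal_nonneg.2 (integral_nonneg_of_ae ?_)
  filter_upwards [hf] with y hy
  exact mul_nonneg (h0 x y) (RCLike.nonneg_iff.1 hy).1

/-- Composition of integral operators with positive kernels. -/
lemma kernelOp_kernelOp [SFinite μ] {K' K'' : X → X → ℝ} (hK : Measurable (Function.uncurry K))
    (hK' : Measurable (Function.uncurry K')) (h0 : ∀ x y, 0 ≤ K x y) (h0' : ∀ x y, 0 ≤ K' x y)
    {f : X → 𝕜} (hf : AEStronglyMeasurable f μ) (x : X)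
    (hcomp : ∀ᵐ y ∂μ, Integrable (fun z => K x z * K' z y) μ ∧ ∫ z, K x z * K' z y ∂μ = K'' x y)
    (hint : Integrable (fun y => K'' x y • f y) μ) :
    kernelOp μ K'' f x = kernelOp μ K (kernelOp μ K' f) x := by
  let F : X → X → 𝕜 := fun y z => (K x z * K' z y) • f y
  have hKx : Measurable (K x) := hK.comp measurable_prodMk_left
  have hFm : AEStronglyMeasurable (Function.uncurry F) (μ.prod μ) := by
    have h1 : Measurable fun q : X × X => K x q.2 * K' q.2 q.1 :=
      (hKx.comp measurable_snd).mul (hK'.comp (measurable_snd.prodMk measurable_fst))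
    exact h1.aestronglyMeasurable.smul hf.comp_fst
  -- Positivity makes the inner absolute integral equal to `K''(x,y) |f(y)|`, so the assumed
  -- integrability of `K'' f` already gives Fubini.
  have hFi : Integrable (Function.uncurry F) (μ.prod μ) := by
    refine ⟨hFm, ?_⟩
    rw [HasFiniteIntegral, lintegral_prod _ hFm.enorm]
    refine lt_of_le_of_lt ?_ hint.2
    refine lintegral_mono_ae ?_
    filter_upwards [hcomp] with y hy
    simp only [Function.uncurry, F, enorm_smul]
    rw [lintegral_mul_const' _ _ enorm_ne_top, ← hy.2]
    refine mul_le_mul' ?_ le_rfl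
    rw [Real.enorm_of_nonneg (integral_nonneg fun z => mul_nonneg (h0 _ _) (h0' _ _)),
      ofReal_integral_eq_lintegral_ofReal hy.1
        (Eventually.of_forall fun z => mul_nonneg (h0 _ _) (h0' _ _))]
    exact lintegral_mono fun z => by rw [Real.enorm_of_nonneg (mul_nonneg (h0 _ _) (h0' _ _))]
  calc kernelOp μ K'' f x = ∫ y, ∫ z, F y z ∂μ ∂μ := by
        refine integral_congr_ae ?_
        filter_upwards [hcomp] with y hy
        simp only [F]
        rw [integral_smul_const, hy.2]
    _ = ∫ z, ∫ y, F y z ∂μ ∂μ := integral_integral_swap hFi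
    _ = _ := by
        refine integral_congr_ae (Eventually.of_forall fun z => ?_)
        simp only [F, kernelOp, ← smul_smul]
        rw [integral_smul]

end PositiveKernel

/-- Cut at modulus one: where `|f| > 1` one has `|f| ≤ |f|^p`, and the rest is bounded. The cut uses
a strongly measurable representative to obtain a measurable set. -/
lemma memL1AddLinfty_of_memLp {X 𝕜 : Type*} [MeasurableSpace X] [RCLike 𝕜] {μ : Measure X}
    {f : X → 𝕜} {p : ℝ≥0∞} (hp : 1 ≤ p) (hf : MemLp f p μ) : MemL1AddLinfty μ f := by
  rcases eq_or_ne p ∞ with rfl | hp'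
  · exact ⟨0, f, MemLp.zero, hf, (zero_add f).symm⟩
  have hp0 : p ≠ 0 := (one_pos.trans_le hp).ne'
  have hr : 1 ≤ p.toReal := by
    rw [← ENNReal.toReal_one]
    exact ENNReal.toReal_mono hp' hp
  have hm := hf.aestronglyMeasurable
  set s := {x | 1 < ‖hm.mk f x‖} with hs
  have hsm : MeasurableSet s :=
    measurableSet_lt measurable_const hm.stronglyMeasurable_mk.norm.measurable
  refine ⟨s.indicator f, sᶜ.indicator f, ⟨hm.indicator hsm, ?_⟩, ?_,
    (Set.indicator_self_add_compl s f).symm⟩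
  · rw [eLpNorm_one_eq_lintegral_enorm]
    refine lt_of_le_of_lt (lintegral_mono_ae ?_)
      (lintegral_rpow_enorm_lt_top_of_eLpNorm_lt_top hp0 hp' hf.eLpNorm_lt_top)
    filter_upwards [hm.ae_eq_mk] with x hx
    by_cases hxs : x ∈ s
    · rw [Set.indicator_of_mem hxs]
      have h1 : 1 ≤ ‖f x‖ₑ := by
        have h2 : (1 : ℝ) < ‖hm.mk f x‖ := hxs
        rw [← hx] at h2
        rw [← ofReal_norm, ← ENNReal.ofReal_one]
        exact ENNReal.ofReal_le_ofReal h2.le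
      conv_lhs => rw [← ENNReal.rpow_one ‖f x‖ₑ]
      exact ENNReal.rpow_le_rpow_of_exponent_le h1 hr
    · rw [Set.indicator_of_notMem hxs]
      simp
  · refine memLp_top_of_bound (hm.indicator hsm.compl) 1 ?_
    filter_upwards [hm.ae_eq_mk] with x hx
    by_cases hxs : x ∈ s
    · rw [Set.indicator_of_notMem (by simpa using hxs)]
      simp
    · rw [Set.indicator_of_mem hxs, hx]
      exact not_lt.1 hxs

/-! ### The Laguerre functions and the heat kernel on the orthant -/

lemma orthantMeasure_eq_pi (d : ℕ) :
    orthantMeasure d = Measure.pi fun _ : Fin d => volume.restrict (Set.Ioi (0 : ℝ)) := by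
  rw [← Measure.restrict_pi_pi, orthantMeasure, volume_pi]
  congr 1
  ext x
  simp [orthant]

instance (d : ℕ) : SigmaFinite (orthantMeasure d) := by
  unfold orthantMeasure
  infer_instance

lemma measurableSet_orthant (d : ℕ) : MeasurableSet (orthant d) := by
  have : orthant d = Set.univ.pi fun _ : Fin d => Set.Ioi (0 : ℝ) := by
    ext x
    simp [orthant]
  rw [this]
  exact MeasurableSet.univ_pi fun _ => measurableSet_Ioi

lemma ae_mem_orthant (d : ℕ) : ∀ᵐ x ∂orthantMeasure d, x ∈ orthant d :=
  ae_restrict_mem (measurableSet_orthant d)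

/-- Absolute summability is carried along because the induction step multiplies two series. -/
lemma summable_and_hasSum_pi_prod {d : ℕ} {f : Fin d → ℕ → ℝ} {g : Fin d → ℝ}
    (h : ∀ i, HasSum (f i) (g i)) :
    (Summable fun k : Fin d → ℕ => ‖∏ i, f i (k i)‖) ∧
      HasSum (fun k : Fin d → ℕ => ∏ i, f i (k i)) (∏ i, g i) := by
  induction d with
  | zero =>
    simp only [Finset.univ_eq_empty, Finset.prod_empty]
    exact ⟨Summable.of_finite, hasSum_unique fun _ : Fin 0 → ℕ => (1 : ℝ)⟩
  | succ d ih =>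
    obtain ⟨h1, h2⟩ := ih fun i : Fin d => h i.succ
    have h0 := (h 0).summable.norm
    have hs := summable_mul_of_summable_norm h0 h1
    have hsum : HasSum (fun k : Fin (d + 1) → ℕ => ∏ i, f i (k i)) (∏ i, g i) := by
      rw [← (Fin.consEquiv fun _ => ℕ).hasSum_iff, Fin.prod_univ_succ]
      refine ((h 0).mul h2 hs).congr_fun fun p => ?_
      simp [Fin.consEquiv, Fin.prod_univ_succ]
    exact ⟨hsum.summable.norm, hsum⟩

lemma exp_neg_mul_laguerreEigenvalue {d : ℕ} (α : Fin d → ℝ) (t : ℝ) (k : Fin d → ℕ) :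
    Real.exp (-t * laguerreEigenvalue α k) =
      ∏ i, Real.exp (-t * (4 * k i + 2 * α i + 2)) := by
  rw [← Real.exp_sum, laguerreEigenvalue, ← Finset.mul_sum, Finset.sum_add_distrib,
    Finset.sum_add_distrib, ← Finset.mul_sum, ← Finset.mul_sum]
  simp [mul_comm]

lemma laguerreKernelTerm_eq {d : ℕ} (α : Fin d → ℝ) (t : ℝ) (x y : Fin d → ℝ) (k : Fin d → ℕ) :
    laguerreKernelTerm α t x y k = ∏ i, (Real.exp (-t * (4 * k i + 2 * α i + 2)) *
      laguerreHermite1 (k i) (α i) (x i) * laguerreHermite1 (k i) (α i) (y i)) := by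
  rw [laguerreKernelTerm, exp_neg_mul_laguerreEigenvalue, laguerreHermite, laguerreHermite,
    Finset.prod_mul_distrib, Finset.prod_mul_distrib]

/-- The closed form of the heat kernel on the orthant. -/
def laguerreKernel {d : ℕ} (α : Fin d → ℝ) (t : ℝ) (x y : Fin d → ℝ) : ℝ :=
  ∏ i, laguerreKernel1 (α i) t (x i) (y i)

section

variable {d : ℕ} {α : Fin d → ℝ} {t : ℝ}

lemma hasSum_laguerreKernelTerm (hα : ∀ i, -1 / 2 ≤ α i) (ht : 0 < t) {x y : Fin d → ℝ}
    (hx : x ∈ orthant d) (hy : y ∈ orthant d) :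
    HasSum (laguerreKernelTerm α t x y) (laguerreKernel α t x y) := by
  have h := (summable_and_hasSum_pi_prod fun i =>
    hasSum_laguerreKernel1 (hα i) ht (hx i) (hy i)).2
  exact h.congr_fun fun k => laguerreKernelTerm_eq α t x y k

lemma laguerreHeatKernel_eq (hα : ∀ i, -1 / 2 ≤ α i) (ht : 0 < t) {x y : Fin d → ℝ}
    (hx : x ∈ orthant d) (hy : y ∈ orthant d) :
    laguerreHeatKernel α t x y = laguerreKernel α t x y :=
  (hasSum_laguerreKernelTerm hα ht hx hy).tsum_eq

lemma neg_one_lt_of_neg_half_le (hα : ∀ i, -1 / 2 ≤ α i) (i : Fin d) : -1 < α i := by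
  linarith [hα i]

lemma laguerreKernel_nonneg (hα : ∀ i, -1 / 2 ≤ α i) (ht : 0 < t) (x y : Fin d → ℝ) :
    0 ≤ laguerreKernel α t x y :=
  Finset.prod_nonneg fun i _ => laguerreKernel1_nonneg (neg_one_lt_of_neg_half_le hα i) ht _ _

lemma laguerreKernel_comm (α : Fin d → ℝ) (t : ℝ) (x y : Fin d → ℝ) :
    laguerreKernel α t x y = laguerreKernel α t y x :=
  Finset.prod_congr rfl fun i _ => laguerreKernel1_comm (α i) t (x i) (y i)

lemma measurable_laguerreKernel (α : Fin d → ℝ) (t : ℝ) :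
    Measurable (Function.uncurry (laguerreKernel α t)) := by
  have h0 : ∀ i, Measurable fun p : (Fin d → ℝ) × (Fin d → ℝ) => (p.1 i, p.2 i) := fun i =>
    ((measurable_pi_apply i).comp measurable_fst).prodMk
      ((measurable_pi_apply i).comp measurable_snd)
  have h1 : ∀ i, Measurable fun p : (Fin d → ℝ) × (Fin d → ℝ) =>
      Function.uncurry (laguerreKernel1 (α i) t) (p.1 i, p.2 i) := fun i =>
    (measurable_laguerreKernel1 (α i) t).comp (h0 i)
  exact Finset.measurable_fun_prod Finset.univ fun i _ => h1 i

lemma exists_laguerreKernel_le (hα : ∀ i, -1 / 2 ≤ α i) (ht : 0 < t) {x : Fin d → ℝ}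
    (hx : x ∈ orthant d) : ∃ C : ℝ, ∀ y ∈ orthant d, laguerreKernel α t x y ≤ C := by
  choose C hC using fun i => exists_laguerreKernel1_le (hα i) ht (hx i)
  exact ⟨∏ i, C i, fun y hy => Finset.prod_le_prod
    (fun i _ => laguerreKernel1_nonneg (neg_one_lt_of_neg_half_le hα i) ht _ _)
    fun i _ => hC i (y i) (hy i)⟩

lemma integrableOn_laguerreKernel1 {a x : ℝ} (ha : -1 / 2 ≤ a) (ht : 0 < t) (hx : 0 < x) :
    IntegrableOn (laguerreKernel1 a t x) (Set.Ioi 0) := by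
  have hS : 0 < Real.sinh (2 * t) := Real.sinh_pos_iff.2 (by linarith)
  have hC : 0 < Real.cosh (2 * t) := Real.cosh_pos _
  have hm : Measurable (laguerreKernel1 a t x) :=
    (measurable_laguerreKernel1 a t).of_uncurry_left
  refine ⟨hm.aestronglyMeasurable, ?_⟩
  have h0 : 0 ≤ᵐ[volume.restrict (Set.Ioi 0)] laguerreKernel1 a t x :=
    Eventually.of_forall fun y => laguerreKernel1_nonneg (by linarith) ht x y
  rw [hasFiniteIntegral_iff_ofReal h0, lintegral_laguerreKernel1 ha ht hx]
  have hδ : 0 ≤ a / 2 + 1 / 4 := by linarith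
  have hw : 0 < x ^ 2 / (2 * Real.sinh (2 * t) * Real.cosh (2 * t)) := by positivity
  obtain ⟨c, -, hc⟩ := exists_laguerreMass_le hδ
  exact ENNReal.mul_lt_top ENNReal.ofReal_lt_top ((hc _ hw).trans_lt ENNReal.ofReal_lt_top)

lemma integrable_laguerreKernel (hα : ∀ i, -1 / 2 ≤ α i) (ht : 0 < t) {x : Fin d → ℝ}
    (hx : x ∈ orthant d) : Integrable (laguerreKernel α t x) (orthantMeasure d) := by
  rw [orthantMeasure_eq_pi]
  exact Integrable.fintype_prod (f := fun i => laguerreKernel1 (α i) t (x i))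
    fun i => integrableOn_laguerreKernel1 (hα i) ht (hx i)

lemma lintegral_laguerreKernel (hα : ∀ i, -1 / 2 ≤ α i) (ht : 0 < t) {x : Fin d → ℝ}
    (hx : x ∈ orthant d) :
    ∫⁻ y, ENNReal.ofReal (laguerreKernel α t x y) ∂orthantMeasure d =
      ∏ i, ∫⁻ u in Set.Ioi (0 : ℝ), ENNReal.ofReal (laguerreKernel1 (α i) t (x i) u) := by
  have h0 : ∀ i u, 0 ≤ laguerreKernel1 (α i) t (x i) u := fun i u =>
    laguerreKernel1_nonneg (neg_one_lt_of_neg_half_le hα i) ht _ _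
  rw [← ofReal_integral_eq_lintegral_ofReal (integrable_laguerreKernel hα ht hx)
    (Eventually.of_forall fun y => laguerreKernel_nonneg hα ht x y), orthantMeasure_eq_pi]
  unfold laguerreKernel
  rw [integral_fintype_prod_eq_prod fun i => laguerreKernel1 (α i) t (x i),
    ENNReal.ofReal_prod_of_nonneg fun i _ => integral_nonneg fun u => h0 i u]
  exact Finset.prod_congr rfl fun i _ => ofReal_integral_eq_lintegral_ofReal
    (integrableOn_laguerreKernel1 (hα i) ht (hx i)) (Eventually.of_forall fun u => h0 i u)

/-- Boundedness of the kernel in `y` handles the `L¹` part, its integrability the `L^∞` part. -/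
lemma integrable_laguerreKernel_smul {𝕜 : Type*} [RCLike 𝕜] (hα : ∀ i, -1 / 2 ≤ α i)
    (ht : 0 < t) {f : (Fin d → ℝ) → 𝕜} (hf : MemL1AddLinfty (orthantMeasure d) f)
    {x : Fin d → ℝ} (hx : x ∈ orthant d) :
    Integrable (fun y => laguerreKernel α t x y • f y) (orthantMeasure d) := by
  obtain ⟨g, h, hg, hh, rfl⟩ := hf
  have hi := integrable_laguerreKernel hα ht hx
  obtain ⟨C, hC⟩ := exists_laguerreKernel_le hα ht hx
  have h1 : Integrable (laguerreKernel α t x • g) (orthantMeasure d) := by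
    refine Integrable.bdd_smul (memLp_one_iff_integrable.1 hg) C hi.aestronglyMeasurable ?_
    filter_upwards [ae_mem_orthant d] with y hy
    rw [Real.norm_of_nonneg (laguerreKernel_nonneg hα ht x y)]
    exact hC y hy
  have h2 : Integrable (laguerreKernel α t x • h) (orthantMeasure d) := by
    refine Integrable.smul_bdd hi (eLpNorm h ∞ (orthantMeasure d)).toReal
      hh.aestronglyMeasurable ?_
    filter_upwards [ae_le_eLpNormEssSup (f := h) (μ := orthantMeasure d)] with y hy
    rw [eLpNorm_exponent_top]
    rw [← toReal_enorm]
    exact ENNReal.toReal_mono (by simpa using hh.eLpNorm_lt_top.ne) hy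
  refine (h1.add h2).congr (Eventually.of_forall fun y => ?_)
  simp [smul_add]

lemma summable_exp_mul_abs_laguerreHermite (hα : ∀ i, -1 / 2 ≤ α i) (ht : 0 < t)
    (x : Fin d → ℝ) :
    Summable fun k : Fin d → ℕ =>
      |Real.exp (-t * laguerreEigenvalue α k) * laguerreHermite α k x| := by
  have h1 : ∀ i, Summable fun n : ℕ => Real.exp (-t * (4 * n + 2 * α i + 2)) *
      laguerreHermite1 n (α i) (x i) := by
    intro i
    refine Summable.of_norm ?_
    refine ((summable_abs_laguerreHermite1_mul_pow (hα i) (Real.exp_pos (-4 * t))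
      (Real.exp_lt_one_iff.2 (by linarith)) (x i)).mul_left (Real.exp (-t * (2 * α i + 2)))).congr
      fun n => ?_
    rw [norm_mul, Real.norm_eq_abs, Real.norm_eq_abs, Real.abs_exp, ← Real.exp_nat_mul,
      mul_comm |_| (Real.exp _), ← mul_assoc, ← Real.exp_add]
    congr 2
    ring
  refine (summable_and_hasSum_pi_prod fun i => (h1 i).hasSum).1.congr fun k => ?_
  rw [Finset.prod_mul_distrib, ← exp_neg_mul_laguerreEigenvalue]
  rfl

/-! ### Orthonormality, Fourier-Laguerre coefficients and spectral expansion. -/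

lemma integral_laguerreHermite_mul (hα : ∀ i, -1 / 2 ≤ α i) (k l : Fin d → ℕ) :
    ∫ x, laguerreHermite α k x * laguerreHermite α l x ∂orthantMeasure d =
      if k = l then 1 else 0 := by
  simp only [laguerreHermite, ← Finset.prod_mul_distrib]
  rw [orthantMeasure_eq_pi, integral_fintype_prod_eq_prod fun i u =>
    laguerreHermite1 (k i) (α i) u * laguerreHermite1 (l i) (α i) u]
  simp only [fun i => integral_laguerreHermite1_mul (neg_one_lt_of_neg_half_le hα i) (k i) (l i)]
  rw [Finset.prod_ite_zero]
  simp [funext_iff]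

lemma measurable_laguerreHermite (hα : ∀ i, -1 / 2 ≤ α i) (k : Fin d → ℕ) :
    Measurable (laguerreHermite α k) :=
  Finset.measurable_fun_prod _ fun i _ =>
    (measurable_laguerreHermite1 (neg_one_lt_of_neg_half_le hα i) (k i)).comp
      (measurable_pi_apply i)

lemma memLp_laguerreHermite (hα : ∀ i, -1 / 2 ≤ α i) (k : Fin d → ℕ) :
    MemLp (laguerreHermite α k) 2 (orthantMeasure d) := by
  rw [memLp_two_iff_integrable_sq (measurable_laguerreHermite hα k).aestronglyMeasurable]
  simp only [laguerreHermite, sq, ← Finset.prod_mul_distrib]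
  rw [orthantMeasure_eq_pi]
  exact Integrable.fintype_prod (f := fun i u => laguerreHermite1 (k i) (α i) u *
    laguerreHermite1 (k i) (α i) u) fun i =>
    integrableOn_laguerreHermite1_mul (neg_one_lt_of_neg_half_le hα i) _ _

variable {𝕜 : Type*} [RCLike 𝕜]

lemma memLp_ofReal_laguerreHermite (hα : ∀ i, -1 / 2 ≤ α i) (k : Fin d → ℕ) :
    MemLp (fun x => ((laguerreHermite α k x : ℝ) : 𝕜)) 2 (orthantMeasure d) :=
  (memLp_laguerreHermite hα k).ofReal

lemma integrable_laguerreHermite_smul (hα : ∀ i, -1 / 2 ≤ α i) (k : Fin d → ℕ)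
    {f : (Fin d → ℝ) → 𝕜} (hf : MemLp f 2 (orthantMeasure d)) :
    Integrable (fun x => laguerreHermite α k x • f x) (orthantMeasure d) := by
  simp only [RCLike.real_smul_eq_coe_mul]
  exact (memLp_ofReal_laguerreHermite hα k).integrable_mul hf

/-- A crude form of Cauchy-Schwarz, from `ab ≤ a² + b²`; only the uniformity in `k` is needed for
termwise integration. -/
lemma integral_norm_laguerreHermite_smul_le (hα : ∀ i, -1 / 2 ≤ α i) (k : Fin d → ℕ)
    {f : (Fin d → ℝ) → 𝕜} (hf : MemLp f 2 (orthantMeasure d)) :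
    ∫ x, ‖laguerreHermite α k x • f x‖ ∂orthantMeasure d ≤
      1 + ∫ x, ‖f x‖ ^ 2 ∂orthantMeasure d := by
  have h1 := integral_laguerreHermite_mul hα k k
  rw [if_pos rfl] at h1
  have i1 := (memLp_laguerreHermite hα k).integrable_sq
  have i2 := (memLp_two_iff_integrable_sq_norm hf.aestronglyMeasurable).1 hf
  simp only [← sq] at h1
  rw [← h1, ← integral_add i1 i2]
  refine integral_mono (integrable_laguerreHermite_smul hα k hf).norm (i1.add i2) fun x => ?_
  simp only
  rw [norm_smul, Real.norm_eq_abs, ← sq_abs (laguerreHermite α k x)]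
  nlinarith [sq_nonneg (|laguerreHermite α k x| - ‖f x‖), sq_nonneg ‖f x‖,
    sq_nonneg |laguerreHermite α k x|]

/-- Absolutely convergent series of Laguerre functions can be paired termwise with `L²`. -/
lemma hasSum_smul_laguerreCoeff (hα : ∀ i, -1 / 2 ≤ α i) {A : (Fin d → ℕ) → ℝ}
    {B : (Fin d → ℝ) → ℝ} (hA : Summable fun k => |A k|)
    (hB : ∀ y ∈ orthant d, HasSum (fun k => A k * laguerreHermite α k y) (B y))
    {f : (Fin d → ℝ) → 𝕜} (hf : MemLp f 2 (orthantMeasure d)) :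
    HasSum (fun k => A k • laguerreCoeff α f k) (∫ y, B y • f y ∂orthantMeasure d) := by
  have hi : ∀ k, Integrable (fun y => A k • (laguerreHermite α k y • f y)) (orthantMeasure d) :=
    fun k => (integrable_laguerreHermite_smul hα k hf).smul (A k)
  have hsum : Summable fun k =>
      ∫ y, ‖A k • (laguerreHermite α k y • f y)‖ ∂orthantMeasure d := by
    refine Summable.of_nonneg_of_le (fun k => integral_nonneg fun y => norm_nonneg _)
      (fun k => ?_) (hA.mul_right (1 + ∫ x, ‖f x‖ ^ 2 ∂orthantMeasure d))
    simp only [fun y => norm_smul (A k) (laguerreHermite α k y • f y)]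
    rw [integral_const_mul, Real.norm_eq_abs]
    exact mul_le_mul_of_nonneg_left (integral_norm_laguerreHermite_smul_le hα k hf)
      (abs_nonneg _)
  have h := hasSum_integral_of_summable_integral_norm hi hsum
  have e : ∫ y, ∑' k, A k • (laguerreHermite α k y • f y) ∂orthantMeasure d =
      ∫ y, B y • f y ∂orthantMeasure d := by
    refine integral_congr_ae ?_
    filter_upwards [ae_mem_orthant d] with y hy
    simp only [smul_smul]
    exact ((hB y hy).smul_const (f y)).tsum_eq
  rw [e] at h
  refine h.congr_fun fun k => ?_
  rw [integral_smul]
  rfl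

/-- Pointwise spectral expansion of the heat semigroup on `L²`. -/
lemma hasSum_kernelOp_laguerreKernel (hα : ∀ i, -1 / 2 ≤ α i) (ht : 0 < t)
    {f : (Fin d → ℝ) → 𝕜} (hf : MemLp f 2 (orthantMeasure d)) {x : Fin d → ℝ}
    (hx : x ∈ orthant d) :
    HasSum (fun k => (Real.exp (-t * laguerreEigenvalue α k) * laguerreHermite α k x) •
      laguerreCoeff α f k) (kernelOp (orthantMeasure d) (laguerreKernel α t) f x) :=
  hasSum_smul_laguerreCoeff hα (summable_exp_mul_abs_laguerreHermite hα ht x)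
    (fun _ hy => hasSum_laguerreKernelTerm hα ht hx hy) hf

lemma laguerreCoeff_laguerreHermite (hα : ∀ i, -1 / 2 ≤ α i) (k l : Fin d → ℕ) :
    laguerreCoeff α (fun x => ((laguerreHermite α l x : ℝ) : 𝕜)) k = if k = l then 1 else 0 := by
  simp only [laguerreCoeff, RCLike.real_smul_eq_coe_mul, ← RCLike.ofReal_mul]
  rw [integral_ofReal, integral_laguerreHermite_mul hα]
  split_ifs <;> simp

lemma kernelOp_laguerreHermite (hα : ∀ i, -1 / 2 ≤ α i) (ht : 0 < t) (l : Fin d → ℕ)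
    {x : Fin d → ℝ} (hx : x ∈ orthant d) :
    kernelOp (orthantMeasure d) (laguerreKernel α t)
      (fun y => ((laguerreHermite α l y : ℝ) : 𝕜)) x =
      ((Real.exp (-t * laguerreEigenvalue α l) * laguerreHermite α l x : ℝ) : 𝕜) := by
  have h := hasSum_kernelOp_laguerreKernel hα ht (memLp_ofReal_laguerreHermite (𝕜 := 𝕜) hα l) hx
  refine h.unique ?_
  have h2 := hasSum_ite_eq l
    ((Real.exp (-t * laguerreEigenvalue α l) * laguerreHermite α l x : ℝ) : 𝕜)
  refine h2.congr_fun fun k => ?_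
  rw [laguerreCoeff_laguerreHermite hα]
  split_ifs with hkl
  · rw [hkl, RCLike.real_smul_eq_coe_mul, mul_one]
  · simp

lemma memLp_laguerreKernel (hα : ∀ i, -1 / 2 ≤ α i) (ht : 0 < t) {x : Fin d → ℝ}
    (hx : x ∈ orthant d) : MemLp (laguerreKernel α t x) 2 (orthantMeasure d) := by
  have hi := integrable_laguerreKernel hα ht hx
  obtain ⟨C, hC⟩ := exists_laguerreKernel_le hα ht hx
  rw [memLp_two_iff_integrable_sq hi.aestronglyMeasurable]
  simp only [sq]
  refine Integrable.bdd_mul (c := C) hi hi.aestronglyMeasurable ?_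
  filter_upwards [ae_mem_orthant d] with y hy
  rw [Real.norm_of_nonneg (laguerreKernel_nonneg hα ht x y)]
  exact hC y hy

/-- The Chapman-Kolmogorov equation. -/
lemma integral_laguerreKernel_mul (hα : ∀ i, -1 / 2 ≤ α i) {s : ℝ} (hs : 0 < s) (ht : 0 < t)
    {x y : Fin d → ℝ} (hx : x ∈ orthant d) (hy : y ∈ orthant d) :
    Integrable (fun z => laguerreKernel α s x z * laguerreKernel α t z y) (orthantMeasure d) ∧
    ∫ z, laguerreKernel α s x z * laguerreKernel α t z y ∂orthantMeasure d =
      laguerreKernel α (s + t) x y := by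
  simp only [fun z => laguerreKernel_comm α t z y]
  have hf := memLp_laguerreKernel hα ht hy
  refine ⟨(memLp_laguerreKernel hα hs hx).integrable_mul hf, ?_⟩
  -- Expand the time-`s` operator on the function `G_t(y,·)`, whose Laguerre coefficients are known
  -- from the eigenfunction relation.
  have h1 := hasSum_kernelOp_laguerreKernel hα hs hf hx
  have h2 : ∀ k, laguerreCoeff α (laguerreKernel α t y) k =
      Real.exp (-t * laguerreEigenvalue α k) * laguerreHermite α k y := by
    intro k
    have := kernelOp_laguerreHermite (𝕜 := ℝ) hα ht k hy
    simp only [kernelOp, RCLike.ofReal_real_eq_id, id_eq, smul_eq_mul] at this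
    rw [← this, laguerreCoeff]
    simp only [smul_eq_mul, mul_comm]
  simp only [h2] at h1
  refine h1.unique ((hasSum_laguerreKernelTerm hα (add_pos hs ht) hx hy).congr_fun fun k => ?_)
  rw [laguerreKernelTerm, neg_add, add_mul, Real.exp_add, smul_eq_mul]
  ring

end

/-! ### Completeness of the Laguerre functions -/

open BoundedContinuousFunction in
/-- An integrable function is determined by its moments against a separating family of bounded
continuous functions. -/
lemma ae_eq_zero_of_forall_integral_mul_prod_pow_eq_zero {E ι : Type*} [Fintype ι]
    [TopologicalSpace E] [PolishSpace E] [MeasurableSpace E] [BorelSpace E] {μ : Measure E}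
    {θ : ι → E →ᵇ ℝ} (hθ : ∀ x y, (∀ i, θ i x = θ i y) → x = y) {h : E → ℝ} (hh : Integrable h μ)
    (h0 : ∀ n : ι → ℕ, ∫ x, h x * ∏ i, θ i x ^ n i ∂μ = 0) : h =ᵐ[μ] 0 := by
  classical
  have m1 : AEMeasurable (fun x => ENNReal.ofReal (h x)) μ := hh.aemeasurable.ennreal_ofReal
  have m2 : AEMeasurable (fun x => ENNReal.ofReal (-h x)) μ := hh.neg.aemeasurable.ennreal_ofReal
  have f1 : ∫⁻ x, ENNReal.ofReal (h x) ∂μ ≠ ∞ := hh.lintegral_lt_top.ne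
  have f2 : ∫⁻ x, ENNReal.ofReal (-h x) ∂μ ≠ ∞ := hh.neg.lintegral_lt_top.ne
  have : IsFiniteMeasure (μ.withDensity fun x => ENNReal.ofReal (h x)) :=
    isFiniteMeasure_withDensity f1
  have : IsFiniteMeasure (μ.withDensity fun x => ENNReal.ofReal (-h x)) :=
    isFiniteMeasure_withDensity f2
  have hstar : ∀ a : E →ᵇ ℝ, star a = a := fun a =>
    BoundedContinuousFunction.ext fun x => star_trivial (a x)
  let A : StarSubalgebra ℝ (E →ᵇ ℝ) :=
    { Algebra.adjoin ℝ (Set.range θ) with star_mem' := fun {a} ha => (hstar a).symm ▸ ha }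
  have hA : (A.map (toContinuousMapStarₐ ℝ)).SeparatesPoints := by
    intro x y hxy
    by_contra! hcon
    refine hxy (hθ x y fun i => hcon (θ i) ⟨(θ i).toContinuousMap, ⟨θ i, ?_, rfl⟩, rfl⟩)
    exact Algebra.subset_adjoin ⟨i, rfl⟩
  have hint : ∀ g : E →ᵇ ℝ, Integrable (fun x => h x * g x) μ := fun g =>
    hh.mul_bdd (c := ‖g‖) g.continuous.aestronglyMeasurable
      (Eventually.of_forall fun x => g.norm_coe_le_norm x)
  have hmon : ∀ g ∈ Submonoid.closure (Set.range θ),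
      ∃ n : ι → ℕ, ∀ x, g x = ∏ i, θ i x ^ n i := by
    intro g hg
    induction hg using Submonoid.closure_induction with
    | mem g hg =>
      obtain ⟨i, rfl⟩ := hg
      refine ⟨Pi.single i 1, fun x => ?_⟩
      rw [Finset.prod_eq_single i]
      · simp
      · intro j _ hj
        simp [hj]
      · simp
    | one => exact ⟨0, fun x => by simp⟩
    | mul g₁ g₂ _ _ h₁ h₂ =>
      obtain ⟨n₁, h₁⟩ := h₁
      obtain ⟨n₂, h₂⟩ := h₂
      exact ⟨n₁ + n₂, fun x => by simp [h₁, h₂, pow_add, Finset.prod_mul_distrib]⟩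
  have hzero : ∀ g ∈ Algebra.adjoin ℝ (Set.range θ), ∫ x, h x * g x ∂μ = 0 := by
    intro g hg
    rw [← Subalgebra.mem_toSubmodule, Algebra.adjoin_eq_span] at hg
    induction hg using Submodule.span_induction with
    | mem g hg =>
      obtain ⟨n, hn⟩ := hmon g hg
      simp only [hn]
      exact h0 n
    | zero => simp
    | add g₁ g₂ _ _ h₁ h₂ =>
      simp only [BoundedContinuousFunction.coe_add, Pi.add_apply, mul_add]
      rw [integral_add (hint g₁) (hint g₂), h₁, h₂, add_zero]
    | smul c g _ h₁ =>
      simp only [BoundedContinuousFunction.coe_smul, smul_eq_mul, mul_left_comm _ c]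
      rw [integral_const_mul, h₁, mul_zero]
  -- The positive and negative parts of `h` define finite measures that agree on a separating
  -- algebra; on a Polish space such measures coincide.
  have key : (μ.withDensity fun x => ENNReal.ofReal (h x)) =
      μ.withDensity fun x => ENNReal.ofReal (-h x) := by
    refine ext_of_forall_mem_subalgebra_integral_eq_of_polish hA fun g hg => ?_
    have e : ∀ u : E → ℝ, Integrable u μ →
        ∫ x, g x ∂μ.withDensity (fun x => ENNReal.ofReal (u x)) = ∫ x, max (u x) 0 * g x ∂μ := by
      intro u hu
      rw [integral_withDensity_eq_integral_toReal_smul₀ hu.aemeasurable.ennreal_ofReal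
        (Eventually.of_forall fun x => ENNReal.ofReal_lt_top)]
      simp only [ENNReal.toReal_ofReal', smul_eq_mul]
    have hb : ∀ u : E → ℝ, Integrable u μ → Integrable (fun x => max (u x) 0 * g x) μ :=
      fun u hu => hu.pos_part.mul_bdd (c := ‖g‖) g.continuous.aestronglyMeasurable
        (Eventually.of_forall fun x => g.norm_coe_le_norm x)
    have := e h hh
    have h2 := e _ hh.neg
    simp only [Pi.neg_apply] at h2
    have h3 : Integrable (fun x => max (-h x) 0 * g x) μ := hb _ hh.neg
    rw [this, h2, ← sub_eq_zero, ← integral_sub (hb _ hh) h3]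
    refine Eq.trans (integral_congr_ae (Eventually.of_forall fun x => ?_)) (hzero g hg)
    simp only
    rw [← sub_mul, max_zero_sub_max_neg_zero_eq_self]
  have := (withDensity_eq_iff m1 m2 f1).1 key
  filter_upwards [this] with x hx
  rcases le_total 0 (h x) with h3 | h3
  · rw [ENNReal.ofReal_of_nonpos (neg_nonpos.2 h3), ENNReal.ofReal_eq_zero] at hx
    exact le_antisymm hx h3
  · rw [ENNReal.ofReal_of_nonpos h3, eq_comm, ENNReal.ofReal_eq_zero] at hx
    simp only [Pi.zero_apply]
    linarith

/-- A bounded injective continuous function on the line extending `exp (-x ^ 2)`. -/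
def gaussExtension : BoundedContinuousFunction ℝ ℝ :=
  BoundedContinuousFunction.ofNormedAddCommGroup
    (fun x => Real.exp (-(max x 0) ^ 2) + (1 - Real.exp (-(min x 0) ^ 2))) (by fun_prop) 2
    (fun x => by
      have h1 : Real.exp (-(max x 0) ^ 2) ≤ 1 :=
        Real.exp_le_one_iff.2 (by nlinarith [sq_nonneg (max x 0)])
      have h2 : Real.exp (-(min x 0) ^ 2) ≤ 1 :=
        Real.exp_le_one_iff.2 (by nlinarith [sq_nonneg (min x 0)])
      have h3 := Real.exp_pos (-(max x 0) ^ 2)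
      have h4 := Real.exp_pos (-(min x 0) ^ 2)
      rw [Real.norm_eq_abs, abs_le]
      constructor <;> linarith)

lemma gaussExtension_of_pos {x : ℝ} (hx : 0 < x) : gaussExtension x = Real.exp (-x ^ 2) := by
  simp [gaussExtension, hx.le]

/-- Points must be separated in all of `ℝ^d`, although the measure lives on the orthant, where only
the Gaussian values matter; hence injectivity on the full line. -/
lemma strictAnti_gaussExtension : StrictAnti gaussExtension := by
  intro x y hxy
  have hm : max x 0 ≤ max y 0 := max_le_max_right 0 hxy.le
  have hm' : min x 0 ≤ min y 0 := min_le_min_right 0 hxy.le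
  have a1 : Real.exp (-(max y 0) ^ 2) ≤ Real.exp (-(max x 0) ^ 2) := by
    rw [Real.exp_le_exp]
    nlinarith [le_max_right x 0]
  have a2 : Real.exp (-(min x 0) ^ 2) ≤ Real.exp (-(min y 0) ^ 2) := by
    rw [Real.exp_le_exp]
    nlinarith [min_le_right y 0]
  simp only [gaussExtension, BoundedContinuousFunction.coe_ofNormedAddCommGroup]
  rcases le_or_gt 0 x with h | h
  · have : Real.exp (-(max y 0) ^ 2) < Real.exp (-(max x 0) ^ 2) := by
      rw [Real.exp_lt_exp, max_eq_left h, max_eq_left (h.trans hxy.le)]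
      nlinarith
    linarith
  · have : Real.exp (-(min x 0) ^ 2) < Real.exp (-(min y 0) ^ 2) := by
      rw [Real.exp_lt_exp, min_eq_left h.le]
      have : x < min y 0 := lt_min hxy h
      nlinarith [min_le_right y 0]
    linarith

lemma laguerreReduced_zero (a X : ℝ) : laguerreReduced a 0 X = 1 / Real.Gamma (a + 1) := by
  simp [laguerreReduced]

lemma laguerreHermite1_zero_pos {a u : ℝ} (ha : -1 < a) (hu : 0 < u) :
    0 < laguerreHermite1 0 a u := by
  have h1 := laguerreWeight_pos ha 0
  have h2 : 0 < Real.Gamma (a + 1) := Real.Gamma_pos_of_pos (by linarith)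
  rw [laguerreHermite1_eq ha, laguerreReduced_zero]
  positivity

/-- The functions `exp (-n u ^ 2) φ_0 u` are absolutely convergent combinations of the
Laguerre functions. -/
lemma exists_hasSum_exp_mul_laguerreHermite1_zero {a : ℝ} (ha : -1 / 2 ≤ a) (n : ℕ) :
    ∃ A : ℕ → ℝ, Summable (fun k => |A k|) ∧ ∀ u,
      HasSum (fun k => A k * laguerreHermite1 k a u)
        (laguerreHermite1 0 a u * Real.exp (-u ^ 2) ^ n) := by
  have ha' : -1 < a := by linarith
  have hw := laguerreWeight_pos ha'
  have hG : 0 < Real.Gamma (a + 1) := Real.Gamma_pos_of_pos (by linarith)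
  have hn : (0 : ℝ) < n + 1 := by positivity
  have hn' : (0 : ℝ) < n + 1 + 1 := by positivity
  -- the case `n = 0` has the trivial expansion
  rcases Nat.eq_zero_or_pos n with rfl | hpos
  · refine ⟨fun k => if k = 0 then 1 else 0, ?_, fun u => ?_⟩
    · exact summable_of_ne_finset_zero (s := {0}) fun k hk => by
        simp only [Finset.mem_singleton] at hk
        simp [hk]
    · convert hasSum_ite_eq 0 (laguerreHermite1 0 a u) using 2 with k
      · split_ifs with h <;> simp [h]
      · simp
  have hnpos : (0 : ℝ) < n := by exact_mod_cast hpos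
  -- Chosen so that `r/(1-r) = n`: the generating function then produces `exp(-n u²)`. The constant
  -- `K` removes its prefactor and inserts the normalization of `φ_0`.
  set r : ℝ := n / (n + 1) with hr
  have hr0 : 0 < r := by positivity
  have hr1 : r < 1 := by rw [hr, div_lt_one hn]; linarith
  have hr2 : 1 - r = 1 / (n + 1) := by rw [hr]; field_simp; ring
  set K : ℝ := √(laguerreWeight a 0) * (1 / Real.Gamma (a + 1)) / (1 - r) ^ (-(a + 1)) with hK
  have hp : (1 - r) ^ (-(a + 1)) ≠ 0 := (Real.rpow_pos_of_pos (by linarith) _).ne'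
  refine ⟨fun k => K * (√(laguerreWeight a k) * r ^ k), ?_, fun u => ?_⟩
  · have h := (summable_sqrt_laguerreWeight_mul ha hr0 hr1 0)
    have h0 : ∀ k, laguerreReduced a k 0 = 1 / Real.Gamma (a + 1) := by
      intro k
      rw [laguerreReduced, Finset.sum_eq_single 0]
      · simp
      · intro j _ hj
        simp [hj]
      · simp
    simp only [h0, abs_of_pos (one_div_pos.2 hG)] at h
    refine (h.mul_left (|K| * Real.Gamma (a + 1))).congr fun k => ?_
    rw [abs_mul, abs_of_nonneg (show 0 ≤ √(laguerreWeight a k) * r ^ k by positivity)]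
    field_simp
  · have h := hasSum_laguerre_generating ha' (show |r| < 1 by rwa [abs_of_pos hr0]) (u ^ 2)
    have h1 := h.mul_left (K * (√2 * u ^ (a + 1 / 2) * Real.exp (-u ^ 2 / 2)))
    refine HasSum.congr_both h1 (fun k => ?_) ?_
    · rw [laguerreHermite1_eq ha']
      have := Real.mul_self_sqrt (hw k).le
      linear_combination K * √2 * u ^ (a + 1 / 2) * Real.exp (-u ^ 2 / 2) *
        laguerreReduced a k (u ^ 2) * r ^ k * this
    · rw [laguerreHermite1_eq ha', laguerreReduced_zero, hK, ← Real.exp_nat_mul]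
      have e : -u ^ 2 * r / (1 - r) = n * -u ^ 2 := by
        rw [hr2, hr]
        field_simp
      rw [e]
      field_simp

section

variable {d : ℕ} {α : Fin d → ℝ}

lemma ae_eq_zero_of_laguerreCoeff_eq_zero_real (hα : ∀ i, -1 / 2 ≤ α i) {f : (Fin d → ℝ) → ℝ}
    (hf : MemLp f 2 (orthantMeasure d)) (h0 : ∀ k, laguerreCoeff α f k = 0) :
    f =ᵐ[orthantMeasure d] 0 := by
  let θ : Fin d → BoundedContinuousFunction (Fin d → ℝ) ℝ := fun i =>
    gaussExtension.compContinuous ⟨fun x => x i, continuous_apply i⟩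
  have hθ : ∀ i x, θ i x = gaussExtension (x i) := fun i x => rfl
  have hi := integrable_laguerreHermite_smul hα 0 hf
  -- The moment lemma is applied to `φ_0 f`, which is integrable; since `φ_0 > 0` on the orthant,
  -- its vanishing forces that of `f`.
  have key := ae_eq_zero_of_forall_integral_mul_prod_pow_eq_zero (θ := θ)
    (fun x y hxy => funext fun i => strictAnti_gaussExtension.injective (hxy i)) hi ?_
  · filter_upwards [key, ae_mem_orthant d] with x hx hxo
    have : 0 < laguerreHermite α 0 x := Finset.prod_pos fun i _ =>
      laguerreHermite1_zero_pos (neg_one_lt_of_neg_half_le hα i) (hxo i)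
    simpa [this.ne'] using hx
  · intro n
    choose A hA hA' using fun i => exists_hasSum_exp_mul_laguerreHermite1_zero (hα i) (n i)
    have h1 : Summable fun k : Fin d → ℕ => |∏ i, A i (k i)| :=
      (summable_and_hasSum_pi_prod fun i => (hA i).of_abs.hasSum).1
    have h2 := hasSum_smul_laguerreCoeff hα h1 (B := fun y => laguerreHermite α 0 y *
      ∏ i, θ i y ^ n i) (fun y hy => ?_) hf
    · simp only [h0, smul_zero] at h2
      rw [← h2.unique hasSum_zero]
      congr 1 with y
      simp only [smul_eq_mul]
      ring
    · refine HasSum.congr_both (summable_and_hasSum_pi_prod fun i => hA' i (y i)).2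
        (fun k => ?_) ?_
      · rw [laguerreHermite, Finset.prod_mul_distrib]
      · rw [laguerreHermite, Finset.prod_mul_distrib]
        simp only [hθ, gaussExtension_of_pos (hy _), Pi.zero_apply]

variable {𝕜 : Type*} [RCLike 𝕜]

/-- The Laguerre functions are complete in `L²`. -/
lemma ae_eq_zero_of_laguerreCoeff_eq_zero (hα : ∀ i, -1 / 2 ≤ α i) {f : (Fin d → ℝ) → 𝕜}
    (hf : MemLp f 2 (orthantMeasure d)) (h0 : ∀ k, laguerreCoeff α f k = 0) :
    f =ᵐ[orthantMeasure d] 0 := by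
  have hre := ae_eq_zero_of_laguerreCoeff_eq_zero_real hα hf.re fun k => by
    have := integral_re (integrable_laguerreHermite_smul hα k hf)
    simp only [RCLike.smul_re] at this
    rw [laguerreCoeff]
    simp only [smul_eq_mul]
    rw [this]
    have h := h0 k
    rw [laguerreCoeff] at h
    simp [h]
  have him := ae_eq_zero_of_laguerreCoeff_eq_zero_real hα hf.im fun k => by
    have := integral_im (integrable_laguerreHermite_smul hα k hf)
    simp only [RCLike.smul_im] at this
    rw [laguerreCoeff]
    simp only [smul_eq_mul]
    rw [this]
    have h := h0 k
    rw [laguerreCoeff] at h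
    simp [h]
  filter_upwards [hre, him] with x h1 h2
  exact RCLike.ext (by simpa using h1) (by simpa using h2)

/-- The Laguerre functions as elements of `L²`. -/
def laguerreLp (𝕜 : Type*) [RCLike 𝕜] (hα : ∀ i, -1 / 2 ≤ α i) (k : Fin d → ℕ) :
    Lp 𝕜 2 (orthantMeasure d) :=
  (memLp_ofReal_laguerreHermite (𝕜 := 𝕜) hα k).toLp _

lemma inner_laguerreLp (hα : ∀ i, -1 / 2 ≤ α i) (k : Fin d → ℕ) (f : Lp 𝕜 2 (orthantMeasure d)) :
    inner 𝕜 (laguerreLp 𝕜 hα k) f = laguerreCoeff α f k := by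
  rw [L2.inner_def, laguerreCoeff]
  refine integral_congr_ae ?_
  filter_upwards [(memLp_ofReal_laguerreHermite (𝕜 := 𝕜) hα k).coeFn_toLp] with x hx
  rw [laguerreLp, hx, RCLike.inner_apply, RCLike.conj_ofReal, RCLike.real_smul_eq_coe_mul, mul_comm]

lemma laguerreCoeff_congr {f g : (Fin d → ℝ) → 𝕜} (h : f =ᵐ[orthantMeasure d] g)
    (k : Fin d → ℕ) : laguerreCoeff α f k = laguerreCoeff α g k :=
  integral_congr_ae (h.mono fun x hx => by simp only [hx])

/-- The Laguerre functions form a Hilbert basis of `L²`. -/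
def laguerreBasis (𝕜 : Type*) [RCLike 𝕜] (hα : ∀ i, -1 / 2 ≤ α i) :
    HilbertBasis (Fin d → ℕ) 𝕜 (Lp 𝕜 2 (orthantMeasure d)) :=
  HilbertBasis.mkOfOrthogonalEqBot (v := laguerreLp 𝕜 hα)
    (by
      classical
      rw [orthonormal_iff_ite]
      intro k l
      rw [inner_laguerreLp, laguerreLp, laguerreCoeff_congr (MemLp.coeFn_toLp _),
        laguerreCoeff_laguerreHermite hα])
    (by
      rw [Submodule.eq_bot_iff]
      intro f hf
      rw [Lp.eq_zero_iff_ae_eq_zero]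
      refine ae_eq_zero_of_laguerreCoeff_eq_zero hα (Lp.memLp f) fun k => ?_
      rw [← inner_laguerreLp hα]
      exact (Submodule.mem_orthogonal _ _).1 hf _ (Submodule.subset_span ⟨k, rfl⟩))

/-- The Fourier-Laguerre expansion in `L²`. -/
lemma tendsto_eLpNorm_sub_laguerre_sum (hα : ∀ i, -1 / 2 ≤ α i) {f : (Fin d → ℝ) → 𝕜}
    (hf : MemLp f 2 (orthantMeasure d)) :
    Tendsto (fun s : Finset (Fin d → ℕ) => eLpNorm (fun x => f x - ∑ k ∈ s,
      laguerreHermite α k x • laguerreCoeff α f k) 2 (orthantMeasure d)) atTop (𝓝 0) := by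
  have h := (laguerreBasis 𝕜 hα).hasSum_repr (hf.toLp f)
  have hs : ∀ s : Finset (Fin d → ℕ), ((∑ k ∈ s, (laguerreBasis 𝕜 hα).repr (hf.toLp f) k •
      laguerreBasis 𝕜 hα k : Lp 𝕜 2 (orthantMeasure d)) : (Fin d → ℝ) → 𝕜)
        =ᵐ[orthantMeasure d] fun x => ∑ k ∈ s, laguerreHermite α k x • laguerreCoeff α f k := by
    intro s
    induction s using Finset.induction_on with
    | empty =>
      simp only [Finset.sum_empty]
      exact Lp.coeFn_zero _ _ _
    | insert k s hk ih =>
      simp only [Finset.sum_insert hk]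
      refine (Lp.coeFn_add _ _).trans ?_
      filter_upwards [ih, Lp.coeFn_smul ((laguerreBasis 𝕜 hα).repr (hf.toLp f) k)
        (laguerreBasis 𝕜 hα k),
        (memLp_ofReal_laguerreHermite (𝕜 := 𝕜) hα k).coeFn_toLp] with x h1 h2 h3
      rw [Pi.add_apply, h1, h2, Pi.smul_apply, HilbertBasis.repr_apply_apply]
      simp only [laguerreBasis, HilbertBasis.coe_mkOfOrthogonalEqBot] at h2 ⊢
      rw [inner_laguerreLp, laguerreCoeff_congr hf.coeFn_toLp, laguerreLp, h3, smul_eq_mul,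
        RCLike.real_smul_eq_coe_mul, mul_comm]
  rw [HasSum, SummationFilter.unconditional_filter, tendsto_iff_edist_tendsto_0] at h
  refine h.congr fun s => ?_
  rw [Lp.edist_def, ← eLpNorm_neg]
  refine eLpNorm_congr_ae ?_
  filter_upwards [hs s, hf.coeFn_toLp] with x h1 h2
  simp only [Pi.neg_apply, Pi.sub_apply, h1, h2, neg_sub]

end

/-! ### Mass of the heat kernel on the orthant -/

section

variable {d : ℕ} {α : Fin d → ℝ} {t : ℝ}

/-- Nonempty open sets have positive Lebesgue measure; this turns almost-everywhere claims into a
point where they can be contradicted. -/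
lemma exists_mem_of_ae_orthantMeasure {U : Set (Fin d → ℝ)} (hU : IsOpen U) (hne : U.Nonempty)
    (hsub : U ⊆ orthant d) {P : (Fin d → ℝ) → Prop} (h : ∀ᵐ x ∂orthantMeasure d, P x) :
    ∃ x ∈ U, P x := by
  by_contra! hcon
  have h1 : orthantMeasure d U = 0 :=
    measure_mono_null (fun x hx => hcon x hx) (ae_iff.1 h)
  rw [orthantMeasure, Measure.restrict_apply hU.measurableSet,
    Set.inter_eq_self_of_subset_left hsub] at h1
  exact (hU.measure_pos volume hne).ne' h1

lemma isOpen_orthant (d : ℕ) : IsOpen (orthant d) := by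
  simp only [orthant, Set.ofPred_forall]
  exact isOpen_iInter_of_finite fun i => isOpen_lt continuous_const (continuous_apply i)

lemma orthant_nonempty (d : ℕ) : (orthant d).Nonempty := ⟨fun _ => 1, fun _ => one_pos⟩

lemma lintegral_laguerreKernel_eq_prod (hα : ∀ i, -1 / 2 ≤ α i) (ht : 0 < t) {x : Fin d → ℝ}
    (hx : x ∈ orthant d) :
    ∫⁻ y, ENNReal.ofReal (laguerreKernel α t x y) ∂orthantMeasure d =
      ∏ i, (ENNReal.ofReal (Real.cosh (2 * t) ^ (-1 / 2 : ℝ) * Real.exp (-(Real.sinh (2 * t)) ^ 2 *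
        (x i ^ 2 / (2 * Real.sinh (2 * t) * Real.cosh (2 * t))))) *
          laguerreMass (α i / 2 + 1 / 4)
            (x i ^ 2 / (2 * Real.sinh (2 * t) * Real.cosh (2 * t)))) := by
  rw [lintegral_laguerreKernel hα ht hx]
  exact Finset.prod_congr rfl fun i _ => lintegral_laguerreKernel1 (hα i) ht (hx i)

lemma lintegral_laguerreKernel_le (hα : ∀ i, -1 / 2 ≤ α i) (ht : 0 < t) {c : Fin d → ℝ}
    (hc0 : ∀ i, 0 ≤ c i)
    (hc : ∀ i w, 0 < w → laguerreMass (α i / 2 + 1 / 4) w ≤ ENNReal.ofReal (c i))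
    {x : Fin d → ℝ} (hx : x ∈ orthant d) :
    ∫⁻ y, ENNReal.ofReal (laguerreKernel α t x y) ∂orthantMeasure d ≤
      ENNReal.ofReal ((∏ i, c i) * Real.cosh (2 * t) ^ (-(d : ℝ) / 2)) := by
  have hS : 0 < Real.sinh (2 * t) := Real.sinh_pos_iff.2 (by linarith)
  have hC : 0 < Real.cosh (2 * t) := Real.cosh_pos _
  have e : (∏ i, c i) * Real.cosh (2 * t) ^ (-(d : ℝ) / 2) =
      ∏ i, (Real.cosh (2 * t) ^ (-1 / 2 : ℝ) * c i) := by
    rw [Finset.prod_mul_distrib, Finset.prod_const, Finset.card_univ, Fintype.card_fin,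
      ← Real.rpow_mul_natCast hC.le, mul_comm]
    congr 2
    ring
  have hp : 0 ≤ Real.cosh (2 * t) ^ (-1 / 2 : ℝ) := Real.rpow_nonneg hC.le _
  rw [lintegral_laguerreKernel_eq_prod hα ht hx, e,
    ENNReal.ofReal_prod_of_nonneg fun i _ => mul_nonneg hp (hc0 i)]
  refine Finset.prod_le_prod' fun i _ => ?_
  have hw : 0 < x i ^ 2 / (2 * Real.sinh (2 * t) * Real.cosh (2 * t)) := by
    have := hx i
    positivity
  rw [ENNReal.ofReal_mul (q := c i) hp]
  refine mul_le_mul' (ENNReal.ofReal_le_ofReal ?_) (hc i _ hw)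
  refine mul_le_of_le_one_right hp (Real.exp_le_one_iff.2 ?_)
  rw [neg_mul]
  exact neg_nonpos.2 (by positivity)

lemma exists_lintegral_laguerreKernel_le (hα : ∀ i, -1 / 2 ≤ α i) :
    ∃ c : ℝ, 1 < c ∧ ∀ t : ℝ, 0 < t → ∀ x ∈ orthant d,
      ∫⁻ y, ENNReal.ofReal (laguerreKernel α t x y) ∂orthantMeasure d ≤
        ENNReal.ofReal (c * Real.cosh (2 * t) ^ (-(d : ℝ) / 2)) := by
  choose c hc1 hc using fun i => exists_laguerreMass_le (δ := α i / 2 + 1 / 4)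
    (by linarith [hα i])
  have hprod : 1 ≤ ∏ i, c i := by
    simpa using Finset.prod_le_prod (s := Finset.univ) (f := fun _ : Fin d => (1 : ℝ))
      (fun _ _ => zero_le_one) fun i _ => hc1 i
  -- The individual bounds may all equal one; adding `1` makes the constant strictly larger than
  -- one.
  refine ⟨(∏ i, c i) + 1, by linarith, fun t ht x hx => ?_⟩
  refine (lintegral_laguerreKernel_le hα ht (fun i => by linarith [hc1 i]) hc hx).trans
    (ENNReal.ofReal_le_ofReal ?_)
  have : 0 ≤ Real.cosh (2 * t) ^ (-(d : ℝ) / 2) := Real.rpow_nonneg (Real.cosh_pos _).le _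
  nlinarith

lemma lintegral_laguerreKernel_le_of_contractive (hα : ∀ i, α i = -1 / 2 ∨ 1 / 2 ≤ α i)
    (ht : 0 < t) {x : Fin d → ℝ} (hx : x ∈ orthant d) :
    ∫⁻ y, ENNReal.ofReal (laguerreKernel α t x y) ∂orthantMeasure d ≤
      ENNReal.ofReal (Real.cosh (2 * t) ^ (-(d : ℝ) / 2)) := by
  have hα' : ∀ i, -1 / 2 ≤ α i := fun i => by rcases hα i with h | h <;> linarith
  have h := lintegral_laguerreKernel_le hα' ht (c := fun _ => 1) (fun i => zero_le_one)
    (fun i w hw => by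
      rw [ENNReal.ofReal_one]
      refine laguerreMass_le_one ?_ hw
      rcases hα i with h | h
      · left; rw [h]; norm_num
      · right; linarith) hx
  simpa using h

/-- In the non-contractive range the mass of the heat kernel exceeds one on a nonempty open set
for some time. -/
lemma exists_one_lt_lintegral_laguerreKernel (hα : ∀ i, -1 / 2 ≤ α i)
    (hi : ∃ i, -1 / 2 < α i ∧ α i < 1 / 2) :
    ∃ t : ℝ, 0 < t ∧ ∃ U : Set (Fin d → ℝ), IsOpen U ∧ U.Nonempty ∧ U ⊆ orthant d ∧
      ∀ x ∈ U, 1 < ∫⁻ y, ENNReal.ofReal (laguerreKernel α t x y) ∂orthantMeasure d := by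
  classical
  obtain ⟨i₀, hi1, hi2⟩ := hi
  obtain ⟨W₀, hW₀, η, hη, hmass₀⟩ := exists_one_lt_laguerreMass (δ := α i₀ / 2 + 1 / 4)
    (by linarith) (by linarith)
  -- The deficits allowed in the other `d - 1` coordinates must not consume the gain `η` of the
  -- distinguished one.
  obtain ⟨ε, ⟨hε0, hε1⟩, hε⟩ : ∃ ε : ℝ, (0 < ε ∧ ε < 1) ∧ 1 < (1 + η) * (1 - ε) ^ (d - 1) := by
    have hc : Tendsto (fun ε : ℝ => (1 + η) * (1 - ε) ^ (d - 1)) (𝓝[>] 0) (𝓝 (1 + η)) := by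
      have : Continuous fun ε : ℝ => (1 + η) * (1 - ε) ^ (d - 1) := by fun_prop
      exact (this.tendsto' 0 _ (by simp)).mono_left nhdsWithin_le_nhds
    have h1 := hc.eventually (lt_mem_nhds (show 1 < 1 + η by linarith))
    have h2 : ∀ᶠ ε : ℝ in 𝓝[>] 0, ε ∈ Set.Ioo (0 : ℝ) 1 := Ioo_mem_nhdsGT zero_lt_one
    exact (h2.and h1).exists
  have hW : ∀ i, ∃ W : ℝ, 0 < W ∧ ∀ w ∈ Set.Icc W (W + 1),
      ENNReal.ofReal (if i = i₀ then 1 + η else 1 - ε) ≤ laguerreMass (α i / 2 + 1 / 4) w := by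
    intro i
    by_cases h : i = i₀
    · subst h
      exact ⟨W₀, hW₀, by simpa using hmass₀⟩
    · simp only [if_neg h]
      exact exists_laguerreMass_ge (by linarith [hα i]) hε0
  choose W hWpos hmass using hW
  set b : Fin d → ℝ := fun i => if i = i₀ then 1 + η else 1 - ε with hb
  have hb0 : ∀ i, 0 ≤ b i := by
    intro i
    simp only [hb]
    split_ifs <;> linarith
  have hbprod : 1 < ∏ i, b i := by
    rw [← Finset.mul_prod_erase _ _ (Finset.mem_univ i₀),
      Finset.prod_congr rfl (g := fun _ => 1 - ε) fun i hi => by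
        simp [hb, Finset.ne_of_mem_erase hi]]
    simpa [hb] using hε
  -- The windows for `w` are already fixed independently of `t`, so letting `t → 0` sends the
  -- prefactors to one. Their pullback to `x` is an open box in the orthant.
  obtain ⟨t, ht, hbt⟩ : ∃ t : ℝ, 0 < t ∧ 1 < ∏ i, (Real.cosh (2 * t) ^ (-1 / 2 : ℝ) *
      Real.exp (-(Real.sinh (2 * t)) ^ 2 * (W i + 1)) * b i) := by
    have hc : Continuous fun t : ℝ => ∏ i, (Real.cosh (2 * t) ^ (-1 / 2 : ℝ) *
        Real.exp (-(Real.sinh (2 * t)) ^ 2 * (W i + 1)) * b i) := by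
      have h1 : Continuous fun t : ℝ => Real.cosh (2 * t) := by fun_prop
      have h2 : Continuous fun t : ℝ => Real.cosh (2 * t) ^ (-1 / 2 : ℝ) :=
        h1.rpow_const fun t => Or.inl (Real.cosh_pos _).ne'
      exact continuous_finsetProd _ fun i _ => (h2.mul (by fun_prop)).mul continuous_const
    have hc' := (hc.tendsto' 0 (∏ i, b i) (by simp)).mono_left
      (nhdsWithin_le_nhds (s := Set.Ioi 0))
    have h0 : ∀ᶠ t : ℝ in 𝓝[>] 0, 0 < t := self_mem_nhdsWithin
    exact (h0.and (hc'.eventually (lt_mem_nhds hbprod))).exists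
  have hS : 0 < Real.sinh (2 * t) := Real.sinh_pos_iff.2 (by linarith)
  have hC : 0 < Real.cosh (2 * t) := Real.cosh_pos _
  set D : ℝ := 2 * Real.sinh (2 * t) * Real.cosh (2 * t) with hD
  have hDpos : 0 < D := by positivity
  refine ⟨t, ht, {x | ∀ i, 0 < x i ∧ W i < x i ^ 2 / D ∧ x i ^ 2 / D < W i + 1}, ?_, ?_,
    fun x hx i => (hx i).1, fun x hx => ?_⟩
  · simp only [Set.ofPred_forall]
    refine isOpen_iInter_of_finite fun i => ?_
    have hc : Continuous fun x : Fin d → ℝ => x i ^ 2 / D := by fun_prop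
    exact (isOpen_lt continuous_const (continuous_apply i)).inter
      ((isOpen_lt continuous_const hc).inter (isOpen_lt hc continuous_const))
  · refine ⟨fun i => √((W i + 1 / 2) * D), fun i => ?_⟩
    have hpos : 0 < (W i + 1 / 2) * D := mul_pos (by linarith [hWpos i]) hDpos
    rw [Real.sq_sqrt hpos.le, mul_div_cancel_right₀ _ hDpos.ne']
    exact ⟨Real.sqrt_pos.2 hpos, by linarith, by linarith⟩
  · rw [lintegral_laguerreKernel_eq_prod hα ht fun i => (hx i).1, ← ENNReal.ofReal_one]
    refine ((ENNReal.ofReal_lt_ofReal_iff (by linarith)).2 hbt).trans_le ?_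
    have hp : 0 ≤ Real.cosh (2 * t) ^ (-1 / 2 : ℝ) := Real.rpow_nonneg hC.le _
    have hpe : ∀ i, 0 ≤ Real.cosh (2 * t) ^ (-1 / 2 : ℝ) *
        Real.exp (-(Real.sinh (2 * t)) ^ 2 * (W i + 1)) := fun i => by positivity
    rw [ENNReal.ofReal_prod_of_nonneg fun i _ => mul_nonneg (hpe i) (hb0 i)]
    refine Finset.prod_le_prod' fun i _ => ?_
    obtain ⟨-, h1, h2⟩ := hx i
    rw [ENNReal.ofReal_mul (hpe i)]
    refine mul_le_mul' (ENNReal.ofReal_le_ofReal ?_) (hmass i _ ⟨h1.le, h2.le⟩)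
    refine mul_le_mul_of_nonneg_left (Real.exp_le_exp.2 ?_) hp
    rw [neg_mul, neg_mul]
    exact neg_le_neg (mul_le_mul_of_nonneg_left h2.le (sq_nonneg _))

end

/-! ### The Laguerre semigroup -/

section

variable {X 𝕜 : Type*} [MeasurableSpace X] [RCLike 𝕜] {μ : Measure X}

lemma kernelOp_ofReal (K : X → X → ℝ) (g : X → ℝ) (x : X) :
    kernelOp μ K (fun y => (g y : 𝕜)) x = ((∫ y, K x y * g y ∂μ : ℝ) : 𝕜) := by
  rw [kernelOp, ← integral_ofReal]
  simp only [RCLike.real_smul_eq_coe_mul, RCLike.ofReal_mul]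

lemma kernelOp_congr {K : X → X → ℝ} {f g : X → 𝕜} (h : f =ᵐ[μ] g) :
    kernelOp μ K f = kernelOp μ K g :=
  funext fun _ => integral_congr_ae (h.mono fun y hy => by simp only [hy])

lemma LpOpNormLE.congr {p : ℝ≥0∞} {S S' : (X → 𝕜) → X → 𝕜} {C : ℝ} (h : LpOpNormLE μ p S C)
    (hS : ∀ f, S f =ᵐ[μ] S' f) : LpOpNormLE μ p S' C := fun f hf => by
  obtain ⟨h1, h2⟩ := h f hf
  exact ⟨h1.ae_eq (hS f), by rwa [← eLpNorm_congr_ae (hS f)]⟩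

lemma LpOpNormLE.mono {p : ℝ≥0∞} {S : (X → 𝕜) → X → 𝕜} {C C' : ℝ} (h : LpOpNormLE μ p S C)
    (hC : C ≤ C') : LpOpNormLE μ p S C' := fun f hf =>
  ⟨(h f hf).1, (h f hf).2.trans (mul_le_mul_left (ENNReal.ofReal_le_ofReal hC) _)⟩

lemma LpOpNormLE.id (p : ℝ≥0∞) : LpOpNormLE μ p (fun f : X → 𝕜 => f) 1 := fun f hf =>
  ⟨hf, by simp⟩

end

section

variable {𝕜 : Type*} [RCLike 𝕜] {d : ℕ} {α : Fin d → ℝ}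

lemma laguerreSemigroup_zero (α : Fin d → ℝ) (f : (Fin d → ℝ) → 𝕜) :
    laguerreSemigroup α 0 f = f := by
  funext x
  simp [laguerreSemigroup]

lemma laguerreSemigroup_eq_kernelOp (hα : ∀ i, -1 / 2 ≤ α i) {t : ℝ≥0} (ht : 0 < t)
    (f : (Fin d → ℝ) → 𝕜) {x : Fin d → ℝ} (hx : x ∈ orthant d) :
    laguerreSemigroup α t f x = kernelOp (orthantMeasure d) (laguerreKernel α t) f x := by
  rw [laguerreSemigroup, if_neg ht.ne', kernelOp]
  refine integral_congr_ae ?_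
  filter_upwards [ae_mem_orthant d] with y hy
  rw [laguerreHeatKernel_eq hα (NNReal.coe_pos.2 ht) hx hy]

lemma laguerreSemigroup_ae_eq (hα : ∀ i, -1 / 2 ≤ α i) {t : ℝ≥0} (ht : 0 < t)
    (f : (Fin d → ℝ) → 𝕜) : laguerreSemigroup α t f =ᵐ[orthantMeasure d]
      kernelOp (orthantMeasure d) (laguerreKernel α t) f :=
  (ae_mem_orthant d).mono fun _ hx => laguerreSemigroup_eq_kernelOp hα ht f hx

lemma lpOpNormLE_laguerreSemigroup (hα : ∀ i, -1 / 2 ≤ α i) {t : ℝ≥0} (ht : 0 < t) {M : ℝ}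
    (hM : ∀ x ∈ orthant d, ∫⁻ y, ENNReal.ofReal (laguerreKernel α t x y) ∂orthantMeasure d ≤
      ENNReal.ofReal M) {p : ℝ≥0∞} (hp : 1 ≤ p) :
    LpOpNormLE (orthantMeasure d) p (laguerreSemigroup (𝕜 := 𝕜) α t) M :=
  (lpOpNormLE_kernelOp (measurable_laguerreKernel α t)
    (laguerreKernel_nonneg hα (NNReal.coe_pos.2 ht)) (laguerreKernel_comm α t)
    ((ae_mem_orthant d).mono hM) hp).congr fun f => (laguerreSemigroup_ae_eq hα ht f).symm

/-- The semigroup acts diagonally on the partial sums of the Fourier-Laguerre expansion. -/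
lemma kernelOp_sub_laguerre_sum (hα : ∀ i, -1 / 2 ≤ α i) {t : ℝ} (ht : 0 < t)
    {f : (Fin d → ℝ) → 𝕜} (hf : MemLp f 2 (orthantMeasure d)) (s : Finset (Fin d → ℕ))
    (c : (Fin d → ℕ) → 𝕜) {x : Fin d → ℝ} (hx : x ∈ orthant d) :
    kernelOp (orthantMeasure d) (laguerreKernel α t)
      (fun y => f y - ∑ k ∈ s, laguerreHermite α k y • c k) x =
    kernelOp (orthantMeasure d) (laguerreKernel α t) f x -
      ∑ k ∈ s, (Real.exp (-t * laguerreEigenvalue α k) * laguerreHermite α k x) • c k := by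
  have hi := integrable_laguerreKernel_smul hα ht (memL1AddLinfty_of_memLp one_le_two hf) hx
  have hk : ∀ k, Integrable (fun y => (laguerreKernel α t x y * laguerreHermite α k y) • c k)
      (orthantMeasure d) := fun k =>
    (integrable_laguerreKernel_smul hα ht
      (memL1AddLinfty_of_memLp one_le_two (memLp_laguerreHermite hα k)) hx).smul_const (c k)
  simp only [kernelOp, smul_sub, Finset.smul_sum, smul_smul]
  rw [integral_sub hi (integrable_finsetSum _ fun k _ => hk k),
    integral_finsetSum _ fun k _ => hk k]
  congr 1
  refine Finset.sum_congr rfl fun k _ => ?_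
  rw [integral_smul_const]
  exact congrArg (· • c k) (kernelOp_laguerreHermite (𝕜 := ℝ) hα ht k hx)

/-- The left-hand function is `T_t` applied to the remainder of the expansion of `f`, so convergence
of that expansion passes to the spectral series of `T_t f`. -/
lemma eLpNorm_laguerreSemigroup_sub_sum_le (hα : ∀ i, -1 / 2 ≤ α i) {t : ℝ≥0} (ht : 0 < t)
    {M : ℝ} (hM : ∀ x ∈ orthant d,
      ∫⁻ y, ENNReal.ofReal (laguerreKernel α t x y) ∂orthantMeasure d ≤ ENNReal.ofReal M)
    {f : (Fin d → ℝ) → 𝕜} (hf : MemLp f 2 (orthantMeasure d)) (s : Finset (Fin d → ℕ)) :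
    eLpNorm (fun x => laguerreSemigroup α t f x - ∑ k ∈ s,
      (Real.exp (-t * laguerreEigenvalue α k) * laguerreHermite α k x) • laguerreCoeff α f k)
      2 (orthantMeasure d) ≤
    ENNReal.ofReal M * eLpNorm (fun x => f x - ∑ k ∈ s,
      laguerreHermite α k x • laguerreCoeff α f k) 2 (orthantMeasure d) := by
  have hfs : MemLp (fun x => f x - ∑ k ∈ s, laguerreHermite α k x • laguerreCoeff α f k) 2
      (orthantMeasure d) := by
    refine hf.sub (memLp_finsetSum _ fun k _ => ?_)
    simp only [RCLike.real_smul_eq_coe_mul]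
    exact (memLp_ofReal_laguerreHermite hα k).mul_const _
  refine le_of_eq_of_le (eLpNorm_congr_ae ?_)
    (lpOpNormLE_laguerreSemigroup hα ht hM one_le_two _ hfs).2
  filter_upwards [ae_mem_orthant d] with x hx
  rw [laguerreSemigroup_eq_kernelOp hα ht _ hx, laguerreSemigroup_eq_kernelOp hα ht _ hx,
    kernelOp_sub_laguerre_sum hα (NNReal.coe_pos.2 ht) hf s _ hx]

lemma isSpectralHeatFlow_laguerreSemigroup (hα : ∀ i, -1 / 2 ≤ α i) (t : ℝ≥0)
    {f : (Fin d → ℝ) → 𝕜} (hf : MemLp f 2 (orthantMeasure d)) :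
    IsSpectralHeatFlow α t f (laguerreSemigroup α t f) := by
  rcases eq_zero_or_pos t with rfl | ht
  · rw [laguerreSemigroup_zero]
    exact ⟨hf, by simpa using tendsto_eLpNorm_sub_laguerre_sum hα hf⟩
  · obtain ⟨c, -, hc⟩ := exists_lintegral_laguerreKernel_le hα
    have hM := hc t (NNReal.coe_pos.2 ht)
    refine ⟨(lpOpNormLE_laguerreSemigroup hα ht hM one_le_two f hf).1, ?_⟩
    have h := ENNReal.Tendsto.const_mul (tendsto_eLpNorm_sub_laguerre_sum hα hf)
      (Or.inr (ENNReal.ofReal_ne_top (r := c * Real.cosh (2 * t) ^ (-(d : ℝ) / 2))))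
    rw [mul_zero] at h
    exact tendsto_of_tendsto_of_tendsto_of_le_of_le tendsto_const_nhds h (fun _ => zero_le)
      fun s => eLpNorm_laguerreSemigroup_sub_sum_le hα ht hM hf s

end

/-! ### Contractivity, Markov properties and their failure. -/

section

variable {𝕜 : Type*} [RCLike 𝕜] {d : ℕ} {α : Fin d → ℝ}

lemma cosh_rpow_le_one (d : ℕ) (t : ℝ) : Real.cosh (2 * t) ^ (-(d : ℝ) / 2) ≤ 1 :=
  Real.rpow_le_one_of_one_le_of_nonpos (Real.one_le_cosh _) (by
    have : (0 : ℝ) ≤ d := d.cast_nonneg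
    linarith)

lemma lpOpNormLE_laguerreSemigroup_of_contractive (hα : ∀ i, α i = -1 / 2 ∨ 1 / 2 ≤ α i)
    {t : ℝ≥0} (ht : 0 < t) {p : ℝ≥0∞} (hp : 1 ≤ p) :
    LpOpNormLE (orthantMeasure d) p (laguerreSemigroup (𝕜 := 𝕜) α t)
      (Real.cosh (2 * t) ^ (-(d : ℝ) / 2)) :=
  lpOpNormLE_laguerreSemigroup (fun i => by rcases hα i with h | h <;> linarith) ht
    (fun _ hx => lintegral_laguerreKernel_le_of_contractive hα (NNReal.coe_pos.2 ht) hx) hp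

lemma lpOpNormLE_laguerreSemigroup_one (hα : ∀ i, α i = -1 / 2 ∨ 1 / 2 ≤ α i)
    (t : ℝ≥0) {p : ℝ≥0∞} (hp : 1 ≤ p) :
    LpOpNormLE (orthantMeasure d) p (laguerreSemigroup (𝕜 := 𝕜) α t) 1 := by
  rcases eq_zero_or_pos t with rfl | ht
  · exact (LpOpNormLE.id p).congr fun f => by rw [laguerreSemigroup_zero]
  · exact (lpOpNormLE_laguerreSemigroup_of_contractive hα ht hp).mono (cosh_rpow_le_one d t)

lemma laguerreSemigroup_add_time (hα : ∀ i, -1 / 2 ≤ α i) {p : ℝ≥0∞} (hp : 1 ≤ p) (s t : ℝ≥0)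
    {f : (Fin d → ℝ) → 𝕜} (hf : MemLp f p (orthantMeasure d)) :
    laguerreSemigroup α (s + t) f =ᵐ[orthantMeasure d]
      laguerreSemigroup α s (laguerreSemigroup α t f) := by
  rcases eq_zero_or_pos s with rfl | hs
  · rw [zero_add, laguerreSemigroup_zero]
  rcases eq_zero_or_pos t with rfl | ht
  · rw [add_zero, laguerreSemigroup_zero]
  have hs' : (0 : ℝ) < s := NNReal.coe_pos.2 hs
  have ht' : (0 : ℝ) < t := NNReal.coe_pos.2 ht
  filter_upwards [ae_mem_orthant d] with x hx
  rw [laguerreSemigroup_eq_kernelOp hα (add_pos hs ht) f hx,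
    laguerreSemigroup_eq_kernelOp hα hs _ hx,
    kernelOp_congr (laguerreSemigroup_ae_eq hα ht f)]
  refine kernelOp_kernelOp (measurable_laguerreKernel α s) (measurable_laguerreKernel α t)
    (laguerreKernel_nonneg hα hs') (laguerreKernel_nonneg hα ht') hf.aestronglyMeasurable x ?_
    (integrable_laguerreKernel_smul hα (NNReal.coe_pos.2 (add_pos hs ht))
      (memL1AddLinfty_of_memLp hp hf) hx)
  filter_upwards [ae_mem_orthant d] with y hy
  rw [NNReal.coe_add]
  exact integral_laguerreKernel_mul hα hs' ht' hx hy

lemma MemL1AddLinfty.aestronglyMeasurable {X : Type*} [MeasurableSpace X] {μ : Measure X}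
    {f : X → 𝕜} (hf : MemL1AddLinfty μ f) : AEStronglyMeasurable f μ := by
  obtain ⟨g, h, hg, hh, rfl⟩ := hf
  exact hg.aestronglyMeasurable.add hh.aestronglyMeasurable

lemma tendsto_laguerreSemigroup_sub (hα : ∀ i, α i = -1 / 2 ∨ 1 / 2 ≤ α i)
    {f : (Fin d → ℝ) → 𝕜} (hf : MemLp f 2 (orthantMeasure d)) :
    Tendsto (fun t : ℝ≥0 => eLpNorm (laguerreSemigroup α t f - f) 2 (orthantMeasure d))
      (𝓝[>] 0) (𝓝 0) := by
  have hα' : ∀ i, -1 / 2 ≤ α i := fun i => by rcases hα i with h | h <;> linarith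
  rw [ENNReal.tendsto_nhds_zero]
  intro ε hε
  have hε3 : 0 < ε / 3 := ENNReal.div_pos hε.ne' (by norm_num)
  obtain ⟨s, hs⟩ := ((ENNReal.tendsto_nhds_zero.1
    (tendsto_eLpNorm_sub_laguerre_sum hα' hf)) (ε / 3) hε3).exists
  let u : (Fin d → ℕ) → (Fin d → ℝ) → 𝕜 := fun k x => laguerreHermite α k x • laguerreCoeff α f k
  have hu : ∀ k, MemLp (u k) 2 (orthantMeasure d) := fun k => by
    simp only [u, RCLike.real_smul_eq_coe_mul]
    exact (memLp_ofReal_laguerreHermite hα' k).mul_const _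
  have hP : Tendsto (fun t : ℝ≥0 => ∑ k ∈ s, ‖Real.exp (-t * laguerreEigenvalue α k) - 1‖ₑ *
      eLpNorm (u k) 2 (orthantMeasure d)) (𝓝[>] 0) (𝓝 0) := by
    have h0 : (0 : ℝ≥0∞) = ∑ k ∈ s, 0 * eLpNorm (u k) 2 (orthantMeasure d) := by simp
    refine (congrArg 𝓝 h0) ▸ ?_
    refine tendsto_finsetSum _ fun k _ => ?_
    refine ENNReal.Tendsto.mul_const ?_ (Or.inr (hu k).eLpNorm_ne_top)
    have hc : Continuous fun t : ℝ≥0 => ‖Real.exp (-t * laguerreEigenvalue α k) - 1‖ₑ := by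
      fun_prop
    exact (hc.tendsto' 0 0 (by simp)).mono_left nhdsWithin_le_nhds
  have hpos : ∀ᶠ t : ℝ≥0 in 𝓝[>] 0, 0 < t := self_mem_nhdsWithin
  filter_upwards [ENNReal.tendsto_nhds_zero.1 hP (ε / 3) hε3, hpos] with t ht1 ht
  have hM : ∀ x ∈ orthant d, ∫⁻ y, ENNReal.ofReal (laguerreKernel α t x y) ∂orthantMeasure d ≤
      ENNReal.ofReal 1 := fun x hx =>
    (lintegral_laguerreKernel_le_of_contractive hα (NNReal.coe_pos.2 ht) hx).trans
      (ENNReal.ofReal_le_ofReal (cosh_rpow_le_one d t))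
  have h1 := eLpNorm_laguerreSemigroup_sub_sum_le hα' ht hM hf s
  rw [ENNReal.ofReal_one, one_mul] at h1
  have hT := (lpOpNormLE_laguerreSemigroup_one hα t one_le_two f hf).1
  let A : (Fin d → ℝ) → 𝕜 := fun x => laguerreSemigroup α t f x - ∑ k ∈ s,
    (Real.exp (-t * laguerreEigenvalue α k) * laguerreHermite α k x) • laguerreCoeff α f k
  let B : (Fin d → ℝ) → 𝕜 := ∑ k ∈ s, (Real.exp (-t * laguerreEigenvalue α k) - 1) • u k
  let D : (Fin d → ℝ) → 𝕜 := fun x => f x - ∑ k ∈ s, laguerreHermite α k x • laguerreCoeff α f k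
  have hBm : ∀ k ∈ s, MemLp ((Real.exp (-t * laguerreEigenvalue α k) - 1) • u k) 2
      (orthantMeasure d) := fun k _ => (hu k).const_smul _
  have hB : MemLp B 2 (orthantMeasure d) := memLp_finsetSum' _ hBm
  have hD : MemLp D 2 (orthantMeasure d) := hf.sub (memLp_finsetSum _ fun k _ => hu k)
  -- With `P` a partial sum near `f`, the terms are `T_t (f - P)`, `T_t P - P` and `f - P`.
  -- Contractivity controls the first, and the second is a finite sum tending to zero with `t`.
  have e : laguerreSemigroup α t f - f = A + B - D := by
    funext x
    simp only [A, B, D, u, Pi.sub_apply, Pi.add_apply, Finset.sum_apply, Pi.smul_apply, smul_smul,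
      sub_smul, one_mul, Finset.sum_sub_distrib]
    ring
  have hA : MemLp A 2 (orthantMeasure d) := by
    have : A = (laguerreSemigroup α t f - f) - B + D := by rw [e]; ring
    rw [this]
    exact ((hT.sub hf).sub hB).add hD
  have hBle : eLpNorm B 2 (orthantMeasure d) ≤ ε / 3 := by
    refine (eLpNorm_sum_le (fun k hk => (hBm k hk).aestronglyMeasurable) one_le_two).trans ?_
    refine le_trans (Finset.sum_le_sum fun k _ => ?_) ht1
    rw [eLpNorm_const_smul]
  rw [e]
  calc eLpNorm (A + B - D) 2 (orthantMeasure d)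
      ≤ eLpNorm A 2 (orthantMeasure d) + eLpNorm B 2 (orthantMeasure d) +
        eLpNorm D 2 (orthantMeasure d) :=
        (eLpNorm_sub_le (hA.add hB).aestronglyMeasurable hD.aestronglyMeasurable one_le_two).trans
          (add_le_add_left (eLpNorm_add_le hA.aestronglyMeasurable hB.aestronglyMeasurable
            one_le_two) _)
    _ ≤ ε / 3 + ε / 3 + ε / 3 := add_le_add (add_le_add (h1.trans hs) hBle) hs
    _ = ε := ENNReal.add_thirds ε

lemma isSymmetricDiffusionSemigroup_laguerreSemigroup (hα : ∀ i, α i = -1 / 2 ∨ 1 / 2 ≤ α i) :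
    IsSymmetricDiffusionSemigroup (orthantMeasure d) (laguerreSemigroup (𝕜 := 𝕜) α) := by
  have hα' : ∀ i, -1 / 2 ≤ α i := fun i => by rcases hα i with h | h <;> linarith
  refine ⟨fun t f hf => ?_, fun t f g _ hfg => ?_, fun t f g hf hg => ?_, fun t c f hf => ?_,
    fun f _ => ?_, fun p hp t => lpOpNormLE_laguerreSemigroup_one hα t hp,
    fun p hp s t f hf => laguerreSemigroup_add_time hα' hp s t hf, fun t f g hf hg => ?_,
    fun f hf => tendsto_laguerreSemigroup_sub hα hf⟩
  · rcases eq_zero_or_pos t with rfl | ht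
    · rw [laguerreSemigroup_zero]
      exact hf.aestronglyMeasurable
    · exact (aestronglyMeasurable_kernelOp (measurable_laguerreKernel α t)
        hf.aestronglyMeasurable).congr (laguerreSemigroup_ae_eq hα' ht f).symm
  · rcases eq_zero_or_pos t with rfl | ht
    · rwa [laguerreSemigroup_zero, laguerreSemigroup_zero]
    · refine (laguerreSemigroup_ae_eq hα' ht f).trans ?_
      rw [kernelOp_congr hfg]
      exact (laguerreSemigroup_ae_eq hα' ht g).symm
  · rcases eq_zero_or_pos t with rfl | ht
    · simp only [laguerreSemigroup_zero]
      rfl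
    · filter_upwards [ae_mem_orthant d] with x hx
      rw [Pi.add_apply, laguerreSemigroup_eq_kernelOp hα' ht _ hx,
        laguerreSemigroup_eq_kernelOp hα' ht _ hx, laguerreSemigroup_eq_kernelOp hα' ht _ hx]
      have ht' := NNReal.coe_pos.2 ht
      simp only [kernelOp, Pi.add_apply, smul_add]
      exact integral_add (integrable_laguerreKernel_smul hα' ht' hf hx)
        (integrable_laguerreKernel_smul hα' ht' hg hx)
  · rcases eq_zero_or_pos t with rfl | ht
    · simp only [laguerreSemigroup_zero]
      rfl
    · filter_upwards [ae_mem_orthant d] with x hx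
      rw [Pi.smul_apply, laguerreSemigroup_eq_kernelOp hα' ht _ hx,
        laguerreSemigroup_eq_kernelOp hα' ht _ hx]
      simp only [kernelOp, Pi.smul_apply, smul_comm _ c]
      exact integral_smul c _
  · rw [laguerreSemigroup_zero]
  · rcases eq_zero_or_pos t with rfl | ht
    · simp only [laguerreSemigroup_zero]
    · have h := integral_conj_kernelOp_mul (measurable_laguerreKernel α t)
        (laguerreKernel_nonneg hα' (NNReal.coe_pos.2 ht)) (laguerreKernel_comm α t)
        ((ae_mem_orthant d).mono fun x hx =>
          lintegral_laguerreKernel_le_of_contractive hα (NNReal.coe_pos.2 ht) hx) hf hg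
      refine Eq.trans (integral_congr_ae ?_) (h.trans (integral_congr_ae ?_))
      · filter_upwards [laguerreSemigroup_ae_eq hα' ht f] with x hx
        simp only [hx]
      · filter_upwards [laguerreSemigroup_ae_eq hα' ht g] with x hx
        simp only [hx]

lemma isPositiveFamily_laguerreSemigroup (hα : ∀ i, -1 / 2 ≤ α i) :
    IsPositiveFamily (orthantMeasure d) (laguerreSemigroup (𝕜 := 𝕜) α) := by
  intro t f _ hf0
  rcases eq_zero_or_pos t with rfl | ht
  · rwa [laguerreSemigroup_zero]
  · filter_upwards [ae_mem_orthant d] with x hx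
    rw [laguerreSemigroup_eq_kernelOp hα ht _ hx]
    exact kernelOp_nonneg (laguerreKernel_nonneg hα (NNReal.coe_pos.2 ht)) hf0 x

lemma laguerreSemigroup_one (hα : ∀ i, -1 / 2 ≤ α i) {t : ℝ≥0} (ht : 0 < t) {x : Fin d → ℝ}
    (hx : x ∈ orthant d) : laguerreSemigroup α t (fun _ => (1 : 𝕜)) x =
      ((∫ y, laguerreKernel α t x y ∂orthantMeasure d : ℝ) : 𝕜) := by
  have h := kernelOp_ofReal (𝕜 := 𝕜) (μ := orthantMeasure d) (laguerreKernel α t) (fun _ => 1) x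
  simp only [RCLike.ofReal_one, mul_one] at h
  rw [laguerreSemigroup_eq_kernelOp hα ht _ hx, h]

lemma integral_laguerreKernel_le (hα : ∀ i, α i = -1 / 2 ∨ 1 / 2 ≤ α i) {t : ℝ} (ht : 0 < t)
    {x : Fin d → ℝ} (hx : x ∈ orthant d) :
    ∫ y, laguerreKernel α t x y ∂orthantMeasure d ≤ Real.cosh (2 * t) ^ (-(d : ℝ) / 2) := by
  have hα' : ∀ i, -1 / 2 ≤ α i := fun i => by rcases hα i with h | h <;> linarith
  have h := lintegral_laguerreKernel_le_of_contractive hα ht hx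
  rwa [← ofReal_integral_eq_lintegral_ofReal (integrable_laguerreKernel hα' ht hx)
    (Eventually.of_forall fun y => laguerreKernel_nonneg hα' ht x y),
    ENNReal.ofReal_le_ofReal_iff (Real.rpow_nonneg (Real.cosh_pos _).le _)] at h

lemma isSubmarkovianSemigroup_laguerreSemigroup (hα : ∀ i, α i = -1 / 2 ∨ 1 / 2 ≤ α i) :
    IsSubmarkovianSemigroup (orthantMeasure d) (laguerreSemigroup (𝕜 := 𝕜) α) := by
  have hα' : ∀ i, -1 / 2 ≤ α i := fun i => by rcases hα i with h | h <;> linarith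
  refine ⟨isSymmetricDiffusionSemigroup_laguerreSemigroup hα,
    isPositiveFamily_laguerreSemigroup hα', fun t => ?_⟩
  rcases eq_zero_or_pos t with rfl | ht
  · simp [laguerreSemigroup_zero]
  · filter_upwards [ae_mem_orthant d] with x hx
    rw [laguerreSemigroup_one hα' ht hx, ← RCLike.ofReal_one (K := 𝕜), RCLike.ofReal_le_ofReal]
    exact (integral_laguerreKernel_le hα (NNReal.coe_pos.2 ht) hx).trans (cosh_rpow_le_one d t)

lemma not_isMarkovianSemigroup_laguerreSemigroup (hd : 1 ≤ d)
    (hα : ∀ i, α i = -1 / 2 ∨ 1 / 2 ≤ α i) :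
    ¬ IsMarkovianSemigroup (orthantMeasure d) (laguerreSemigroup (𝕜 := 𝕜) α) := by
  have hα' : ∀ i, -1 / 2 ≤ α i := fun i => by rcases hα i with h | h <;> linarith
  rintro ⟨-, -, h⟩
  obtain ⟨x, hx, hx1⟩ := exists_mem_of_ae_orthantMeasure (isOpen_orthant d) (orthant_nonempty d)
    subset_rfl (h 1)
  rw [laguerreSemigroup_one hα' one_pos hx, ← RCLike.ofReal_one (K := 𝕜), RCLike.ofReal_inj] at hx1
  have h1 := integral_laguerreKernel_le hα (t := ((1 : ℝ≥0) : ℝ)) (by simp) hx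
  rw [hx1] at h1
  -- At time one the mass bound is strictly below one; this is where `d ≥ 1` enters.
  have h2 : Real.cosh (2 * ((1 : ℝ≥0) : ℝ)) ^ (-(d : ℝ) / 2) < 1 :=
    Real.rpow_lt_one_of_one_lt_of_neg (Real.one_lt_cosh.2 (by simp)) (by
      have : (1 : ℝ) ≤ d := by exact_mod_cast hd
      linarith)
  exact absurd h1 (not_le.2 h2)

/-- An `L^∞`-contractive Laguerre semigroup has kernels of mass at most one. -/
lemma ae_lintegral_laguerreKernel_le_one (hα : ∀ i, -1 / 2 ≤ α i)
    (h : IsLpContractiveSemigroup (orthantMeasure d) (laguerreSemigroup (𝕜 := 𝕜) α))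
    {t : ℝ≥0} (ht : 0 < t) : ∀ᵐ x ∂orthantMeasure d,
      ∫⁻ y, ENNReal.ofReal (laguerreKernel α t x y) ∂orthantMeasure d ≤ 1 := by
  -- Contractivity is tested only on `L² ∩ L^∞`, and for `d ≥ 1` this excludes the constant one; it
  -- is approximated by indicators of growing cubes.
  let Q : ℕ → Set (Fin d → ℝ) := fun n => Set.univ.pi fun _ => Set.Ioo (-(n : ℝ)) n
  have hQm : ∀ n, MeasurableSet (Q n) := fun n => MeasurableSet.univ_pi fun _ => measurableSet_Ioo
  have hQfin : ∀ n, orthantMeasure d (Q n) ≠ ∞ := fun n => by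
    refine ((Measure.restrict_apply_le _ _).trans_lt ?_).ne
    rw [Real.volume_pi_Ioo]
    exact ENNReal.prod_lt_top fun _ _ => ENNReal.ofReal_lt_top
  let g : ℕ → (Fin d → ℝ) → ℝ := fun n => (Q n).indicator fun _ => 1
  have hg : ∀ n (p : ℝ≥0∞), MemLp (g n) p (orthantMeasure d) := fun n p =>
    memLp_indicator_const p (hQm n) 1 (Or.inr (hQfin n))
  have hg1 : ∀ n y, ‖g n y‖ ≤ 1 := fun n y => by
    refine (norm_indicator_le_norm_self (fun _ => (1 : ℝ)) y).trans ?_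
    simp
  have hbound : ∀ᵐ x ∂orthantMeasure d, ∀ n,
      ‖laguerreSemigroup α t (fun y => ((g n y : ℝ) : 𝕜)) x‖ ≤ 1 := by
    rw [ae_all_iff]
    intro n
    have h1 := h ∞ le_top t _ (hg n 2).ofReal (hg n ∞).ofReal
    have h2 : eLpNorm (fun y => ((g n y : ℝ) : 𝕜)) ∞ (orthantMeasure d) ≤ 1 := by
      rw [eLpNorm_exponent_top]
      refine eLpNormEssSup_le_of_ae_enorm_bound (Eventually.of_forall fun y => ?_)
      rw [← ofReal_norm, RCLike.norm_ofReal]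
      exact ENNReal.ofReal_le_one.2 (hg1 n y)
    have h3 := h1.trans h2
    rw [eLpNorm_exponent_top] at h3
    filter_upwards [ae_le_eLpNormEssSup (f := laguerreSemigroup α t
      (fun y => ((g n y : ℝ) : 𝕜))) (μ := orthantMeasure d)] with x hx
    rw [← ENNReal.ofReal_le_one, ofReal_norm]
    exact hx.trans h3
  filter_upwards [hbound, ae_mem_orthant d] with x hb hx
  have hK := integrable_laguerreKernel hα (NNReal.coe_pos.2 ht) hx
  have hle : ∀ n, ∫ y, laguerreKernel α t x y * g n y ∂orthantMeasure d ≤ 1 := fun n => by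
    have h1 := hb n
    rw [laguerreSemigroup_eq_kernelOp hα ht _ hx, kernelOp_ofReal, RCLike.norm_ofReal] at h1
    exact (le_abs_self _).trans h1
  have hlim : Tendsto (fun n => ∫ y, laguerreKernel α t x y * g n y ∂orthantMeasure d) atTop
      (𝓝 (∫ y, laguerreKernel α t x y ∂orthantMeasure d)) := by
    refine tendsto_integral_of_dominated_convergence (fun y => ‖laguerreKernel α t x y‖)
      (fun n => hK.aestronglyMeasurable.mul (hg n 1).aestronglyMeasurable) hK.norm
      (fun n => Eventually.of_forall fun y => ?_) (Eventually.of_forall fun y => ?_)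
    · rw [norm_mul]
      exact mul_le_of_le_one_right (norm_nonneg _) (hg1 n y)
    · refine tendsto_const_nhds.congr' ?_
      obtain ⟨N, hN⟩ := exists_nat_gt ‖y‖
      filter_upwards [eventually_ge_atTop N] with n hn
      have hy : y ∈ Q n := fun i _ => by
        rw [Set.mem_Ioo, ← abs_lt]
        exact ((norm_le_pi_norm y i).trans_lt hN).trans_le (by exact_mod_cast hn)
      simp only [g, Set.indicator_of_mem hy, mul_one]
  rw [← ofReal_integral_eq_lintegral_ofReal hK
    (Eventually.of_forall fun y => laguerreKernel_nonneg hα (NNReal.coe_pos.2 ht) x y),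
    ENNReal.ofReal_le_one]
  exact le_of_tendsto' hlim hle

lemma not_isLpContractiveSemigroup_laguerreSemigroup (hα : ∀ i, -1 / 2 ≤ α i)
    (hi : ∃ i, -1 / 2 < α i ∧ α i < 1 / 2) :
    ¬ IsLpContractiveSemigroup (orthantMeasure d) (laguerreSemigroup (𝕜 := 𝕜) α) := by
  intro h
  obtain ⟨t, ht, U, hUo, hUne, hUsub, hU⟩ := exists_one_lt_lintegral_laguerreKernel hα hi
  lift t to ℝ≥0 using ht.le
  obtain ⟨x, hxU, hx⟩ := exists_mem_of_ae_orthantMeasure hUo hUne hUsub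
    (ae_lintegral_laguerreKernel_le_one hα h (NNReal.coe_pos.1 ht))
  exact absurd hx (not_le.2 (hU x hxU))

end

end

theorem mainTheorem1 {𝕜 : Type*} [RCLike 𝕜] {d : ℕ} (hd : 1 ≤ d) (α : Fin d → ℝ)
    (hα : ∀ i, -1 / 2 ≤ α i) :
    -- the operators are well defined on `L¹ + L^∞` and coincide with `exp(-tL)` on `L²`
    (∀ t : ℝ≥0, 0 < t → ∀ x ∈ orthant d, ∀ y ∈ orthant d,
      Summable (laguerreKernelTerm α t x y)) ∧
    (∀ t : ℝ≥0, 0 < t → ∀ f : (Fin d → ℝ) → 𝕜, MemL1AddLinfty (orthantMeasure d) f →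
      ∀ x ∈ orthant d,
        Integrable (fun y => laguerreHeatKernel α t x y • f y) (orthantMeasure d)) ∧
    (∀ t : ℝ≥0, ∀ f : (Fin d → ℝ) → 𝕜, MemLp f 2 (orthantMeasure d) →
      IsSpectralHeatFlow α t f (laguerreSemigroup α t f)) ∧
    -- contractive range
    ((∀ i, α i = -1 / 2 ∨ 1 / 2 ≤ α i) →
      IsSubmarkovianSemigroup (orthantMeasure d) (laguerreSemigroup (𝕜 := 𝕜) α) ∧
      ¬ IsMarkovianSemigroup (orthantMeasure d) (laguerreSemigroup (𝕜 := 𝕜) α) ∧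
      ∀ p : ℝ≥0∞, 1 ≤ p → ∀ t : ℝ≥0, 0 < t →
        LpOpNormLE (orthantMeasure d) p (laguerreSemigroup (𝕜 := 𝕜) α t)
          (Real.cosh (2 * t) ^ (-(d : ℝ) / 2))) ∧
    -- non-contractive range
    ((∃ i, -1 / 2 < α i ∧ α i < 1 / 2) →
      ¬ IsLpContractiveSemigroup (orthantMeasure d) (laguerreSemigroup (𝕜 := 𝕜) α) ∧
      ∃ c : ℝ, 1 < c ∧ ∀ p : ℝ≥0∞, 1 ≤ p → ∀ t : ℝ≥0, 0 < t →
        LpOpNormLE (orthantMeasure d) p (laguerreSemigroup (𝕜 := 𝕜) α t)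
          (c * Real.cosh (2 * t) ^ (-(d : ℝ) / 2))) := by
  refine ⟨fun t ht x hx y hy => (hasSum_laguerreKernelTerm hα (NNReal.coe_pos.2 ht) hx hy).summable,
    fun t ht f hf x hx => ?_, fun t f hf => isSpectralHeatFlow_laguerreSemigroup hα t hf,
    fun hα' => ⟨isSubmarkovianSemigroup_laguerreSemigroup hα',
      not_isMarkovianSemigroup_laguerreSemigroup hd hα',
      fun p hp t ht => lpOpNormLE_laguerreSemigroup_of_contractive hα' ht hp⟩,
    fun hi => ⟨not_isLpContractiveSemigroup_laguerreSemigroup hα hi, ?_⟩⟩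
  · refine (integrable_laguerreKernel_smul hα (NNReal.coe_pos.2 ht) hf hx).congr ?_
    filter_upwards [ae_mem_orthant d] with y hy
    rw [laguerreHeatKernel_eq hα (NNReal.coe_pos.2 ht) hx hy]
  · obtain ⟨c, hc1, hc⟩ := exists_lintegral_laguerreKernel_le hα
    exact ⟨c, hc1, fun p hp t ht =>
      lpOpNormLE_laguerreSemigroup hα ht (hc t (NNReal.coe_pos.2 ht)) hp⟩
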